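/- Path-integral action for $\bar\alpha$-Langevin dynamics. Let $d,m\ge 0$ be integers, $t\in\mathbb R$, $T>0$, and for $s\in[t,t+T]$ let $F_{\bar\alpha}(\cdot,s):\mathbb R^d\to\mathbb R^d$ be $C^1$ with bounded first derivatives and $b(\cdot,s)=(b^{i\mu}):\mathbb R^d\to\mathbb R^{d\times m}$ be $C^2$ and bounded together with its first and second derivatives (all bounds uniform in $s$); let $F_{\bar\alpha}$, $b$ and $\partial_k b$ be jointly continuous in $(x,s)$, and let $B^{ij}=\frac12\sum_\mu b^{i\mu}b^{j\mu}$ be uniformly elliptic. Repeated indices are summed. Fix $\alpha,\bar\alpha,\theta\in[0,1]$ and a starting point $x\in\mathbb R^d$ at time $t$; for an end point $x_1$ put $\Delta x=x_1-x$, $x_\alpha=x+\alpha\Delta x$, $x_\theta=x+\theta\Delta x$. Consider the $\bar\alpha$-Langevin equation $dx^i=F_{\bar\alpha}^i\,dt+b^{i\mu}\otimes_{\bar\alpha}dW_\mu$, where $b^{i\mu}\otimes_{\bar\alpha}dW_\mu=b^{i\mu}(x+\bar\alpha\,dx,t)\,dW_\mu$. Two families (indexed by small $h>0$) of measures $G_h(dx_1)$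 are called equivalent if for all small $h$ all moments $\int\Delta x^{i_1}\cdots\Delta x^{i_M}\,G_h(dx_1)$, $M\ge 0$, exist for both families, and each of them agrees for the two families up to $o(h)$ as $h\to0^+$. Let $S_h$ be the measure $$S_h(dx_1)=\frac{d^dx_1}{\sqrt{(4\pi h)^d\det B(x_\alpha)}}\exp\Big\{-\frac{1}{4h}u^i\,B^{-1}_{ij}(x_\alpha)\,u^j+h\big(-\alpha\,\partial_iF_{\bar\alpha}^i-\alpha\bar\alpha\,\partial_i(b^{k\mu}\partial_kb^{i\mu})+\alpha^2\partial_i\partial_jB^{ij}\big)(x_\theta)\Big\},$$ $$u^i=\Delta x^i-h\,F_{\bar\alpha}^i(x_\alpha)-h\,\big(\bar\alpha\,b^{k\mu}\partial_kb^{i\mu}-2\alpha\,\partial_kB^{ik}\big)(x_\alpha),$$ all functions being taken at time $t$ (the last bracket is the spurious drift; $\theta=\alpha$ is the form in which all functions are evaluated at $x_\alpha$). Then: 1. If for each $h\in(0,T]$ the random increment $dx$ satisfies $dx^i=F_{\bar\alpha}^i(x,t)\,h+b^{i\mu}(x+\bar\alpha\,dx,t)\,dW_\mu$ almost surely, where $dW$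 is a centred Gaussian vector in $\mathbb R^m$ with $\langle dW_\mu dW_\nu\rangle=\delta_{\mu\nu}h$, then the law of $x_1=x+dx$ is equivalent to $S_h$. 2. Let $F^i=F_{\bar\alpha}^i+\bar\alpha\,b^{k\mu}\partial_kb^{i\mu}$ be the corresponding Ito drift. If probability measures $G_h$, $0\le h\le T$, on $\mathbb R^d$ form a weak solution of the Fokker–Planck equation $\partial_hG_h=-\partial_i(F^iG_h)+\partial_i\partial_j(B^{ij}G_h)$ (coefficients at time $t+h$) with $G_0=\delta_x$, i.e. if $G_h$ is the exact Green's function of the dynamics, then $G_h$ is equivalent to $S_h$. 3. The Gaussian measure $\dfrac{d^dx_1}{\sqrt{(4\pi h)^d\det B(x)}}\exp\{-\frac1{4h}(\Delta x^i-F^i(x)h)B^{-1}_{ij}(x)(\Delta x^j-F^j(x)h)\}$, with $F$ as in 2 and all functions taken at time $t$, is equivalent to $S_h$. 4. For $\alpha=\bar\alpha=\frac12$, writing $F_S=F_{1/2}$, the density of $S_h$ is for every $h>0$ and $x_1$ equal to the Stratonovich form $$\frac{1}{\sqrt{(4\pi h)^d\det B(x_{1/2})}}\exp\Big\{-\frac1{4h}w^iB^{-1}_{ij}(x_{1/2})w^j-\frac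 h2\partial_iF_S^i(x_\theta)+\frac h8\big((\partial_ib^{i\mu})(\partial_jb^{j\mu})-(\partial_ib^{j\mu})(\partial_jb^{i\mu})\big)(x_\theta)\Big\},$$ $$w^i=\Delta x^i-h\,F_S^i(x_{1/2})+\tfrac h2\,\big(b^{i\mu}\partial_kb^{k\mu}\big)(x_{1/2}).$$ -/

import Mathlib

open Set Filter Topology MeasureTheory ProbabilityTheory Asymptotics
open scoped Matrix

noncomputable section

/-- The partial derivative `∂_k f (x)` of a scalar function on `ℝ^d`. -/
def partialD {d : ℕ} (k : Fin d) (f : (Fin d → ℝ) → ℝ) (x : Fin d → ℝ) : ℝ :=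
  fderiv ℝ f x (Pi.single k 1)

/-- The diffusion matrix `B^{ij} = (1/2) ∑_μ b^{iμ} b^{jμ}`. -/
def diffusionB {d m : ℕ} (b : (Fin d → ℝ) → Fin d → Fin m → ℝ) (x : Fin d → ℝ) :
    Matrix (Fin d) (Fin d) ℝ :=
  Matrix.of fun i j => (1 / 2) * ∑ μ, b x i μ * b x j μ

/-- The vector field `∑_{k, μ} b^{kμ} ∂_k b^{iμ}`. -/
def noiseDrift {d m : ℕ} (b : (Fin d → ℝ) → Fin d → Fin m → ℝ) (x : Fin d → ℝ) (i : Fin d) : ℝ :=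
  ∑ k, ∑ μ, b x k μ * partialD k (fun y => b y i μ) x

/-- The Ito drift `F = F_ᾱ + ᾱ b^{kμ} ∂_k b^{iμ}` that corresponds to the `ᾱ`-drift `F_ᾱ`. -/
def itoDrift {d m : ℕ} (αb : ℝ) (F : (Fin d → ℝ) → Fin d → ℝ)
    (b : (Fin d → ℝ) → Fin d → Fin m → ℝ) (x : Fin d → ℝ) (i : Fin d) : ℝ :=
  F x i + αb * noiseDrift b x i

/-- The spurious drift `ᾱ b^{kμ} ∂_k b^{iμ} - 2 α ∂_k B^{ik}`. -/
def spuriousDrift {d m : ℕ} (α αb : ℝ) (b : (Fin d → ℝ) → Fin d → Fin m → ℝ)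
    (x : Fin d → ℝ) (i : Fin d) : ℝ :=
  αb * noiseDrift b x i - 2 * α * ∑ k, partialD k (fun y => diffusionB b y i k) x

/-- The quadratic form `u^i (B⁻¹)_{ij} u^j / (4 h)` with `B` evaluated at `y`. -/
def kineticTerm {d m : ℕ} (b : (Fin d → ℝ) → Fin d → Fin m → ℝ) (h : ℝ)
    (y u : Fin d → ℝ) : ℝ :=
  (u ⬝ᵥ ((diffusionB b y)⁻¹ *ᵥ u)) / (4 * h)

/-- The prefactor `1 / √((4 π h)^d det B(y))`. -/
def slicePrefactor {d m : ℕ} (b : (Fin d → ℝ) → Fin d → Fin m → ℝ) (h : ℝ)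
    (y : Fin d → ℝ) : ℝ :=
  1 / Real.sqrt ((4 * Real.pi * h) ^ d * (diffusionB b y).det)

/-- The extra terms (per unit of time) in the exponent,
`- α ∂_i F_ᾱ^i - α ᾱ ∂_i (b^{kμ} ∂_k b^{iμ}) + α² ∂_i ∂_j B^{ij}`, at the point `z`. -/
def extraTerms {d m : ℕ} (α αb : ℝ) (F : (Fin d → ℝ) → Fin d → ℝ)
    (b : (Fin d → ℝ) → Fin d → Fin m → ℝ) (z : Fin d → ℝ) : ℝ :=
  - α * ∑ i, partialD i (fun y => F y i) z
    - α * αb * ∑ i, partialD i (fun y => noiseDrift b y i) z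
    + α ^ 2 * ∑ i, ∑ j, partialD i (partialD j (fun y => diffusionB b y i j)) z

/-- The `(α, ᾱ)`-form of the time-slice density, as a function of the end point `x₁`.
Prefactor and quadratic form are evaluated at `x_α = x + α (x₁ - x)`, and the extra terms,
which are linear in `h`, at `x_θ = x + θ (x₁ - x)`. -/
def sliceDensity {d m : ℕ} (α αb θ : ℝ) (F : (Fin d → ℝ) → Fin d → ℝ)
    (b : (Fin d → ℝ) → Fin d → Fin m → ℝ) (h : ℝ) (x x₁ : Fin d → ℝ) : ℝ :=
  slicePrefactor b h (x + α • (x₁ - x)) *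
    Real.exp (- kineticTerm b h (x + α • (x₁ - x))
        (fun i => (x₁ - x) i - F (x + α • (x₁ - x)) i * h
          - spuriousDrift α αb b (x + α • (x₁ - x)) i * h)
      + extraTerms α αb F b (x + θ • (x₁ - x)) * h)

/-- The Stratonovich form of the time-slice density: drift `F_S^i - (1/2) b^{iμ} ∂_k b^{kμ}`, and
the extra terms `- (1/2) ∂_i F_S^i + (1/8) ((∂_i b^{iμ}) (∂_j b^{jμ}) - (∂_i b^{jμ}) (∂_j b^{iμ}))`
evaluated at `x_θ`; everything else is evaluated at the midpoint. -/
def stratonovichDensity {d m : ℕ} (θ : ℝ) (F : (Fin d → ℝ) → Fin d → ℝ)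
    (b : (Fin d → ℝ) → Fin d → Fin m → ℝ) (h : ℝ) (x x₁ : Fin d → ℝ) : ℝ :=
  let y := x + (1 / 2 : ℝ) • (x₁ - x)
  let z := x + θ • (x₁ - x)
  slicePrefactor b h y *
    Real.exp (- kineticTerm b h y
        (fun i => (x₁ - x) i - F y i * h
          + (1 / 2) * (∑ k, ∑ μ, b y i μ * partialD k (fun w => b w k μ) y) * h)
      - h / 2 * ∑ i, partialD i (fun w => F w i) z
      + h / 8 * ∑ i, ∑ j, ∑ μ,
          (partialD i (fun w => b w i μ) z * partialD j (fun w => b w j μ) z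
            - partialD i (fun w => b w j μ) z * partialD j (fun w => b w i μ) z))

/-- The Gaussian time-slice density of the Ito equation with drift `F`: all functions are
evaluated at the initial point. -/
def itoDensity {d m : ℕ} (F : (Fin d → ℝ) → Fin d → ℝ)
    (b : (Fin d → ℝ) → Fin d → Fin m → ℝ) (h : ℝ) (x x₁ : Fin d → ℝ) : ℝ :=
  slicePrefactor b h x * Real.exp (- kineticTerm b h x (fun i => (x₁ - x) i - F x i * h))

/-- The measure `p(x₁) d^d x₁`. -/
def densityMeasure {d : ℕ} (p : (Fin d → ℝ) → ℝ) : Measure (Fin d → ℝ) :=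
  volume.withDensity fun x₁ => ENNReal.ofReal (p x₁)

/-- The monomial `Δx^{i_1} ⋯ Δx^{i_M}` in `Δx = x₁ - x`. -/
def incrementMonomial {d M : ℕ} (x : Fin d → ℝ) (I : Fin M → Fin d) (x₁ : Fin d → ℝ) : ℝ :=
  ∏ k, (x₁ (I k) - x (I k))

/-- Two families of measures (indexed by the length `h > 0` of the time slice) for the end point
of a slice that starts at `x` are equivalent if for small `h` all moments of `Δx` exist, and all
of them, including the one of order zero, agree up to `o(h)`. -/
def MomentEquivalent {d : ℕ} (x : Fin d → ℝ) (G₁ G₂ : ℝ → Measure (Fin d → ℝ)) : Prop :=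
  (∀ᶠ h in 𝓝[>] (0 : ℝ), ∀ (M : ℕ) (I : Fin M → Fin d),
    Integrable (incrementMonomial x I) (G₁ h) ∧ Integrable (incrementMonomial x I) (G₂ h)) ∧
  ∀ (M : ℕ) (I : Fin M → Fin d),
    (fun h => (∫ x₁, incrementMonomial x I x₁ ∂(G₁ h)) - ∫ x₁, incrementMonomial x I x₁ ∂(G₂ h))
      =o[𝓝[>] 0] fun h => h

/-- Regularity of the drift `F(s, y)` and the noise amplitudes `b(s, y)` for the times
`t ≤ s ≤ t + T`: the derivatives in `y` that the action contains exist, are continuous and are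
bounded, `b` is bounded, and `B` is uniformly elliptic. The drift itself may be unbounded. -/
structure RegularCoefficients {d m : ℕ} (t T : ℝ) (F : ℝ → (Fin d → ℝ) → Fin d → ℝ)
    (b : ℝ → (Fin d → ℝ) → Fin d → Fin m → ℝ) : Prop where
  F_contDiff : ∀ s ∈ Icc t (t + T), ContDiff ℝ 1 (F s)
  b_contDiff : ∀ s ∈ Icc t (t + T), ContDiff ℝ 2 (b s)
  F_continuousOn : ContinuousOn (fun p : ℝ × (Fin d → ℝ) => F p.1 p.2) (Icc t (t + T) ×ˢ univ)
  b_continuousOn : ContinuousOn (fun p : ℝ × (Fin d → ℝ) => b p.1 p.2) (Icc t (t + T) ×ˢ univ)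
  fderiv_b_continuousOn : ContinuousOn
    (fun p : ℝ × (Fin d → ℝ) => fderiv ℝ (b p.1) p.2) (Icc t (t + T) ×ˢ univ)
  bounded : ∃ C : ℝ, ∀ s ∈ Icc t (t + T), ∀ y,
    ‖fderiv ℝ (F s) y‖ ≤ C ∧ ‖b s y‖ ≤ C ∧ ‖fderiv ℝ (b s) y‖ ≤ C ∧
      ‖fderiv ℝ (fderiv ℝ (b s)) y‖ ≤ C
  elliptic : ∃ lam : ℝ, 0 < lam ∧ ∀ s ∈ Icc t (t + T), ∀ y v : Fin d → ℝ,
    lam * ∑ i, v i ^ 2 ≤ v ⬝ᵥ (diffusionB (b s) y *ᵥ v)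

/-- `dx h` is, for every slice length `h ∈ (0, T]`, an increment during `(t, t + h)` of the
`ᾱ`-Langevin equation `dx = F dt + b ⊗_ᾱ dW` from the point `x`: with the Wiener increment
`dW h`, a centred Gaussian vector of covariance `h • 1`,
`dx^i = F^i(x, t) h + ∑_μ b^{iμ}(x + ᾱ dx, t) dW_μ`. For `ᾱ ≠ 0` the equation is implicit. -/
structure IsLangevinIncrement {d m : ℕ} {Ω : Type*} [MeasurableSpace Ω] (αb t T : ℝ)
    (F : ℝ → (Fin d → ℝ) → Fin d → ℝ) (b : ℝ → (Fin d → ℝ) → Fin d → Fin m → ℝ)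
    (x : Fin d → ℝ) (P : Measure Ω) (dW : ℝ → Ω → Fin m → ℝ) (dx : ℝ → Ω → Fin d → ℝ) :
    Prop where
  dW_aemeasurable : ∀ h ∈ Ioc 0 T, AEMeasurable (dW h) P
  dW_law : ∀ h ∈ Ioc 0 T,
    P.map (dW h) = Measure.pi fun _ : Fin m => gaussianReal 0 (Real.toNNReal h)
  dx_aemeasurable : ∀ h ∈ Ioc 0 T, AEMeasurable (dx h) P
  equation : ∀ h ∈ Ioc 0 T, ∀ᵐ ω ∂P, ∀ i,
    dx h ω i = F t x i * h + ∑ μ, b t (x + αb • dx h ω) i μ * dW h ω μ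

/-- The operator `F^i ∂_i + B^{ij} ∂_i ∂_j`, the formal adjoint of the Fokker-Planck operator
`p ↦ - ∂_i (F^i p) + ∂_i ∂_j (B^{ij} p)`. -/
def fokkerPlanckAdjoint {d m : ℕ} (F : (Fin d → ℝ) → Fin d → ℝ)
    (b : (Fin d → ℝ) → Fin d → Fin m → ℝ) (f : (Fin d → ℝ) → ℝ) (y : Fin d → ℝ) : ℝ :=
  (∑ i, F y i * partialD i f y) + ∑ i, ∑ j, diffusionB b y i j * partialD i (partialD j f) y

/-- `G h`, for `0 ≤ h ≤ T`, is the transition probability from `x` at time `t` to time `t + h` of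
the dynamics with Ito drift `F` and noise amplitudes `b`: it is a weak solution of the
Fokker-Planck equation, with a unit mass at `x` as initial value. -/
structure IsFokkerPlanckGreen {d m : ℕ} (t T : ℝ) (F : ℝ → (Fin d → ℝ) → Fin d → ℝ)
    (b : ℝ → (Fin d → ℝ) → Fin d → Fin m → ℝ) (x : Fin d → ℝ)
    (G : ℝ → Measure (Fin d → ℝ)) : Prop where
  isProbabilityMeasure : ∀ h ∈ Icc 0 T, IsProbabilityMeasure (G h)
  intervalIntegrable : ∀ f : (Fin d → ℝ) → ℝ, ContDiff ℝ ((⊤ : ℕ∞) : WithTop ℕ∞) f → HasCompactSupport f →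
    IntervalIntegrable (fun s => ∫ y, fokkerPlanckAdjoint (F (t + s)) (b (t + s)) f y ∂(G s))
      volume 0 T
  weak_solution : ∀ f : (Fin d → ℝ) → ℝ, ContDiff ℝ ((⊤ : ℕ∞) : WithTop ℕ∞) f → HasCompactSupport f →
    ∀ h ∈ Icc 0 T, ∫ y, f y ∂(G h) =
      f x + ∫ s in (0 : ℝ)..h, ∫ y, fokkerPlanckAdjoint (F (t + s)) (b (t + s)) f y ∂(G s)

end

noncomputable section

/-! ### Partial derivatives -/

section PartialDerivatives

variable {d : ℕ}

lemma partialD_const (k : Fin d) (c : ℝ) : partialD k (fun _ => c) = fun _ => 0 := by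
  funext y; simp [partialD]

lemma partialD_add {f g : (Fin d → ℝ) → ℝ} (k : Fin d) {y : Fin d → ℝ}
    (hf : DifferentiableAt ℝ f y) (hg : DifferentiableAt ℝ g y) :
    partialD k (fun z => f z + g z) y = partialD k f y + partialD k g y := by
  simp only [partialD]
  rw [show (fun z => f z + g z) = f + g from rfl, fderiv_add hf hg]; rfl

lemma partialD_sub {f g : (Fin d → ℝ) → ℝ} (k : Fin d) {y : Fin d → ℝ}
    (hf : DifferentiableAt ℝ f y) (hg : DifferentiableAt ℝ g y) :
    partialD k (fun z => f z - g z) y = partialD k f y - partialD k g y := by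
  simp only [partialD]
  rw [show (fun z => f z - g z) = f - g from rfl, fderiv_sub hf hg]; rfl

lemma partialD_mul {f g : (Fin d → ℝ) → ℝ} (k : Fin d) {y : Fin d → ℝ}
    (hf : DifferentiableAt ℝ f y) (hg : DifferentiableAt ℝ g y) :
    partialD k (fun z => f z * g z) y = partialD k f y * g y + f y * partialD k g y := by
  simp only [partialD]
  rw [show (fun z => f z * g z) = f * g from rfl, fderiv_mul hf hg]
  simp only [_root_.add_apply, _root_.smul_apply, smul_eq_mul]; ring

lemma partialD_const_mul {f : (Fin d → ℝ) → ℝ} (k : Fin d) {y : Fin d → ℝ} (c : ℝ)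
    (hf : DifferentiableAt ℝ f y) :
    partialD k (fun z => c * f z) y = c * partialD k f y := by
  rw [partialD_mul k (differentiableAt_const c) hf, partialD_const]; ring

lemma partialD_sum {ι : Type*} (s : Finset ι) {f : ι → (Fin d → ℝ) → ℝ} (k : Fin d)
    {y : Fin d → ℝ} (hf : ∀ a ∈ s, DifferentiableAt ℝ (f a) y) :
    partialD k (fun z => ∑ a ∈ s, f a z) y = ∑ a ∈ s, partialD k (f a) y := by
  simp only [partialD]
  rw [show (fun z => ∑ a ∈ s, f a z) = ∑ a ∈ s, f a by ext; simp, fderiv_sum hf]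
  simp

lemma HasDerivAt.partialD_comp {φ : ℝ → ℝ} {φ' : ℝ} {f : (Fin d → ℝ) → ℝ} (k : Fin d)
    {y : Fin d → ℝ} (hφ : HasDerivAt φ φ' (f y)) (hf : DifferentiableAt ℝ f y) :
    partialD k (fun z => φ (f z)) y = φ' * partialD k f y := by
  simp only [partialD]
  rw [show (fun z => φ (f z)) = φ ∘ f from rfl,
    (hφ.hasFDerivAt.comp y hf.hasFDerivAt).fderiv]
  simp [mul_comm]

lemma fderiv_apply_eq_sum_partialD (f : (Fin d → ℝ) → ℝ) (y v : Fin d → ℝ) :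
    fderiv ℝ f y v = ∑ k, v k * partialD k f y := by
  conv_lhs => rw [pi_eq_sum_univ' v]
  simp only [map_sum, map_smul, smul_eq_mul, partialD]

/-- Along a line, the derivative is the directional derivative. -/
lemma DifferentiableAt.hasDerivAt_line {f : (Fin d → ℝ) → ℝ} {y v : Fin d → ℝ} {τ : ℝ}
    (hf : DifferentiableAt ℝ f (y + τ • v)) :
    HasDerivAt (fun s : ℝ => f (y + s • v)) (∑ k, v k * partialD k f (y + τ • v)) τ := by
  rw [← fderiv_apply_eq_sum_partialD]
  have h1 : HasDerivAt (fun s : ℝ => y + s • v) v τ := by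
    simpa using ((hasDerivAt_id τ).smul_const v).const_add y
  exact hf.hasFDerivAt.comp_hasDerivAt τ h1

end PartialDerivatives

/-! ### Functions with bounded continuous partial derivatives -/

section BoundedDerivatives

variable {d : ℕ}

/-- `f` and its partial derivatives up to order `n` are continuous and bounded. -/
def BddC : ℕ → ((Fin d → ℝ) → ℝ) → Prop
  | 0, f => Continuous f ∧ ∃ C, ∀ y, |f y| ≤ C
  | n + 1, f => Differentiable ℝ f ∧ (∃ C, ∀ y, |f y| ≤ C) ∧ ∀ i, BddC n (partialD i f)

namespace BddC

lemma continuous {n : ℕ} {f : (Fin d → ℝ) → ℝ} (hf : BddC n f) : Continuous f := by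
  cases n with
  | zero => exact hf.1
  | succ n => exact hf.1.continuous

lemma bound {n : ℕ} {f : (Fin d → ℝ) → ℝ} (hf : BddC n f) : ∃ C, ∀ y, |f y| ≤ C := by
  cases n with
  | zero => exact hf.2
  | succ n => exact hf.2.1

lemma exists_pos_bound {n : ℕ} {f : (Fin d → ℝ) → ℝ} (hf : BddC n f) :
    ∃ C, 0 < C ∧ ∀ y, |f y| ≤ C := by
  obtain ⟨C, hC⟩ := hf.bound
  exact ⟨max C 1, by positivity, fun y => (hC y).trans (le_max_left _ _)⟩

lemma of_succ {n : ℕ} {f : (Fin d → ℝ) → ℝ} (hf : BddC (n + 1) f) : BddC n f := by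
  induction n generalizing f with
  | zero => exact ⟨hf.continuous, hf.2.1⟩
  | succ n ih => exact ⟨hf.1, hf.2.1, fun i => ih (hf.2.2 i)⟩

lemma const (n : ℕ) (c : ℝ) : BddC n (fun _ : Fin d → ℝ => c) := by
  induction n generalizing c with
  | zero => exact ⟨continuous_const, |c|, fun _ => le_rfl⟩
  | succ n ih =>
    exact ⟨differentiable_const c, ⟨|c|, fun _ => le_rfl⟩,
      fun i => by rw [partialD_const]; exact ih 0⟩

lemma bound_add {f g : (Fin d → ℝ) → ℝ} (hf : ∃ C, ∀ y, |f y| ≤ C) (hg : ∃ C, ∀ y, |g y| ≤ C) :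
    ∃ C, ∀ y, |f y + g y| ≤ C := by
  obtain ⟨C, hC⟩ := hf
  obtain ⟨D, hD⟩ := hg
  exact ⟨C + D, fun y => (abs_add_le _ _).trans (add_le_add (hC y) (hD y))⟩

lemma bound_mul {f g : (Fin d → ℝ) → ℝ} (hf : ∃ C, ∀ y, |f y| ≤ C) (hg : ∃ C, ∀ y, |g y| ≤ C) :
    ∃ C, ∀ y, |f y * g y| ≤ C := by
  obtain ⟨C, hC⟩ := hf
  obtain ⟨D, hD⟩ := hg
  refine ⟨C * D, fun y => ?_⟩
  rw [abs_mul]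
  exact mul_le_mul (hC y) (hD y) (abs_nonneg _) ((abs_nonneg _).trans (hC y))

lemma add {n : ℕ} {f g : (Fin d → ℝ) → ℝ} (hf : BddC n f) (hg : BddC n g) :
    BddC n (fun y => f y + g y) := by
  induction n generalizing f g with
  | zero => exact ⟨hf.1.add hg.1, bound_add hf.bound hg.bound⟩
  | succ n ih =>
    refine ⟨hf.1.add hg.1, bound_add hf.bound hg.bound, fun i => ?_⟩
    rw [show partialD i (fun y => f y + g y) = fun y => partialD i f y + partialD i g y from
      funext fun y => partialD_add i (hf.1 y) (hg.1 y)]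
    exact ih (hf.2.2 i) (hg.2.2 i)

lemma mul {n : ℕ} {f g : (Fin d → ℝ) → ℝ} (hf : BddC n f) (hg : BddC n g) :
    BddC n (fun y => f y * g y) := by
  induction n generalizing f g with
  | zero => exact ⟨hf.1.mul hg.1, bound_mul hf.bound hg.bound⟩
  | succ n ih =>
    refine ⟨hf.1.mul hg.1, bound_mul hf.bound hg.bound, fun i => ?_⟩
    rw [show partialD i (fun y => f y * g y)
      = fun y => partialD i f y * g y + f y * partialD i g y from
      funext fun y => partialD_mul i (hf.1 y) (hg.1 y)]
    exact (ih (hf.2.2 i) hg.of_succ).add (ih hf.of_succ (hg.2.2 i))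

lemma const_mul {n : ℕ} {f : (Fin d → ℝ) → ℝ} (c : ℝ) (hf : BddC n f) :
    BddC n (fun y => c * f y) := (const n c).mul hf

lemma sum {ι : Type*} (s : Finset ι) {n : ℕ} {f : ι → (Fin d → ℝ) → ℝ}
    (hf : ∀ a ∈ s, BddC n (f a)) : BddC n (fun y => ∑ a ∈ s, f a y) := by
  classical
  induction s using Finset.induction_on with
  | empty => simpa using const n 0
  | insert a s ha ih =>
    simp only [Finset.sum_insert ha]
    exact (hf a (Finset.mem_insert_self a s)).add
      (ih fun b hb => hf b (Finset.mem_insert_of_mem hb))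

lemma prod {ι : Type*} (s : Finset ι) {n : ℕ} {f : ι → (Fin d → ℝ) → ℝ}
    (hf : ∀ a ∈ s, BddC n (f a)) : BddC n (fun y => ∏ a ∈ s, f a y) := by
  classical
  induction s using Finset.induction_on with
  | empty => simpa using const n 1
  | insert a s ha ih =>
    simp only [Finset.prod_insert ha]
    exact (hf a (Finset.mem_insert_self a s)).mul
      (ih fun b hb => hf b (Finset.mem_insert_of_mem hb))

lemma det {κ : Type*} [Fintype κ] [DecidableEq κ] {n : ℕ} {A : (Fin d → ℝ) → Matrix κ κ ℝ}
    (hA : ∀ i j, BddC n (fun y => A y i j)) : BddC n (fun y => (A y).det) := by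
  simp only [Matrix.det_apply']
  exact sum _ fun σ _ => const_mul _ (prod _ fun i _ => hA _ _)

lemma inv {n : ℕ} {f : (Fin d → ℝ) → ℝ} (hf : BddC n f) {c : ℝ} (hc : 0 < c)
    (hfc : ∀ y, c ≤ f y) : BddC n (fun y => (f y)⁻¹) := by
  have hne : ∀ y, f y ≠ 0 := fun y => (hc.trans_le (hfc y)).ne'
  have hb : ∃ C, ∀ y, |(f y)⁻¹| ≤ C := ⟨c⁻¹, fun y => by
    rw [abs_of_pos (inv_pos.2 (hc.trans_le (hfc y)))]
    exact inv_anti₀ hc (hfc y)⟩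
  induction n generalizing f with
  | zero => exact ⟨hf.1.inv₀ hne, hb⟩
  | succ n ih =>
    refine ⟨fun y => (hf.1 y).inv (hne y), hb, fun i => ?_⟩
    have h : partialD i (fun y => (f y)⁻¹)
        = fun y => -1 * (((f y)⁻¹ * (f y)⁻¹) * partialD i f y) := by
      funext y
      rw [(hasDerivAt_inv (hne y)).partialD_comp i (hf.1 y)]
      field_simp
    rw [h]
    exact (((ih hf.of_succ hfc hne hb).mul (ih hf.of_succ hfc hne hb)).mul (hf.2.2 i)).const_mul _

lemma inv_sqrt {n : ℕ} {f : (Fin d → ℝ) → ℝ} (hf : BddC n f) {c : ℝ} (hc : 0 < c)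
    (hfc : ∀ y, c ≤ f y) : BddC n (fun y => (Real.sqrt (f y))⁻¹) := by
  have hpos : ∀ y, 0 < f y := fun y => hc.trans_le (hfc y)
  have hne : ∀ y, Real.sqrt (f y) ≠ 0 := fun y => (Real.sqrt_pos.2 (hpos y)).ne'
  have hb : ∃ C, ∀ y, |(Real.sqrt (f y))⁻¹| ≤ C := ⟨(Real.sqrt c)⁻¹, fun y => by
    rw [abs_of_pos (inv_pos.2 (Real.sqrt_pos.2 (hpos y)))]
    exact inv_anti₀ (Real.sqrt_pos.2 hc) (Real.sqrt_le_sqrt (hfc y))⟩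
  induction n with
  | zero => exact ⟨(Real.continuous_sqrt.comp hf.1).inv₀ hne, hb⟩
  | succ n ih =>
    refine ⟨fun y => ((hf.1 y).sqrt (hpos y).ne').inv (hne y), hb, fun i => ?_⟩
    have h : partialD i (fun y => (Real.sqrt (f y))⁻¹)
        = fun y => (-1 / 2) * (((Real.sqrt (f y))⁻¹ * (f y)⁻¹) * partialD i f y) := by
      funext y
      have h1 : HasDerivAt (fun r : ℝ => (Real.sqrt r)⁻¹)
          (-(1 / (2 * Real.sqrt (f y))) / Real.sqrt (f y) ^ 2) (f y) :=
        (Real.hasDerivAt_sqrt (hpos y).ne').inv (hne y)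
      rw [h1.partialD_comp i (hf.1 y), Real.sq_sqrt (hpos y).le]
      have := hne y
      have := (hpos y).ne'
      field_simp
    rw [h]
    exact (((ih hf.of_succ).mul ((hf.of_succ).inv hc hfc)).mul (hf.2.2 i)).const_mul _

end BddC

lemma ContDiff.partialD_comp {n : WithTop ℕ∞} {f : (Fin d → ℝ) → ℝ} (hf : ContDiff ℝ (n + 1) f)
    (i : Fin d) : ContDiff ℝ n (partialD i f) :=
  (hf.fderiv_right le_rfl).clm_apply contDiff_const

end BoundedDerivatives

/-! ### Moments of short time slices -/

section SliceMoments

variable {d : ℕ}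

/-- The moments of a time slice with drift `a` and diffusion matrix `B`, up to first order. -/
def sliceMoment (a : Fin d → ℝ) (B : Matrix (Fin d) (Fin d) ℝ) (h : ℝ) :
    (M : ℕ) → (Fin M → Fin d) → ℝ
  | 0, _ => 1
  | 1, I => h * a (I 0)
  | 2, I => h * (2 * B (I 0) (I 1))
  | _, _ => 0

/-- All moments of `G h` around `x` exist and agree with `sliceMoment` up to `o(h)`. -/
structure HasSliceMoments (x a : Fin d → ℝ) (B : Matrix (Fin d) (Fin d) ℝ)
    (G : ℝ → Measure (Fin d → ℝ)) : Prop where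
  integrable : ∀ᶠ h in 𝓝[>] (0 : ℝ), ∀ (M : ℕ) (I : Fin M → Fin d),
    Integrable (incrementMonomial x I) (G h)
  moment : ∀ (M : ℕ) (I : Fin M → Fin d),
    (fun h => (∫ x₁, incrementMonomial x I x₁ ∂(G h)) - sliceMoment a B h M I) =o[𝓝[>] 0]
      fun h => h

lemma HasSliceMoments.momentEquivalent {x a : Fin d → ℝ} {B : Matrix (Fin d) (Fin d) ℝ}
    {G₁ G₂ : ℝ → Measure (Fin d → ℝ)} (h₁ : HasSliceMoments x a B G₁)
    (h₂ : HasSliceMoments x a B G₂) : MomentEquivalent x G₁ G₂ := by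
  refine ⟨?_, fun M I => ?_⟩
  · filter_upwards [h₁.integrable, h₂.integrable] with h a b M I using ⟨a M I, b M I⟩
  · simpa using (h₁.moment M I).sub (h₂.moment M I)

lemma abs_incrementMonomial_le {M : ℕ} (x : Fin d → ℝ) (I : Fin M → Fin d) (y : Fin d → ℝ) :
    |incrementMonomial x I y| ≤ ‖y - x‖ ^ M := by
  rw [incrementMonomial, Finset.abs_prod]
  calc ∏ k, |y (I k) - x (I k)| ≤ ∏ _k : Fin M, ‖y - x‖ :=
        Finset.prod_le_prod (fun _ _ => abs_nonneg _) fun k _ => norm_le_pi_norm (y - x) (I k)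
    _ = _ := by simp

lemma continuous_incrementMonomial {M : ℕ} (x : Fin d → ℝ) (I : Fin M → Fin d) :
    Continuous (incrementMonomial x I) := by
  unfold incrementMonomial; fun_prop

lemma isLittleO_of_abs_le_sqrt_pow {f : ℝ → ℝ} {C : ℝ} {M : ℕ} (hM : 3 ≤ M)
    (hf : ∀ᶠ h in 𝓝[>] (0 : ℝ), |f h| ≤ C * Real.sqrt h ^ M) : f =o[𝓝[>] 0] fun h => h := by
  obtain ⟨N, rfl⟩ := Nat.exists_eq_add_of_le' hM
  have hO : f =O[𝓝[>] 0] fun h => h * Real.sqrt h ^ (N + 1) := by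
    refine IsBigO.of_bound C ?_
    filter_upwards [hf, self_mem_nhdsWithin] with h hh hpos
    have hpos : 0 < h := hpos
    rw [Real.norm_eq_abs, Real.norm_eq_abs (h * _), abs_of_nonneg (a := h * _) (by positivity)]
    refine hh.trans (le_of_eq ?_)
    rw [show N + 3 = 2 + (N + 1) by ring, pow_add _ 2, Real.sq_sqrt hpos.le]
  refine hO.trans_isLittleO ?_
  have ht : Tendsto (fun h : ℝ => Real.sqrt h ^ (N + 1)) (𝓝[>] 0) (𝓝 0) := by
    have : Continuous fun h : ℝ => Real.sqrt h ^ (N + 1) := by fun_prop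
    simpa using (this.tendsto 0).mono_left nhdsWithin_le_nhds
  simpa using (isBigO_refl (fun h : ℝ => h) (𝓝[>] 0)).mul_isLittleO ((isLittleO_one_iff ℝ).2 ht)

/-- Reduction to the moments of order at most two and to a bound on the higher ones. -/
lemma HasSliceMoments.of_bounds {x a : Fin d → ℝ} {B : Matrix (Fin d) (Fin d) ℝ}
    {G : ℝ → Measure (Fin d → ℝ)}
    (hint : ∀ᶠ h in 𝓝[>] (0 : ℝ), ∀ (M : ℕ) (I : Fin M → Fin d),
      Integrable (incrementMonomial x I) (G h))
    (h0 : (fun h => (∫ _y, (1 : ℝ) ∂(G h)) - 1) =o[𝓝[>] 0] fun h => h)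
    (h1 : ∀ i, (fun h => (∫ y, (y i - x i) ∂(G h)) - h * a i) =o[𝓝[>] 0] fun h => h)
    (h2 : ∀ i j, (fun h => (∫ y, (y i - x i) * (y j - x j) ∂(G h)) - h * (2 * B i j))
      =o[𝓝[>] 0] fun h => h)
    (h3 : ∀ (M : ℕ) (I : Fin M → Fin d), 3 ≤ M → ∃ C, ∀ᶠ h in 𝓝[>] (0 : ℝ),
      |∫ y, incrementMonomial x I y ∂(G h)| ≤ C * Real.sqrt h ^ M) :
    HasSliceMoments x a B G := by
  refine ⟨hint, fun M I => ?_⟩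
  match M, I with
  | 0, I => simpa [incrementMonomial, sliceMoment] using h0
  | 1, I => simpa [incrementMonomial, sliceMoment] using h1 (I 0)
  | 2, I => simpa [incrementMonomial, sliceMoment] using h2 (I 0) (I 1)
  | M + 3, I =>
    obtain ⟨C, hC⟩ := h3 (M + 3) I (by omega)
    simp only [sliceMoment, sub_zero]
    exact isLittleO_of_abs_le_sqrt_pow (by omega) hC

end SliceMoments

/-! ### The coefficients at a fixed time -/

section Coefficients

variable {d m : ℕ}

lemma lipschitz_of_bounded_partialD {f : (Fin d → ℝ) → ℝ} (hf : Differentiable ℝ f)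
    (hb : ∀ k, ∃ C, ∀ y, |partialD k f y| ≤ C) :
    ∃ L, 0 ≤ L ∧ ∀ y z, |f y - f z| ≤ L * ‖y - z‖ := by
  choose C hC using hb
  have hC0 : ∀ k, 0 ≤ C k := fun k => (abs_nonneg _).trans (hC k 0)
  refine ⟨∑ k, C k, Finset.sum_nonneg fun k _ => hC0 k, fun y z => ?_⟩
  have hbound : ∀ w, ‖fderiv ℝ f w‖ ≤ ∑ k, C k := fun w => by
    refine ContinuousLinearMap.opNorm_le_bound _ (Finset.sum_nonneg fun k _ => hC0 k) fun v => ?_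
    rw [fderiv_apply_eq_sum_partialD, Finset.sum_mul]
    refine (norm_sum_le _ _).trans (Finset.sum_le_sum fun k _ => ?_)
    rw [norm_mul, mul_comm]
    exact mul_le_mul (hC k w) (norm_le_pi_norm v k) (norm_nonneg _) (hC0 k)
  exact convex_univ.norm_image_sub_le_of_norm_fderiv_le (fun w _ => hf w)
    (fun w _ => hbound w) (mem_univ z) (mem_univ y)

lemma partialD_coord {ι : Type*} [Fintype ι] {f : (Fin d → ℝ) → ι → ℝ} {y : Fin d → ℝ}
    (hf : DifferentiableAt ℝ f y) (k : Fin d) (i : ι) :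
    partialD k (fun z => f z i) y = fderiv ℝ f y (Pi.single k 1) i := by
  have h := (hasFDerivAt_pi'.1 hf.hasFDerivAt i).fderiv
  simp only [partialD, h]; rfl

/-- The regularity of the coefficients at a fixed time. -/
structure SliceRegular (F : (Fin d → ℝ) → Fin d → ℝ)
    (b : (Fin d → ℝ) → Fin d → Fin m → ℝ) : Prop where
  drift_differentiable : ∀ i, Differentiable ℝ (fun y => F y i)
  drift_partialD : ∀ i k, BddC 0 (partialD k (fun y => F y i))
  noise : ∀ i μ, BddC 2 (fun y => b y i μ)
  elliptic : ∃ lam : ℝ, 0 < lam ∧ ∀ y v : Fin d → ℝ,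
    lam * (v ⬝ᵥ v) ≤ v ⬝ᵥ (diffusionB b y *ᵥ v)

lemma dotProduct_self_nonneg' (v : Fin d → ℝ) : 0 ≤ v ⬝ᵥ v :=
  Finset.sum_nonneg fun i _ => mul_self_nonneg (v i)

lemma norm_single_one (k : Fin d) : ‖(Pi.single k 1 : Fin d → ℝ)‖ = 1 := by
  rw [Pi.norm_single]; simp

lemma partialD_coord₂ {b : (Fin d → ℝ) → Fin d → Fin m → ℝ} {y : Fin d → ℝ}
    (hb : DifferentiableAt ℝ b y) (k i : Fin d) (μ : Fin m) :
    partialD k (fun z => b z i μ) y = fderiv ℝ b y (Pi.single k 1) i μ := by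
  rw [partialD_coord (f := fun z => b z i) (differentiableAt_pi.1 hb i)]
  have h := (hasFDerivAt_pi'.1 hb.hasFDerivAt i).fderiv
  rw [h]; rfl

lemma partialD_partialD_coord₂ {b : (Fin d → ℝ) → Fin d → Fin m → ℝ}
    (hb : ContDiff ℝ 2 b) (l k i : Fin d) (μ : Fin m) (y : Fin d → ℝ) :
    partialD l (partialD k (fun z => b z i μ)) y
      = fderiv ℝ (fderiv ℝ b) y (Pi.single l 1) (Pi.single k 1) i μ := by
  have hd : Differentiable ℝ b := hb.differentiable (by norm_num)
  have h1 : partialD k (fun z => b z i μ) = fun z => fderiv ℝ b z (Pi.single k 1) i μ :=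
    funext fun z => partialD_coord₂ (hd z) k i μ
  have hd2 : DifferentiableAt ℝ (fderiv ℝ b) y :=
    (hb.fderiv_right (m := 1) (by norm_num)).differentiable (by norm_num) y
  have hd3 : DifferentiableAt ℝ (fun z => fderiv ℝ b z (Pi.single k 1)) y :=
    hd2.clm_apply (differentiableAt_const _)
  rw [h1, partialD_coord₂ hd3]
  have := (hd2.hasFDerivAt.clm_apply (hasFDerivAt_const (Pi.single k (1 : ℝ)) y)).fderiv
  rw [this]; simp

lemma RegularCoefficients.sliceRegular {t T : ℝ} {F : ℝ → (Fin d → ℝ) → Fin d → ℝ}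
    {b : ℝ → (Fin d → ℝ) → Fin d → Fin m → ℝ} (hreg : RegularCoefficients t T F b) {s : ℝ}
    (hs : s ∈ Icc t (t + T)) : SliceRegular (F s) (b s) := by
  obtain ⟨C, hC⟩ := hreg.bounded
  have hF := hreg.F_contDiff s hs
  have hb := hreg.b_contDiff s hs
  have hFd : Differentiable ℝ (F s) := hF.differentiable (by norm_num)
  have hbd : Differentiable ℝ (b s) := hb.differentiable (by norm_num)
  have hbc : ∀ i μ, ContDiff ℝ 2 (fun y => b s y i μ) := fun i μ =>
    contDiff_pi.1 (contDiff_pi.1 hb i) μ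
  refine ⟨fun i => differentiable_pi.1 hFd i, fun i k => ⟨?_, C, fun y => ?_⟩,
    fun i μ => ⟨(hbc i μ).differentiable (by norm_num), ⟨C, fun y => ?_⟩, fun k => ⟨?_, ⟨C, fun y => ?_⟩,
      fun l => ⟨?_, C, fun y => ?_⟩⟩⟩, ?_⟩
  · exact (ContDiff.partialD_comp (n := 0) (by simpa using contDiff_pi.1 hF i) k).continuous
  · rw [partialD_coord (hFd y)]
    refine (norm_le_pi_norm (fderiv ℝ (F s) y (Pi.single k 1)) i).trans ?_
    refine (ContinuousLinearMap.le_opNorm _ _).trans ?_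
    rw [norm_single_one, mul_one]
    exact (hC s hs y).1
  · exact ((norm_le_pi_norm (b s y i) μ).trans (norm_le_pi_norm (b s y) i)).trans (hC s hs y).2.1
  · exact (ContDiff.partialD_comp (n := 1) (by simpa [one_add_one_eq_two] using hbc i μ) k).differentiable
      (by norm_num)
  · rw [partialD_coord₂ (hbd y)]
    refine ((norm_le_pi_norm _ μ).trans
      (norm_le_pi_norm (fderiv ℝ (b s) y (Pi.single k 1)) i)).trans ?_
    refine (ContinuousLinearMap.le_opNorm _ _).trans ?_
    rw [norm_single_one, mul_one]
    exact (hC s hs y).2.2.1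
  · exact (ContDiff.partialD_comp (n := 0) (by
      simpa using ContDiff.partialD_comp (n := 1) (by simpa [one_add_one_eq_two] using hbc i μ) k) l).continuous
  · rw [partialD_partialD_coord₂ hb]
    refine ((norm_le_pi_norm _ μ).trans (norm_le_pi_norm
      (fderiv ℝ (fderiv ℝ (b s)) y (Pi.single l 1) (Pi.single k 1)) i)).trans ?_
    refine (ContinuousLinearMap.le_opNorm₂ _ _ _).trans ?_
    rw [norm_single_one, norm_single_one, mul_one, mul_one]
    exact (hC s hs y).2.2.2
  · obtain ⟨lam, hlam, h⟩ := hreg.elliptic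
    refine ⟨lam, hlam, fun y v => ?_⟩
    have := h s hs y v
    simpa [dotProduct, pow_two] using this

namespace SliceRegular

variable {F : (Fin d → ℝ) → Fin d → ℝ} {b : (Fin d → ℝ) → Fin d → Fin m → ℝ}

lemma diffusionB_bddC (hreg : SliceRegular F b) (i j : Fin d) :
    BddC 2 (fun y => diffusionB b y i j) := by
  simp only [diffusionB, Matrix.of_apply]
  exact (BddC.sum _ fun μ _ => (hreg.noise i μ).mul (hreg.noise j μ)).const_mul _

lemma noiseDrift_bddC (hreg : SliceRegular F b) (i : Fin d) :
    BddC 1 (fun y => noiseDrift b y i) := by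
  simp only [noiseDrift]
  exact BddC.sum _ fun k _ => BddC.sum _ fun μ _ => (hreg.noise k μ).of_succ.mul
    ((hreg.noise i μ).2.2 k)

lemma spuriousDrift_bddC (hreg : SliceRegular F b) (α αb : ℝ) (i : Fin d) :
    BddC 1 (fun y => spuriousDrift α αb b y i) := by
  simp only [spuriousDrift, sub_eq_add_neg, ← neg_mul]
  exact ((hreg.noiseDrift_bddC i).const_mul _).add
    ((BddC.sum _ fun k _ => (hreg.diffusionB_bddC i k).2.2 k).const_mul _)

lemma extraTerms_bddC (hreg : SliceRegular F b) (α αb : ℝ) :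
    BddC 0 (fun y => extraTerms α αb F b y) := by
  simp only [extraTerms, sub_eq_add_neg, ← neg_mul]
  exact (((BddC.sum _ fun i _ => hreg.drift_partialD i i).const_mul _).add
    ((BddC.sum _ fun i _ => (hreg.noiseDrift_bddC i).2.2 i).const_mul _)).add
    ((BddC.sum _ fun i _ => BddC.sum _ fun j _ =>
      ((hreg.diffusionB_bddC i j).2.2 j).2.2 i).const_mul _)

lemma diffusionB_comm (y : Fin d → ℝ) (i j : Fin d) :
    diffusionB b y i j = diffusionB b y j i := by
  simp [diffusionB, mul_comm]

lemma diffusionB_isSymm (y : Fin d → ℝ) : (diffusionB b y).IsSymm :=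
  Matrix.IsSymm.ext fun i j => diffusionB_comm y j i

lemma diffusionB_posDef (hreg : SliceRegular F b) (y : Fin d → ℝ) :
    (diffusionB b y).PosDef := by
  obtain ⟨lam, hlam, h⟩ := hreg.elliptic
  refine Matrix.PosDef.of_dotProduct_mulVec_pos
    (by rw [Matrix.IsHermitian, Matrix.conjTranspose_eq_transpose_of_trivial]
        exact diffusionB_isSymm y) fun v hv => ?_
  have h1 : 0 < v ⬝ᵥ v := by
    rcases (dotProduct_self_nonneg' v).lt_or_eq with h | h
    · exact h
    · exact absurd (dotProduct_self_eq_zero.1 h.symm) hv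
  simpa using (mul_pos hlam h1).trans_le (h y v)

lemma isUnit_det (hreg : SliceRegular F b) (y : Fin d → ℝ) :
    IsUnit (diffusionB b y).det := (hreg.diffusionB_posDef y).det_pos.ne'.isUnit

lemma mulVec_inv (hreg : SliceRegular F b) (y v : Fin d → ℝ) :
    diffusionB b y *ᵥ ((diffusionB b y)⁻¹ *ᵥ v) = v := by
  rw [Matrix.mulVec_mulVec, Matrix.mul_nonsing_inv _ (hreg.isUnit_det y), Matrix.one_mulVec]

lemma inv_isSymm (y : Fin d → ℝ) : (diffusionB b y)⁻¹.IsSymm := by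
  rw [Matrix.IsSymm, Matrix.transpose_nonsing_inv, (diffusionB_isSymm y).eq]

lemma abs_mul_le_dotProduct (v w : Fin d → ℝ) :
    (v ⬝ᵥ w) ^ 2 ≤ (v ⬝ᵥ v) * (w ⬝ᵥ w) := by
  simpa [dotProduct, pow_two] using Finset.sum_mul_sq_le_sq_mul_sq Finset.univ v w

lemma exists_mulVec_bound {A : (Fin d → ℝ) → Matrix (Fin d) (Fin d) ℝ}
    (hA : ∀ i j, ∃ C, ∀ y, |A y i j| ≤ C) :
    ∃ K, 0 < K ∧ ∀ y v, (A y *ᵥ v) ⬝ᵥ (A y *ᵥ v) ≤ K * (v ⬝ᵥ v) := by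
  choose C hC using hA
  refine ⟨(∑ i, ∑ j, C i j ^ 2) + 1, by positivity, fun y v => ?_⟩
  have hv := dotProduct_self_nonneg' v
  calc (A y *ᵥ v) ⬝ᵥ (A y *ᵥ v) = ∑ i, (A y i ⬝ᵥ v) ^ 2 := by
        simp [dotProduct, Matrix.mulVec, pow_two]
    _ ≤ ∑ i, (∑ j, C i j ^ 2) * (v ⬝ᵥ v) := by
        refine Finset.sum_le_sum fun i _ => (abs_mul_le_dotProduct _ _).trans ?_
        refine mul_le_mul_of_nonneg_right ?_ hv
        refine Finset.sum_le_sum fun j _ => ?_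
        rw [← pow_two, ← sq_abs]
        exact pow_le_pow_left₀ (abs_nonneg _) (hC i j y) 2
    _ ≤ _ := by rw [← Finset.sum_mul]; nlinarith

/-- `B⁻¹` is uniformly positive. -/
lemma exists_inv_lower (hreg : SliceRegular F b) :
    ∃ c : ℝ, 0 < c ∧ ∀ y ξ : Fin d → ℝ, c * (ξ ⬝ᵥ ξ) ≤ ξ ⬝ᵥ ((diffusionB b y)⁻¹ *ᵥ ξ) := by
  obtain ⟨lam, hlam, h⟩ := hreg.elliptic
  obtain ⟨K, hK, hK'⟩ := exists_mulVec_bound (A := fun y => diffusionB b y)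
    fun i j => (hreg.diffusionB_bddC i j).bound
  refine ⟨lam / K, by positivity, fun y ξ => ?_⟩
  set η := (diffusionB b y)⁻¹ *ᵥ ξ with hη
  have hξ : diffusionB b y *ᵥ η = ξ := hreg.mulVec_inv y ξ
  have h1 := h y η
  have h2 := hK' y η
  simp only [hξ] at h1 h2
  rw [dotProduct_comm ξ η, div_mul_eq_mul_div, div_le_iff₀ hK]
  nlinarith

/-- `B⁻¹` is uniformly bounded. -/
lemma exists_inv_upper (hreg : SliceRegular F b) :
    ∃ K : ℝ, ∀ (y : Fin d → ℝ) i j, |(diffusionB b y)⁻¹ i j| ≤ K := by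
  obtain ⟨lam, hlam, h⟩ := hreg.elliptic
  refine ⟨lam⁻¹, fun y i j => ?_⟩
  set ξ : Fin d → ℝ := Pi.single j 1
  set η := (diffusionB b y)⁻¹ *ᵥ ξ with hη
  have hξ : diffusionB b y *ᵥ η = ξ := hreg.mulVec_inv y ξ
  have h1 := h y η
  rw [hξ] at h1
  have hij : (diffusionB b y)⁻¹ i j = η i := by simp [hη, ξ]
  have h3 : η ⬝ᵥ ξ = η j := by simp [ξ]
  have hle : ∀ k, (η k) ^ 2 ≤ η ⬝ᵥ η := fun k => by
    rw [pow_two]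
    exact Finset.single_le_sum (f := fun k => η k * η k) (fun _ _ => mul_self_nonneg _)
      (Finset.mem_univ k)
  rw [h3] at h1
  have hj := hle j
  have hi := hle i
  have hnn := dotProduct_self_nonneg' η
  have h4 : lam ^ 2 * (η ⬝ᵥ η) ≤ 1 := by
    rcases hnn.lt_or_eq with hp | h0
    · have : (lam * (η ⬝ᵥ η)) ^ 2 ≤ η ⬝ᵥ η :=
        (pow_le_pow_left₀ (by positivity) h1 2).trans hj
      nlinarith
    · rw [← h0]; simp
  rw [hij]
  refine abs_le_of_sq_le_sq ?_ (by positivity)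
  rw [inv_pow, ← one_div, le_div_iff₀ (by positivity)]
  nlinarith [sq_nonneg lam]

lemma exists_det_lower (hreg : SliceRegular F b) :
    ∃ c : ℝ, 0 < c ∧ ∀ y : Fin d → ℝ, c ≤ (diffusionB b y).det := by
  obtain ⟨K, hK⟩ := hreg.exists_inv_upper
  have hbound : ∃ C, ∀ y : Fin d → ℝ, |((diffusionB b y)⁻¹).det| ≤ C := by
    refine ⟨∑ σ : Equiv.Perm (Fin d), ∏ _i : Fin d, K, fun y => ?_⟩
    rw [Matrix.det_apply']
    refine (Finset.abs_sum_le_sum_abs _ _).trans (Finset.sum_le_sum fun σ _ => ?_)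
    rw [abs_mul, Finset.abs_prod]
    have : |((Equiv.Perm.sign σ : ℤ) : ℝ)| = 1 := by
      rcases Int.units_eq_one_or (Equiv.Perm.sign σ) with h | h <;> simp [h]
    rw [this, one_mul]
    exact Finset.prod_le_prod (fun _ _ => abs_nonneg _) fun i _ => hK y _ _
  obtain ⟨C, hC⟩ := hbound
  refine ⟨(max C 1)⁻¹, by positivity, fun y => ?_⟩
  have hpos := (hreg.diffusionB_posDef y).det_pos
  have h1 := hC y
  rw [Matrix.det_nonsing_inv, Ring.inverse_eq_inv', abs_of_pos (inv_pos.2 hpos)] at h1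
  exact inv_le_of_inv_le₀ hpos (h1.trans (le_max_left _ _))

lemma inv_sqrt_det_bddC (hreg : SliceRegular F b) :
    BddC 2 (fun y => (Real.sqrt (diffusionB b y).det)⁻¹) := by
  obtain ⟨c, hc, h⟩ := hreg.exists_det_lower
  exact (BddC.det hreg.diffusionB_bddC).inv_sqrt hc h

lemma inv_bddC (hreg : SliceRegular F b) (i j : Fin d) :
    BddC 2 (fun y => (diffusionB b y)⁻¹ i j) := by
  obtain ⟨c, hc, h⟩ := hreg.exists_det_lower
  simp only [Matrix.inv_def, Ring.inverse_eq_inv', Matrix.smul_apply, smul_eq_mul]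
  refine ((BddC.det hreg.diffusionB_bddC).inv hc h).mul ?_
  simp only [Matrix.adjugate_apply]
  refine BddC.det fun k l => ?_
  by_cases hk : k = j
  · subst hk
    simpa using BddC.const 2 _
  · simpa [Matrix.updateRow_apply, hk] using hreg.diffusionB_bddC k l

/-- The total drift in the quadratic form of the time slice. -/
def totalDrift (α αb : ℝ) (F : (Fin d → ℝ) → Fin d → ℝ)
    (b : (Fin d → ℝ) → Fin d → Fin m → ℝ) (y : Fin d → ℝ) (i : Fin d) : ℝ :=
  F y i + spuriousDrift α αb b y i

lemma differentiable_totalDrift (hreg : SliceRegular F b) (α αb : ℝ) (i : Fin d) :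
    Differentiable ℝ (fun y => totalDrift α αb F b y i) :=
  (hreg.drift_differentiable i).add (hreg.spuriousDrift_bddC α αb i).1

lemma lipschitz_totalDrift (hreg : SliceRegular F b) (α αb : ℝ) (i : Fin d) :
    ∃ L, 0 ≤ L ∧ ∀ y z, |totalDrift α αb F b y i - totalDrift α αb F b z i| ≤ L * ‖y - z‖ := by
  refine lipschitz_of_bounded_partialD (hreg.differentiable_totalDrift α αb i) fun k => ?_
  rw [show partialD k (fun y => totalDrift α αb F b y i)
    = fun y => partialD k (fun y => F y i) y + partialD k (fun y => spuriousDrift α αb b y i) y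
    from funext fun y => partialD_add k (hreg.drift_differentiable i y)
      ((hreg.spuriousDrift_bddC α αb i).1 y)]
  exact BddC.bound_add (hreg.drift_partialD i k).bound
    ((hreg.spuriousDrift_bddC α αb i).2.2 k).bound

end SliceRegular

end Coefficients

/-! ### Moments of Gaussian measures -/

section GaussianMoments

lemma integral_sq_gaussianReal (v : NNReal) : ∫ x, x ^ 2 ∂(gaussianReal 0 v) = v := by
  have h := variance_eq_sub (memLp_id_gaussianReal' (μ := 0) (v := v) 2 (by simp))
  rw [variance_id_gaussianReal] at h
  simpa [integral_id_gaussianReal] using h.symm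

variable {κ : Type*} [Fintype κ]

lemma integral_coord_pi_gaussianReal (v : NNReal) (i : κ) :
    ∫ w, w i ∂(Measure.pi fun _ : κ => gaussianReal 0 v) = 0 := by
  have := integral_comp_eval (μ := fun _ : κ => gaussianReal 0 v) (i := i) (f := fun x : ℝ => x)
    aestronglyMeasurable_id
  simpa using this.trans integral_id_gaussianReal

lemma integral_mul_coord_pi_gaussianReal [DecidableEq κ] (v : NNReal) (i j : κ) :
    ∫ w, w i * w j ∂(Measure.pi fun _ : κ => gaussianReal 0 v) = if i = j then (v : ℝ) else 0 := by
  split_ifs with h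
  · subst h
    have := integral_comp_eval (μ := fun _ : κ => gaussianReal 0 v) (i := i)
      (f := fun x : ℝ => x ^ 2) (by fun_prop)
    simp only [← pow_two]
    exact this.trans (integral_sq_gaussianReal v)
  · have hind := (iIndepFun_pi (μ := fun _ : κ => gaussianReal 0 v) (X := fun _ => id)
      fun _ => aemeasurable_id).indepFun h
    have := hind.integral_fun_mul_eq_mul_integral
      (measurable_pi_apply i).aestronglyMeasurable (measurable_pi_apply j).aestronglyMeasurable
    simp only [id] at this
    rw [this, integral_coord_pi_gaussianReal, zero_mul]

lemma integral_mul_exp_neg_sq_div_four (f : ℝ → ℝ) :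
    ∫ x, f x * Real.exp (-(x * x) / 4) = Real.sqrt (4 * Real.pi) * ∫ x, f x ∂(gaussianReal 0 2) := by
  rw [integral_gaussianReal_eq_integral_smul (by norm_num), ← integral_const_mul]
  congr 1; funext x
  simp only [gaussianPDFReal, smul_eq_mul, sub_zero, NNReal.coe_ofNat]
  have h : Real.sqrt (2 * Real.pi * 2) = Real.sqrt (4 * Real.pi) := by ring_nf
  have hne : Real.sqrt (4 * Real.pi) ≠ 0 := (Real.sqrt_pos.2 (by positivity)).ne'
  rw [h, show -(x * x) / 4 = -x ^ 2 / (2 * 2) by ring]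
  field_simp

variable {d : ℕ}

lemma exp_neg_dotProduct_div_four (η : Fin d → ℝ) :
    Real.exp (-(η ⬝ᵥ η) / 4) = ∏ k, Real.exp (-(η k * η k) / 4) := by
  rw [← Real.exp_sum, dotProduct, neg_div, Finset.sum_div, ← Finset.sum_neg_distrib]
  simp only [neg_div]

lemma integral_prod_mul_exp (f : Fin d → ℝ → ℝ) :
    ∫ η : Fin d → ℝ, (∏ k, f k (η k)) * Real.exp (-(η ⬝ᵥ η) / 4)
      = Real.sqrt (4 * Real.pi) ^ d *
        ∫ η, ∏ k, f k (η k) ∂(Measure.pi fun _ : Fin d => gaussianReal 0 2) := by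
  simp only [exp_neg_dotProduct_div_four, ← Finset.prod_mul_distrib]
  rw [integral_fintype_prod_volume_eq_prod
      (fun k (x : ℝ) => f k x * Real.exp (-(x * x) / 4)), integral_fintype_prod_eq_prod]
  simp [integral_mul_exp_neg_sq_div_four, Finset.prod_mul_distrib]

lemma integral_exp_neg_dotProduct :
    ∫ η : Fin d → ℝ, Real.exp (-(η ⬝ᵥ η) / 4) = Real.sqrt (4 * Real.pi) ^ d := by
  simpa using integral_prod_mul_exp (d := d) fun _ _ => 1

lemma integral_coord_exp_neg_dotProduct (i : Fin d) :
    ∫ η : Fin d → ℝ, η i * Real.exp (-(η ⬝ᵥ η) / 4) = 0 := by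
  have h : ∀ η : Fin d → ℝ, ∏ k, (if k = i then η k else 1) = η i := fun η => by
    simp
  have := integral_prod_mul_exp (d := d) fun k x => if k = i then x else 1
  simpa only [h, integral_coord_pi_gaussianReal, mul_zero] using this

lemma integral_mul_coord_exp_neg_dotProduct (i j : Fin d) :
    ∫ η : Fin d → ℝ, η i * η j * Real.exp (-(η ⬝ᵥ η) / 4)
      = Real.sqrt (4 * Real.pi) ^ d * (if i = j then 2 else 0) := by
  have h : ∀ η : Fin d → ℝ, ∏ k, ((if k = i then η k else 1) * (if k = j then η k else 1))
      = η i * η j := fun η => by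
    rw [Finset.prod_mul_distrib]; simp
  have := integral_prod_mul_exp (d := d)
    fun k x => (if k = i then x else 1) * (if k = j then x else 1)
  simpa only [h, integral_mul_coord_pi_gaussianReal, NNReal.coe_ofNat] using this

lemma norm_sq_le_dotProduct (ξ : Fin d → ℝ) : ‖ξ‖ ^ 2 ≤ ξ ⬝ᵥ ξ := by
  have h0 := dotProduct_self_nonneg' ξ
  have : ‖ξ‖ ≤ Real.sqrt (ξ ⬝ᵥ ξ) := by
    rw [pi_norm_le_iff_of_nonneg (Real.sqrt_nonneg _)]
    intro i
    refine Real.abs_le_sqrt ?_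
    rw [pow_two]
    exact Finset.single_le_sum (f := fun k => ξ k * ξ k) (fun _ _ => mul_self_nonneg _)
      (Finset.mem_univ i)
  calc ‖ξ‖ ^ 2 ≤ Real.sqrt (ξ ⬝ᵥ ξ) ^ 2 := pow_le_pow_left₀ (norm_nonneg _) this 2
    _ = _ := Real.sq_sqrt h0

lemma abs_coord_le (ξ : Fin d → ℝ) (k : Fin d) : |ξ k| ≤ 1 + ξ ⬝ᵥ ξ := by
  have h1 : |ξ k| ≤ ‖ξ‖ := norm_le_pi_norm ξ k
  nlinarith [norm_sq_le_dotProduct ξ, norm_nonneg ξ, sq_nonneg (‖ξ‖ - 1)]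

lemma norm_le_one_add_dotProduct (ξ : Fin d → ℝ) : ‖ξ‖ ≤ 1 + ξ ⬝ᵥ ξ := by
  nlinarith [norm_sq_le_dotProduct ξ, norm_nonneg ξ, sq_nonneg (‖ξ‖ - 1)]

/-- Powers are absorbed into the Gaussian. -/
lemma pow_mul_exp_le (n : ℕ) {c : ℝ} (hc : 0 < c) :
    ∃ K c', 0 < K ∧ 0 < c' ∧ ∀ q : ℝ, 0 ≤ q → (1 + q) ^ n * Real.exp (-c * q) ≤ K * Real.exp (-c' * q) := by
  induction n with
  | zero => exact ⟨1, c, one_pos, hc, fun q _ => by simp⟩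
  | succ n ih =>
    obtain ⟨K, c', hK, hc', h⟩ := ih
    refine ⟨K * (1 + 2 / c'), c' / 2, by positivity, by positivity, fun q hq => ?_⟩
    have h1 : 1 + q ≤ (1 + 2 / c') * Real.exp (c' / 2 * q) := by
      have h2 := Real.add_one_le_exp (c' / 2 * q)
      calc 1 + q ≤ (1 + 2 / c') * (c' / 2 * q + 1) := by
            field_simp; nlinarith [mul_nonneg hc'.le hq, mul_pos hc' hc']
        _ ≤ _ := mul_le_mul_of_nonneg_left h2 (by positivity)
    calc (1 + q) ^ (n + 1) * Real.exp (-c * q)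
        = (1 + q) * ((1 + q) ^ n * Real.exp (-c * q)) := by ring
      _ ≤ ((1 + 2 / c') * Real.exp (c' / 2 * q)) * (K * Real.exp (-c' * q)) :=
          mul_le_mul h1 (h q hq) (by positivity) (by positivity)
      _ = K * (1 + 2 / c') * (Real.exp (c' / 2 * q) * Real.exp (-c' * q)) := by ring
      _ = _ := by rw [← Real.exp_add]; ring_nf

lemma integrable_exp_neg_dotProduct {c : ℝ} (hc : 0 < c) :
    Integrable fun ξ : Fin d → ℝ => Real.exp (-c * (ξ ⬝ᵥ ξ)) := by
  have := Integrable.fintype_prod (ι := Fin d) (𝕜 := ℝ) (f := fun _ x => Real.exp (-c * x ^ 2))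
    (μ := fun _ => volume) fun _ => integrable_exp_neg_mul_sq hc
  refine this.congr (ae_of_all _ fun ξ => ?_)
  simp only [← Real.exp_sum, dotProduct, Finset.mul_sum, pow_two]

lemma integrable_pow_mul_exp_neg_dotProduct (n : ℕ) {c : ℝ} (hc : 0 < c) :
    Integrable fun ξ : Fin d → ℝ => (1 + ξ ⬝ᵥ ξ) ^ n * Real.exp (-c * (ξ ⬝ᵥ ξ)) := by
  obtain ⟨K, c', hK, hc', h⟩ := pow_mul_exp_le n hc
  refine ((integrable_exp_neg_dotProduct hc').const_mul K).mono'
    (by fun_prop) (ae_of_all _ fun ξ => ?_)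
  have h0 := dotProduct_self_nonneg' ξ
  rw [Real.norm_eq_abs, abs_of_nonneg (by positivity)]
  exact h _ h0

lemma mulVec_apply_sum (S : Matrix (Fin d) (Fin d) ℝ) (η : Fin d → ℝ) (i : Fin d) :
    (S *ᵥ η) i = ∑ k, S i k * η k := rfl

/-- The linear change of variables `ξ = S η`. -/
lemma integral_comp_mulVec {S : Matrix (Fin d) (Fin d) ℝ} (hS : S.det ≠ 0)
    {f : (Fin d → ℝ) → ℝ} (hf : Continuous f) :
    ∫ ξ, f ξ = |S.det| * ∫ η, f (S *ᵥ η) := by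
  have h := Real.map_matrix_volume_pi_eq_smul_volume_pi hS
  have h1 : ∫ ξ, f ξ ∂(Measure.map (Matrix.toLin' S) volume) = ∫ η, f (S *ᵥ η) := by
    rw [integral_map]
    · simp [Matrix.toLin'_apply]
    · exact (LinearMap.continuous_of_finiteDimensional _).aemeasurable
    · exact hf.aestronglyMeasurable
  rw [h, integral_smul_measure, ENNReal.toReal_ofReal (abs_nonneg _), smul_eq_mul] at h1
  rw [← h1, ← mul_assoc, ← abs_mul, mul_inv_cancel₀ hS, abs_one, one_mul]

open scoped MatrixOrder Matrix.Norms.L2Operator in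
lemma exists_sqrt_matrix {B : Matrix (Fin d) (Fin d) ℝ} (hB : B.PosDef) :
    ∃ S : Matrix (Fin d) (Fin d) ℝ, B = S * Sᵀ ∧ S.det ≠ 0 ∧ Real.sqrt B.det = |S.det| ∧
      ∀ η, (S *ᵥ η) ⬝ᵥ (B⁻¹ *ᵥ (S *ᵥ η)) = η ⬝ᵥ η := by
  obtain ⟨R, hR⟩ := CStarAlgebra.nonneg_iff_eq_star_mul_self.1 hB.posSemidef.nonneg
  have hBS : B = Rᵀ * Rᵀᵀ := by
    rw [hR, Matrix.star_eq_conjTranspose, Matrix.conjTranspose_eq_transpose_of_trivial,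
      Matrix.transpose_transpose]
  have hdet : B.det = Rᵀ.det * Rᵀ.det := by
    conv_lhs => rw [hBS, Matrix.det_mul, Matrix.det_transpose Rᵀ]
  have hne : Rᵀ.det ≠ 0 := fun h => hB.det_pos.ne' (by rw [hdet, h, zero_mul])
  refine ⟨Rᵀ, hBS, hne, by rw [hdet, ← pow_two, Real.sqrt_sq_eq_abs], fun η => ?_⟩
  have hu : IsUnit Rᵀ.det := hne.isUnit
  have hu' : IsUnit Rᵀᵀ.det := by rwa [Matrix.det_transpose]
  rw [hBS, Matrix.mul_inv_rev, Matrix.mulVec_mulVec, Matrix.mul_assoc,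
    Matrix.nonsing_inv_mul _ hu, Matrix.mul_one, Matrix.dotProduct_mulVec, Matrix.vecMul_mulVec,
    Matrix.mul_nonsing_inv _ hu', Matrix.vecMul_one]

/-- The centred Gaussian density with covariance `2 B`. -/
def centredGaussian (B : Matrix (Fin d) (Fin d) ℝ) (ξ : Fin d → ℝ) : ℝ :=
  (Real.sqrt (4 * Real.pi) ^ d)⁻¹ *
    ((Real.sqrt B.det)⁻¹ * Real.exp (-(ξ ⬝ᵥ (B⁻¹ *ᵥ ξ)) / 4))

lemma integral_mul_centredGaussian {B : Matrix (Fin d) (Fin d) ℝ} {S : Matrix (Fin d) (Fin d) ℝ}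
    (hdet : S.det ≠ 0) (hsqrt : Real.sqrt B.det = |S.det|)
    (hS : ∀ η, (S *ᵥ η) ⬝ᵥ (B⁻¹ *ᵥ (S *ᵥ η)) = η ⬝ᵥ η) {f : (Fin d → ℝ) → ℝ}
    (hf : Continuous f) :
    ∫ ξ, f ξ * centredGaussian B ξ = (Real.sqrt (4 * Real.pi) ^ d)⁻¹ *
      ∫ η, f (S *ᵥ η) * Real.exp (-(η ⬝ᵥ η) / 4) := by
  have hc : Continuous (centredGaussian B) := by unfold centredGaussian; fun_prop
  rw [integral_comp_mulVec hdet (f := fun ξ => f ξ * centredGaussian B ξ) (hf.mul hc), ← integral_const_mul, ← integral_const_mul]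
  congr 1; funext η
  simp only [centredGaussian, hS, hsqrt]
  have := abs_pos.2 hdet
  field_simp

variable {B : Matrix (Fin d) (Fin d) ℝ}

lemma integral_centredGaussian (hB : B.PosDef) : ∫ ξ, centredGaussian B ξ = 1 := by
  obtain ⟨S, -, hdet, hsqrt, hS⟩ := exists_sqrt_matrix hB
  have := integral_mul_centredGaussian hdet hsqrt hS (f := fun _ => 1) continuous_const
  simp only [one_mul] at this
  rw [this, integral_exp_neg_dotProduct, inv_mul_cancel₀ (by positivity)]

lemma integrable_polynomial_exp (n : ℕ) {f : (Fin d → ℝ) → ℝ} (hf : Continuous f)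
    (hb : ∀ ξ, |f ξ| ≤ (1 + ξ ⬝ᵥ ξ) ^ n) :
    Integrable fun ξ : Fin d → ℝ => f ξ * Real.exp (-(ξ ⬝ᵥ ξ) / 4) := by
  refine (integrable_pow_mul_exp_neg_dotProduct n (c := 1 / 4) (by norm_num)).mono'
    (by fun_prop) (ae_of_all _ fun ξ => ?_)
  rw [norm_mul, Real.norm_eq_abs, Real.norm_eq_abs, Real.abs_exp,
    show -(ξ ⬝ᵥ ξ) / 4 = -(1 / 4) * (ξ ⬝ᵥ ξ) by ring]
  exact mul_le_mul_of_nonneg_right (hb ξ) (Real.exp_pos _).le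

lemma integral_coord_centredGaussian (hB : B.PosDef) (i : Fin d) :
    ∫ ξ, ξ i * centredGaussian B ξ = 0 := by
  obtain ⟨S, -, hdet, hsqrt, hS⟩ := exists_sqrt_matrix hB
  rw [integral_mul_centredGaussian hdet hsqrt hS (f := fun ξ => ξ i) (by fun_prop)]
  simp only [mulVec_apply_sum, Finset.sum_mul, mul_assoc]
  rw [integral_finsetSum]
  · simp [integral_const_mul, integral_coord_exp_neg_dotProduct]
  · intro k _
    exact (integrable_polynomial_exp 1 (by fun_prop)
      (fun ξ => by simpa using abs_coord_le ξ k)).const_mul _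

lemma integral_mul_coord_centredGaussian (hB : B.PosDef) (i j : Fin d) :
    ∫ ξ, ξ i * ξ j * centredGaussian B ξ = 2 * B i j := by
  obtain ⟨S, hBS, hdet, hsqrt, hS⟩ := exists_sqrt_matrix hB
  rw [integral_mul_centredGaussian hdet hsqrt hS (f := fun ξ => ξ i * ξ j) (by fun_prop)]
  have hint : ∀ k l, Integrable fun η : Fin d → ℝ =>
      S i k * S j l * (η k * η l * Real.exp (-(η ⬝ᵥ η) / 4)) := fun k l =>
    (integrable_polynomial_exp 2 (by fun_prop) (fun ξ => by
      rw [abs_mul, pow_two]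
      exact mul_le_mul (abs_coord_le ξ k) (abs_coord_le ξ l) (abs_nonneg _)
        ((abs_nonneg _).trans (abs_coord_le ξ k)))).const_mul _
  have h1 : ∀ η : Fin d → ℝ, (S *ᵥ η) i * (S *ᵥ η) j * Real.exp (-(η ⬝ᵥ η) / 4)
      = ∑ k, ∑ l, S i k * S j l * (η k * η l * Real.exp (-(η ⬝ᵥ η) / 4)) := fun η => by
    simp only [mulVec_apply_sum]
    rw [Finset.sum_mul_sum, Finset.sum_mul]
    simp only [Finset.sum_mul]
    exact Finset.sum_congr rfl fun k _ => Finset.sum_congr rfl fun l _ => by ring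
  simp only [h1]
  rw [integral_finsetSum _ fun k _ => integrable_finsetSum _ fun l _ => hint k l]
  simp only [integral_finsetSum _ fun l _ => hint _ l, integral_const_mul,
    integral_mul_coord_exp_neg_dotProduct]
  have hne : Real.sqrt (4 * Real.pi) ^ d ≠ 0 := by positivity
  rw [hBS]
  simp only [Matrix.mul_apply, Matrix.transpose_apply, mul_ite, mul_zero, Finset.sum_ite_eq,
    Finset.mem_univ, if_true, Finset.mul_sum]
  exact Finset.sum_congr rfl fun k _ => by field_simp

end GaussianMoments

/-! ### Families of functions dominated by a Gaussian -/

section GaussianDomination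

variable {d : ℕ}

/-- A bound of `g y ξ` by a Gaussian in `ξ`, uniformly in `y`. -/
def GaussBound (g : (Fin d → ℝ) → (Fin d → ℝ) → ℝ) : Prop :=
  ∃ C c : ℝ, 0 ≤ C ∧ 0 < c ∧ ∀ y ξ, |g y ξ| ≤ C * Real.exp (-c * (ξ ⬝ᵥ ξ))

/-- `g y ξ` is continuous, dominated by a Gaussian in `ξ` uniformly in `y`, and so are its partial
derivatives in `y` up to order `n`. -/
def GaussDom : ℕ → ((Fin d → ℝ) → (Fin d → ℝ) → ℝ) → Prop
  | 0, g => Continuous (fun p : (Fin d → ℝ) × (Fin d → ℝ) => g p.1 p.2) ∧ GaussBound g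
  | n + 1, g => (Continuous (fun p : (Fin d → ℝ) × (Fin d → ℝ) => g p.1 p.2) ∧ GaussBound g) ∧
      (∀ ξ, Differentiable ℝ (fun y => g y ξ)) ∧
      ∀ i, GaussDom n (fun y ξ => partialD i (fun z => g z ξ) y)

namespace GaussBound

variable {g g' : (Fin d → ℝ) → (Fin d → ℝ) → ℝ}

lemma add (hg : GaussBound g) (hg' : GaussBound g') : GaussBound fun y ξ => g y ξ + g' y ξ := by
  obtain ⟨C, c, hC, hc, h⟩ := hg
  obtain ⟨C', c', hC', hc', h'⟩ := hg'
  refine ⟨C + C', min c c', by positivity, by positivity, fun y ξ => (abs_add_le _ _).trans ?_⟩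
  have h0 := dotProduct_self_nonneg' ξ
  rw [add_mul]
  refine add_le_add ((h y ξ).trans (mul_le_mul_of_nonneg_left (Real.exp_le_exp.2 ?_) hC))
    ((h' y ξ).trans (mul_le_mul_of_nonneg_left (Real.exp_le_exp.2 ?_) hC'))
  · nlinarith [min_le_left c c']
  · nlinarith [min_le_right c c']

lemma of_le_pow_mul (n : ℕ) {K : ℝ} (hg : GaussBound g)
    (h : ∀ y ξ, |g' y ξ| ≤ K * (1 + ξ ⬝ᵥ ξ) ^ n * |g y ξ|) : GaussBound g' := by
  obtain ⟨C, c, hC, hc, hgb⟩ := hg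
  obtain ⟨K', c', hK', hc', hK⟩ := pow_mul_exp_le n hc
  refine ⟨|K| * C * K', c', by positivity, hc', fun y ξ => (h y ξ).trans ?_⟩
  have h0 := dotProduct_self_nonneg' ξ
  calc K * (1 + ξ ⬝ᵥ ξ) ^ n * |g y ξ|
      ≤ |K| * (1 + ξ ⬝ᵥ ξ) ^ n * (C * Real.exp (-c * (ξ ⬝ᵥ ξ))) :=
        mul_le_mul (mul_le_mul_of_nonneg_right (le_abs_self K) (by positivity)) (hgb y ξ)
          (abs_nonneg _) (by positivity)
    _ = |K| * C * ((1 + ξ ⬝ᵥ ξ) ^ n * Real.exp (-c * (ξ ⬝ᵥ ξ))) := by ring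
    _ ≤ |K| * C * (K' * Real.exp (-c' * (ξ ⬝ᵥ ξ))) :=
        mul_le_mul_of_nonneg_left (hK _ h0) (by positivity)
    _ = _ := by ring

end GaussBound

namespace GaussDom

variable {n : ℕ} {g g' : (Fin d → ℝ) → (Fin d → ℝ) → ℝ}

lemma cont (hg : GaussDom n g) :
    Continuous (fun p : (Fin d → ℝ) × (Fin d → ℝ) => g p.1 p.2) := by
  cases n with
  | zero => exact hg.1
  | succ n => exact hg.1.1

lemma gaussBound (hg : GaussDom n g) : GaussBound g := by
  cases n with
  | zero => exact hg.2
  | succ n => exact hg.1.2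

lemma of_succ (hg : GaussDom (n + 1) g) : GaussDom n g := by
  induction n generalizing g with
  | zero => exact ⟨hg.cont, hg.gaussBound⟩
  | succ n ih => exact ⟨hg.1, hg.2.1, fun i => ih (hg.2.2 i)⟩

lemma add (hg : GaussDom n g) (hg' : GaussDom n g') : GaussDom n fun y ξ => g y ξ + g' y ξ := by
  induction n generalizing g g' with
  | zero => exact ⟨hg.1.add hg'.1, hg.2.add hg'.2⟩
  | succ n ih =>
    refine ⟨⟨hg.1.1.add hg'.1.1, hg.1.2.add hg'.1.2⟩,
      fun ξ => (hg.2.1 ξ).add (hg'.2.1 ξ), fun i => ?_⟩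
    simp only [partialD_add i (hg.2.1 _ _) (hg'.2.1 _ _)]
    exact ih (hg.2.2 i) (hg'.2.2 i)

lemma bddC_mul {f : (Fin d → ℝ) → ℝ} (hf : BddC n f) (hg : GaussDom n g) :
    GaussDom n fun y ξ => f y * g y ξ := by
  have hb : GaussBound fun y ξ => f y * g y ξ := by
    obtain ⟨C, hC⟩ := hf.bound
    refine hg.gaussBound.of_le_pow_mul 0 (K := C) fun y ξ => ?_
    rw [abs_mul, pow_zero, mul_one]
    exact mul_le_mul_of_nonneg_right (hC y) (abs_nonneg _)
  have hc : Continuous (fun p : (Fin d → ℝ) × (Fin d → ℝ) => f p.1 * g p.1 p.2) :=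
    (hf.continuous.comp continuous_fst).mul hg.cont
  induction n generalizing f g with
  | zero => exact ⟨hc, hb⟩
  | succ n ih =>
    refine ⟨⟨hc, hb⟩, fun ξ => hf.1.mul (hg.2.1 ξ), fun i => ?_⟩
    simp only [partialD_mul i (hf.1 _) (hg.2.1 _ _)]
    have aux : ∀ {f : (Fin d → ℝ) → ℝ} {g : (Fin d → ℝ) → (Fin d → ℝ) → ℝ}, BddC n f →
        GaussDom n g → GaussDom n fun y ξ => f y * g y ξ := fun {f g} hf hg => by
      refine ih hf hg ?_ ((hf.continuous.comp continuous_fst).mul hg.cont)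
      obtain ⟨C, hC⟩ := hf.bound
      refine hg.gaussBound.of_le_pow_mul 0 (K := C) fun y ξ => ?_
      rw [abs_mul, pow_zero, mul_one]
      exact mul_le_mul_of_nonneg_right (hC y) (abs_nonneg _)
    exact (aux (hf.2.2 i) hg.of_succ).add (aux hf.of_succ (hg.2.2 i))

lemma coord_mul (k : Fin d) (hg : GaussDom n g) : GaussDom n fun y ξ => ξ k * g y ξ := by
  have hb : ∀ {g : (Fin d → ℝ) → (Fin d → ℝ) → ℝ}, GaussBound g →
      GaussBound fun y ξ => ξ k * g y ξ := fun {g} h =>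
    h.of_le_pow_mul 1 (K := 1) fun y ξ => by
      rw [abs_mul, one_mul, pow_one]
      exact mul_le_mul_of_nonneg_right (abs_coord_le ξ k) (abs_nonneg _)
  have hc : ∀ {g : (Fin d → ℝ) → (Fin d → ℝ) → ℝ},
      Continuous (fun p : (Fin d → ℝ) × (Fin d → ℝ) => g p.1 p.2) →
      Continuous (fun p : (Fin d → ℝ) × (Fin d → ℝ) => p.2 k * g p.1 p.2) := fun {g} h =>
    ((continuous_apply k).comp continuous_snd).mul h
  induction n generalizing g with
  | zero => exact ⟨hc hg.1, hb hg.2⟩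
  | succ n ih =>
    refine ⟨⟨hc hg.1.1, hb hg.1.2⟩, fun ξ => (hg.2.1 ξ).const_mul _, fun i => ?_⟩
    simp only [partialD_const_mul i _ (hg.2.1 _ _)]
    exact ih (hg.2.2 i)

lemma zero : GaussDom n fun (_ _ : Fin d → ℝ) => (0 : ℝ) := by
  induction n with
  | zero => exact ⟨continuous_const, 0, 1, le_rfl, one_pos, by simp⟩
  | succ n ih =>
    refine ⟨⟨continuous_const, 0, 1, le_rfl, one_pos, by simp⟩,
      fun ξ => differentiable_const _, fun i => ?_⟩
    simp only [partialD_const]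
    exact ih

lemma sum {ι : Type*} (s : Finset ι) {g : ι → (Fin d → ℝ) → (Fin d → ℝ) → ℝ}
    (hg : ∀ a ∈ s, GaussDom n (g a)) : GaussDom n fun y ξ => ∑ a ∈ s, g a y ξ := by
  classical
  induction s using Finset.induction_on with
  | empty => simpa using zero
  | insert a s ha ih =>
    simp only [Finset.sum_insert ha]
    exact (hg a (Finset.mem_insert_self a s)).add
      (ih fun b hb => hg b (Finset.mem_insert_of_mem hb))

lemma const_mul (c : ℝ) (hg : GaussDom n g) : GaussDom n fun y ξ => c * g y ξ :=
  bddC_mul (BddC.const n c) hg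

lemma dotProduct_mulVec_eq_sum (Q : Matrix (Fin d) (Fin d) ℝ) (ξ : Fin d → ℝ) :
    ξ ⬝ᵥ (Q *ᵥ ξ) = ∑ i, ∑ j, ξ i * (ξ j * Q i j) := by
  simp only [dotProduct, Matrix.mulVec, Finset.mul_sum]
  exact Finset.sum_congr rfl fun i _ => Finset.sum_congr rfl fun j _ => by ring

/-- Gaussians with a uniformly positive quadratic form. -/
lemma exp_quadratic {Q : (Fin d → ℝ) → Matrix (Fin d) (Fin d) ℝ}
    (hQ : ∀ i j, BddC n fun y => Q y i j) {c : ℝ} (hc : 0 < c)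
    (hQc : ∀ y ξ : Fin d → ℝ, c * (ξ ⬝ᵥ ξ) ≤ ξ ⬝ᵥ (Q y *ᵥ ξ)) :
    GaussDom n fun y ξ => Real.exp (-(ξ ⬝ᵥ (Q y *ᵥ ξ)) / 4) := by
  have hcont : Continuous (fun p : (Fin d → ℝ) × (Fin d → ℝ) =>
      Real.exp (-(p.2 ⬝ᵥ (Q p.1 *ᵥ p.2)) / 4)) := by
    have : ∀ i j, Continuous fun p : (Fin d → ℝ) × (Fin d → ℝ) => Q p.1 i j := fun i j =>
      (hQ i j).continuous.comp continuous_fst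
    simp only [dotProduct_mulVec_eq_sum]
    refine Real.continuous_exp.comp (Continuous.div_const (Continuous.neg ?_) _)
    exact continuous_finsetSum _ fun i _ => continuous_finsetSum _ fun j _ =>
      ((continuous_apply i).comp continuous_snd).mul
        (((continuous_apply j).comp continuous_snd).mul (this i j))
  have hb : GaussBound fun y ξ => Real.exp (-(ξ ⬝ᵥ (Q y *ᵥ ξ)) / 4) := by
    refine ⟨1, c / 4, zero_le_one, by positivity, fun y ξ => ?_⟩
    rw [Real.abs_exp, one_mul]
    refine Real.exp_le_exp.2 ?_
    have := hQc y ξ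
    linarith
  induction n with
  | zero => exact ⟨hcont, hb⟩
  | succ n ih =>
    have hd : ∀ ξ, Differentiable ℝ fun y => -(ξ ⬝ᵥ (Q y *ᵥ ξ)) / 4 := fun ξ => by
      have : ∀ i j, Differentiable ℝ fun y => Q y i j := fun i j => (hQ i j).1
      simp only [dotProduct_mulVec_eq_sum]
      fun_prop
    refine ⟨⟨hcont, hb⟩, fun ξ => (hd ξ).exp, fun k => ?_⟩
    have h : ∀ y ξ, partialD k (fun z => Real.exp (-(ξ ⬝ᵥ (Q z *ᵥ ξ)) / 4)) y
        = ∑ i, ∑ j, (-1 / 4) * (ξ i * (ξ j * (partialD k (fun z => Q z i j) y *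
          Real.exp (-(ξ ⬝ᵥ (Q y *ᵥ ξ)) / 4)))) := fun y ξ => by
      rw [(Real.hasDerivAt_exp _).partialD_comp (f := fun z => -(ξ ⬝ᵥ (Q z *ᵥ ξ)) / 4) k (hd ξ y)]
      have hij : ∀ i j, DifferentiableAt ℝ (fun z => ξ i * (ξ j * Q z i j)) y := fun i j =>
        (((hQ i j).1 y).const_mul _).const_mul _
      have h1 : (fun z => -(ξ ⬝ᵥ (Q z *ᵥ ξ)) / 4)
          = fun z => (-1 / 4) * ∑ i, ∑ j, ξ i * (ξ j * Q z i j) := by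
        funext z; rw [dotProduct_mulVec_eq_sum]; ring
      rw [h1, partialD_const_mul k _ (DifferentiableAt.fun_sum fun i _ =>
          DifferentiableAt.fun_sum fun j _ => hij i j),
        partialD_sum _ k fun i _ => DifferentiableAt.fun_sum fun j _ => hij i j]
      simp only [partialD_sum _ k fun j _ => hij _ j,
        partialD_const_mul k _ (((hQ _ _).1 y).const_mul _), partialD_const_mul k _ ((hQ _ _).1 y)]
      rw [Finset.mul_sum, Finset.mul_sum]
      refine Finset.sum_congr rfl fun i _ => ?_
      rw [Finset.mul_sum, Finset.mul_sum]
      refine Finset.sum_congr rfl fun j _ => ?_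
      ring
    simp only [h]
    have ih' := ih (fun i j => (hQ i j).of_succ)
    exact sum _ fun i _ => sum _ fun j _ => const_mul _ (coord_mul i (coord_mul j
      (bddC_mul ((hQ i j).2.2 k) ih')))

lemma continuous_comp (hg : GaussDom n g) {Y : (Fin d → ℝ) → (Fin d → ℝ)} (hY : Continuous Y) :
    Continuous fun ξ => g (Y ξ) ξ :=
  hg.cont.comp (hY.prodMk continuous_id)

lemma continuous_comp₂ (hg : GaussDom n g) {X : Type*} [TopologicalSpace X]
    {Y Z : X → (Fin d → ℝ)} (hY : Continuous Y) (hZ : Continuous Z) :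
    Continuous fun p => g (Y p) (Z p) :=
  hg.cont.comp (hY.prodMk hZ)

lemma integrable_comp (hg : GaussDom n g) {Y : (Fin d → ℝ) → (Fin d → ℝ)} (hY : Continuous Y) :
    Integrable fun ξ => g (Y ξ) ξ := by
  obtain ⟨C, c, hC, hc, h⟩ := hg.gaussBound
  exact ((integrable_exp_neg_dotProduct hc).const_mul C).mono'
    (hg.continuous_comp hY).aestronglyMeasurable (ae_of_all _ fun ξ => h _ ξ)

/-- Differentiation under the integral sign along a displacement that depends on `ξ`. -/
lemma hasDerivAt_integral (hg : GaussDom 1 g) {v : (Fin d → ℝ) → (Fin d → ℝ)}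
    (hv : Continuous v) (hv' : ∀ ξ k, |v ξ k| ≤ 1 + ξ ⬝ᵥ ξ) (x : Fin d → ℝ) (τ : ℝ) :
    HasDerivAt (fun s : ℝ => ∫ ξ, g (x + s • v ξ) ξ)
      (∫ ξ, ∑ k, v ξ k * partialD k (fun z => g z ξ) (x + τ • v ξ)) τ := by
  choose C c hC hc h using fun k => (hg.2.2 k).gaussBound
  have hY : ∀ s : ℝ, Continuous fun ξ => x + s • v ξ := fun s => by fun_prop
  refine (hasDerivAt_integral_of_dominated_loc_of_deriv_le (F := fun s ξ => g (x + s • v ξ) ξ)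
    (F' := fun s ξ => ∑ k, v ξ k * partialD k (fun z => g z ξ) (x + s • v ξ))
    (bound := fun ξ => ∑ k, C k * ((1 + ξ ⬝ᵥ ξ) ^ 1 * Real.exp (-c k * (ξ ⬝ᵥ ξ))))
    (s := univ) univ_mem
    (Eventually.of_forall fun s => (hg.continuous_comp (hY s)).aestronglyMeasurable)
    (hg.integrable_comp (hY τ)) ?_ ?_ ?_ ?_).2
  · refine Continuous.aestronglyMeasurable ?_
    exact continuous_finsetSum _ fun k _ => ((continuous_apply k).comp hv).mul
      ((hg.2.2 k).continuous_comp (hY τ))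
  · refine ae_of_all _ fun ξ s _ => (norm_sum_le _ _).trans (Finset.sum_le_sum fun k _ => ?_)
    rw [norm_mul, Real.norm_eq_abs, Real.norm_eq_abs]
    have h0 := dotProduct_self_nonneg' ξ
    calc _ ≤ (1 + ξ ⬝ᵥ ξ) * (C k * Real.exp (-c k * (ξ ⬝ᵥ ξ))) :=
          mul_le_mul (hv' ξ k) (h k _ ξ) (abs_nonneg _) (by positivity)
      _ = _ := by ring
  · exact integrable_finsetSum _ fun k _ =>
      (integrable_pow_mul_exp_neg_dotProduct 1 (hc k)).const_mul _
  · exact ae_of_all _ fun ξ s _ => (hg.2.1 ξ _).hasDerivAt_line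

/-- Partial derivatives of an integral that is known in closed form. -/
lemma integral_partialD (hg : GaussDom 1 g) {J : (Fin d → ℝ) → ℝ} (hJ : ∀ y, ∫ ξ, g y ξ = J y)
    {y : Fin d → ℝ} (hJd : DifferentiableAt ℝ J y) (i : Fin d) :
    ∫ ξ, partialD i (fun z => g z ξ) y = partialD i J y := by
  have h1 := hg.hasDerivAt_integral (v := fun _ => Pi.single i 1) continuous_const
    (fun ξ k => by
      have := dotProduct_self_nonneg' ξ
      by_cases hk : k = i
      · subst hk; simpa using this
      · simp only [Pi.single_apply, hk, if_false, abs_zero]; positivity) y 0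
  simp only [hJ, zero_smul, add_zero] at h1
  have h2 : HasDerivAt (fun s : ℝ => J (y + s • Pi.single i 1)) _ 0 :=
    DifferentiableAt.hasDerivAt_line (by simpa using hJd)
  have := h1.unique h2
  simpa [Pi.single_apply] using this

/-- First-order expansion of `∫ g (x + τ ξ) ξ dξ`. -/
lemma hasDerivAt_integral_id (hg : GaussDom 1 g) (x : Fin d → ℝ) (τ : ℝ) :
    HasDerivAt (fun s : ℝ => ∫ ξ, g (x + s • ξ) ξ)
      (∫ ξ, ∑ k, ξ k * partialD k (fun z => g z ξ) (x + τ • ξ)) τ :=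
  hg.hasDerivAt_integral continuous_id abs_coord_le x τ

lemma hasDerivAt_integral_zero (hg : GaussDom 1 g) {J : Fin d → (Fin d → ℝ) → ℝ}
    (hJ : ∀ k y, ∫ ξ, ξ k * g y ξ = J k y) {x : Fin d → ℝ}
    (hJd : ∀ k, DifferentiableAt ℝ (J k) x) :
    HasDerivAt (fun s : ℝ => ∫ ξ, g (x + s • ξ) ξ) (∑ k, partialD k (J k) x) 0 := by
  convert! hg.hasDerivAt_integral_id x 0 using 1
  simp only [zero_smul, add_zero]
  rw [integral_finsetSum _ fun k _ =>
    ((hg.2.2 k).coord_mul k).integrable_comp (continuous_const (y := x))]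
  refine Finset.sum_congr rfl fun k _ => ?_
  rw [← (hg.coord_mul k).integral_partialD (hJ k) (hJd k) k]
  simp only [partialD_const_mul k _ (hg.2.1 _ _)]

/-- A Peano form of the second-order Taylor expansion. -/
lemma _root_.isLittleO_sq_of_hasDerivAt {k k' : ℝ → ℝ} {a : ℝ} (hk : ∀ s, HasDerivAt k (k' s) s)
    (hk0 : k' 0 = 0) (hk' : HasDerivAt k' a 0) :
    (fun s => k s - k 0 - a / 2 * s ^ 2) =o[𝓝 0] fun s => s ^ 2 := by
  refine isLittleO_iff.2 fun ε hε => ?_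
  have h1 := (hasDerivAt_iff_isLittleO_nhds_zero.1 hk')
  simp only [zero_add, hk0, sub_zero, smul_eq_mul] at h1
  obtain ⟨δ, hδ, h2⟩ := Metric.eventually_nhds_iff.1 (isLittleO_iff.1 h1 hε)
  refine Metric.eventually_nhds_iff.2 ⟨δ, hδ, fun s hs => ?_⟩
  have hs' : |s| < δ := by simpa using hs
  have hd : ∀ r, HasDerivAt (fun s => k s - k 0 - a / 2 * s ^ 2) (k' r - r * a) r := fun r => by
    have := ((hk r).sub_const (k 0)).sub ((hasDerivAt_pow 2 r).const_mul (a / 2))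
    refine this.congr_deriv ?_
    simp; ring
  have := (convex_ball (0 : ℝ) δ).inter (convex_closedBall (0 : ℝ) |s|)
  have h3 := this.norm_image_sub_le_of_norm_hasDerivWithin_le (C := ε * |s|)
    (fun r _ => (hd r).hasDerivWithinAt) (fun r hr => by
      refine (h2 (by simpa using hr.1)).trans ?_
      exact mul_le_mul_of_nonneg_left (by simpa using hr.2) hε.le)
    (x := 0) (y := s) (by simp [hδ]) (by simp [hs'])
  simp only [sub_self, ne_eq, OfNat.ofNat_ne_zero, not_false_eq_true, zero_pow, mul_zero,
    sub_zero, Real.norm_eq_abs] at h3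
  rw [Real.norm_eq_abs, Real.norm_eq_abs, abs_pow, pow_two |s|, ← mul_assoc]
  exact h3

/-- Second-order expansion of `∫ g (x + τ ξ) ξ dξ`. -/
lemma isLittleO_integral (hg : GaussDom 2 g) {J₁ : Fin d → (Fin d → ℝ) → ℝ}
    {J₂ : Fin d → Fin d → (Fin d → ℝ) → ℝ} {J₂' : Fin d → Fin d → Fin d → (Fin d → ℝ) → ℝ}
    (hJ₁ : ∀ k y, ∫ ξ, ξ k * g y ξ = J₁ k y) (hJ₁d : ∀ k, Differentiable ℝ (J₁ k))
    (x : Fin d → ℝ) (hJ₁0 : ∑ k, partialD k (J₁ k) x = 0)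
    (hJ₂ : ∀ k l y, ∫ ξ, ξ k * (ξ l * g y ξ) = J₂ k l y) (hJ₂d : ∀ k l, Differentiable ℝ (J₂ k l))
    (hJ₂' : ∀ k l i y, partialD i (J₂ k l) y = J₂' k l i y)
    (hJ₂'d : ∀ k l i, Differentiable ℝ (J₂' k l i)) :
    (fun s : ℝ => (∫ ξ, g (x + s • ξ) ξ) - (∫ ξ, g x ξ)
      - (∑ k, ∑ l, partialD k (J₂' k l l) x) / 2 * s ^ 2) =o[𝓝 0] fun s => s ^ 2 := by
  have hg1 : GaussDom 1 fun y ξ => ∑ l, ξ l * partialD l (fun z => g z ξ) y :=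
    sum _ fun l _ => (hg.2.2 l).coord_mul l
  have hk := fun s => hg.of_succ.hasDerivAt_integral_id x s
  have h0 := (hk 0).unique (hg.of_succ.hasDerivAt_integral_zero hJ₁ fun k => hJ₁d k x)
  have hd := hg1.hasDerivAt_integral_zero (J := fun k y => ∑ l, J₂' k l l y) (fun k y => by
    simp only [Finset.mul_sum]
    rw [integral_finsetSum _ fun l _ =>
      (((hg.2.2 l).coord_mul l).coord_mul k).integrable_comp (continuous_const (y := y))]
    refine Finset.sum_congr rfl fun l _ => ?_
    rw [← hJ₂', ← ((hg.of_succ.coord_mul l).coord_mul k).integral_partialD (hJ₂ k l) (hJ₂d k l y) l]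
    simp only [partialD_const_mul l _ (hg.2.1 _ _),
      partialD_const_mul l _ ((hg.2.1 _ _).const_mul _)])
    (x := x) (fun k => DifferentiableAt.fun_sum fun l _ => hJ₂'d k l l x)
  have := isLittleO_sq_of_hasDerivAt hk (h0.trans hJ₁0) hd
  simp only [partialD_sum _ _ fun l _ => hJ₂'d _ l l x, zero_smul, add_zero] at this
  exact this

end GaussDom

end GaussianDomination

/-! ### The rescaled time slice -/

section RescaledSlice

namespace SliceRegular

variable {d m : ℕ} {F : (Fin d → ℝ) → Fin d → ℝ} {b : (Fin d → ℝ) → Fin d → Fin m → ℝ}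

/-- The Gaussian in the rescaled increment `ξ`, with coefficients at `y`. -/
def sliceGaussian (b : (Fin d → ℝ) → Fin d → Fin m → ℝ) (y ξ : Fin d → ℝ) : ℝ :=
  centredGaussian (diffusionB b y) ξ

lemma gaussDom_sliceGaussian (hreg : SliceRegular F b) : GaussDom 2 (sliceGaussian b) := by
  obtain ⟨c, hc, h⟩ := hreg.exists_inv_lower
  exact GaussDom.const_mul _ (GaussDom.bddC_mul hreg.inv_sqrt_det_bddC
    (GaussDom.exp_quadratic hreg.inv_bddC hc h))

lemma sliceGaussian_nonneg (y ξ : Fin d → ℝ) : 0 ≤ sliceGaussian b y ξ := by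
  unfold sliceGaussian centredGaussian; positivity

lemma integral_sliceGaussian (hreg : SliceRegular F b) (y : Fin d → ℝ) :
    ∫ ξ, sliceGaussian b y ξ = 1 := integral_centredGaussian (hreg.diffusionB_posDef y)

lemma integral_coord_sliceGaussian (hreg : SliceRegular F b) (i : Fin d) (y : Fin d → ℝ) :
    ∫ ξ, ξ i * sliceGaussian b y ξ = 0 :=
  integral_coord_centredGaussian (hreg.diffusionB_posDef y) i

lemma integral_mul_coord_sliceGaussian (hreg : SliceRegular F b) (i j : Fin d) (y : Fin d → ℝ) :
    ∫ ξ, ξ i * (ξ j * sliceGaussian b y ξ) = 2 * diffusionB b y i j := by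
  simpa only [mul_assoc, sliceGaussian] using
    integral_mul_coord_centredGaussian (hreg.diffusionB_posDef y) i j

lemma integral_dotProduct_mul_sliceGaussian (hreg : SliceRegular F b) (y v w : Fin d → ℝ) :
    ∫ ξ, sliceGaussian b y ξ * ((v ⬝ᵥ ξ) * (w ⬝ᵥ ξ)) = 2 * (v ⬝ᵥ (diffusionB b y *ᵥ w)) := by
  have h1 : ∀ ξ, sliceGaussian b y ξ * ((v ⬝ᵥ ξ) * (w ⬝ᵥ ξ))
      = ∑ i, ∑ j, v i * w j * (ξ i * (ξ j * sliceGaussian b y ξ)) := fun ξ => by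
    rw [dotProduct, dotProduct, Finset.sum_mul_sum, Finset.mul_sum]
    refine Finset.sum_congr rfl fun i _ => ?_
    rw [Finset.mul_sum]
    exact Finset.sum_congr rfl fun j _ => by ring
  have hint : ∀ i j, Integrable fun ξ => v i * w j * (ξ i * (ξ j * sliceGaussian b y ξ)) :=
    fun i j => ((hreg.gaussDom_sliceGaussian.coord_mul j).coord_mul i |>.integrable_comp
      (continuous_const (y := y))).const_mul _
  simp only [h1]
  rw [integral_finsetSum _ fun i _ => integrable_finsetSum _ fun j _ => hint i j]
  simp only [integral_finsetSum _ fun j _ => hint _ j, integral_const_mul,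
    hreg.integral_mul_coord_sliceGaussian, dotProduct, Matrix.mulVec, Finset.mul_sum]
  exact Finset.sum_congr rfl fun i _ => Finset.sum_congr rfl fun j _ => by ring

/-- The exponent of the rescaled time slice, apart from the Gaussian. -/
def sliceExponent (α αb θ : ℝ) (F : (Fin d → ℝ) → Fin d → ℝ)
    (b : (Fin d → ℝ) → Fin d → Fin m → ℝ) (x : Fin d → ℝ) (ε : ℝ) (ξ : Fin d → ℝ) : ℝ :=
  ε / 2 * (totalDrift α αb F b (x + (α * ε) • ξ) ⬝ᵥ ((diffusionB b (x + (α * ε) • ξ))⁻¹ *ᵥ ξ))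
    - ε ^ 2 / 4 * (totalDrift α αb F b (x + (α * ε) • ξ) ⬝ᵥ
      ((diffusionB b (x + (α * ε) • ξ))⁻¹ *ᵥ totalDrift α αb F b (x + (α * ε) • ξ)))
    + ε ^ 2 * extraTerms α αb F b (x + (θ * ε) • ξ)

lemma dotProduct_mulVec_comm {P : Matrix (Fin d) (Fin d) ℝ} (hP : P.IsSymm) (v w : Fin d → ℝ) :
    v ⬝ᵥ (P *ᵥ w) = w ⬝ᵥ (P *ᵥ v) := by
  rw [Matrix.dotProduct_mulVec, ← Matrix.mulVec_transpose, hP.eq, dotProduct_comm]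

lemma rescaled_sliceDensity (α αb θ : ℝ) (x ξ : Fin d → ℝ) {ε : ℝ} (hε : 0 < ε) :
    ε ^ d * sliceDensity α αb θ F b (ε ^ 2) x (x + ε • ξ)
      = sliceGaussian b (x + (α * ε) • ξ) ξ * Real.exp (sliceExponent α αb θ F b x ε ξ) := by
  have h1 : x + α • (x + ε • ξ - x) = x + (α * ε) • ξ := by
    rw [add_sub_cancel_left, smul_smul]
  have h2 : x + θ • (x + ε • ξ - x) = x + (θ * ε) • ξ := by
    rw [add_sub_cancel_left, smul_smul]
  simp only [sliceDensity, h1, h2]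
  set y := x + (α * ε) • ξ
  set z := x + (θ * ε) • ξ
  set A := totalDrift α αb F b y with hA
  set P := (diffusionB b y)⁻¹ with hP
  have hu : (fun i => (x + ε • ξ - x) i - F y i * ε ^ 2 - spuriousDrift α αb b y i * ε ^ 2)
      = ε • ξ - ε ^ 2 • A := by
    funext i
    simp only [hA, totalDrift, Pi.add_apply, Pi.sub_apply, Pi.smul_apply, smul_eq_mul]
    ring
  have hkin : kineticTerm b (ε ^ 2) y (ε • ξ - ε ^ 2 • A)
      = (ξ ⬝ᵥ (P *ᵥ ξ)) / 4 - ε / 2 * (A ⬝ᵥ (P *ᵥ ξ)) + ε ^ 2 / 4 * (A ⬝ᵥ (P *ᵥ A)) := by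
    simp only [kineticTerm, ← hP, Matrix.mulVec_sub, Matrix.mulVec_smul, sub_dotProduct,
      dotProduct_sub, smul_dotProduct, dotProduct_smul, smul_eq_mul]
    rw [dotProduct_mulVec_comm (inv_isSymm y) ξ A]
    field_simp
    ring
  have hpre : ε ^ d * slicePrefactor b (ε ^ 2) y
      = (Real.sqrt (4 * Real.pi) ^ d)⁻¹ * (Real.sqrt (diffusionB b y).det)⁻¹ := by
    rw [slicePrefactor, mul_pow, mul_assoc, mul_comm ((ε ^ 2) ^ d),
      ← mul_assoc, Real.sqrt_mul' _ (by positivity), Real.sqrt_mul (by positivity), ← pow_mul,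
      mul_comm 2 d, pow_mul, Real.sqrt_sq (by positivity)]
    have h3 : Real.sqrt ((4 * Real.pi) ^ d) = Real.sqrt (4 * Real.pi) ^ d := by
      rw [Real.sqrt_eq_iff_eq_sq (by positivity) (by positivity), ← pow_mul, mul_comm d 2, pow_mul,
        Real.sq_sqrt (by positivity)]
    rw [h3, one_div, mul_inv, mul_inv]
    field_simp
  rw [hu, hkin, ← mul_assoc, hpre, sliceGaussian, centredGaussian, ← hP]
  have hexp : Real.exp (-(ξ ⬝ᵥ (P *ᵥ ξ) / 4 - ε / 2 * (A ⬝ᵥ (P *ᵥ ξ))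
        + ε ^ 2 / 4 * (A ⬝ᵥ (P *ᵥ A))) + extraTerms α αb F b z * ε ^ 2)
      = Real.exp (-(ξ ⬝ᵥ (P *ᵥ ξ)) / 4) * Real.exp (sliceExponent α αb θ F b x ε ξ) := by
    rw [← Real.exp_add, sliceExponent]
    congr 1
    ring
  rw [hexp]
  ring

lemma exists_bilin_bound (hreg : SliceRegular F b) :
    ∃ K, 0 < K ∧ ∀ y u v : Fin d → ℝ, |u ⬝ᵥ ((diffusionB b y)⁻¹ *ᵥ v)| ≤ K * (‖u‖ * ‖v‖) := by
  obtain ⟨K, hK⟩ := hreg.exists_inv_upper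
  refine ⟨(∑ _i : Fin d, ∑ _j : Fin d, |K|) + 1, by positivity, fun y u v => ?_⟩
  have hnn : 0 ≤ ‖u‖ * ‖v‖ := by positivity
  have h1 : |u ⬝ᵥ ((diffusionB b y)⁻¹ *ᵥ v)| ≤ ∑ _i : Fin d, ∑ _j : Fin d, |K| * (‖u‖ * ‖v‖) := by
    simp only [dotProduct, Matrix.mulVec, Finset.mul_sum]
    refine (Finset.abs_sum_le_sum_abs _ _).trans (Finset.sum_le_sum fun i _ => ?_)
    refine (Finset.abs_sum_le_sum_abs _ _).trans (Finset.sum_le_sum fun j _ => ?_)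
    rw [abs_mul, abs_mul]
    calc |u i| * (|(diffusionB b y)⁻¹ i j| * |v j|) ≤ ‖u‖ * (|K| * ‖v‖) := by
          refine mul_le_mul (norm_le_pi_norm u i) (mul_le_mul ((hK y i j).trans (le_abs_self K))
            (norm_le_pi_norm v j) (abs_nonneg _) (abs_nonneg _)) (by positivity) (norm_nonneg _)
      _ = _ := by ring
  refine h1.trans ?_
  simp only [← Finset.sum_mul]
  nlinarith

lemma exists_lipschitz_totalDrift (hreg : SliceRegular F b) (α αb : ℝ) :
    ∃ L, 0 ≤ L ∧ ∀ y z, ‖totalDrift α αb F b y - totalDrift α αb F b z‖ ≤ L * ‖y - z‖ := by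
  choose L hL h using hreg.lipschitz_totalDrift α αb
  refine ⟨∑ i, L i, Finset.sum_nonneg fun i _ => hL i, fun y z => ?_⟩
  rw [pi_norm_le_iff_of_nonneg (mul_nonneg (Finset.sum_nonneg fun i _ => hL i) (norm_nonneg _))]
  intro i
  refine (h i y z).trans (mul_le_mul_of_nonneg_right ?_ (norm_nonneg _))
  exact Finset.single_le_sum (f := L) (fun i _ => hL i) (Finset.mem_univ i)

lemma continuous_totalDrift (hreg : SliceRegular F b) (α αb : ℝ) :
    Continuous (totalDrift α αb F b) :=
  continuous_pi fun i => (hreg.differentiable_totalDrift α αb i).continuous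

lemma continuous_bilin (hreg : SliceRegular F b) {X : Type*} [TopologicalSpace X]
    {y u v : X → Fin d → ℝ} (hy : Continuous y) (hu : Continuous u) (hv : Continuous v) :
    Continuous fun p => u p ⬝ᵥ ((diffusionB b (y p))⁻¹ *ᵥ v p) := by
  simp only [dotProduct, Matrix.mulVec]
  exact continuous_finsetSum _ fun i _ => ((continuous_apply i).comp hu).mul
    (continuous_finsetSum _ fun j _ => ((hreg.inv_bddC i j).continuous.comp hy).mul
      ((continuous_apply j).comp hv))

lemma continuous_sliceExponent (hreg : SliceRegular F b) (α αb θ : ℝ) (x : Fin d → ℝ) (ε : ℝ) :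
    Continuous (sliceExponent α αb θ F b x ε) := by
  have hA := hreg.continuous_totalDrift α αb
  have hE := (hreg.extraTerms_bddC α αb).continuous
  have hy : ∀ c : ℝ, Continuous fun ξ : Fin d → ℝ => x + c • ξ := fun c => by fun_prop
  exact (((hreg.continuous_bilin (hy _) (hA.comp (hy _)) continuous_id).const_mul _).sub
    ((hreg.continuous_bilin (hy _) (hA.comp (hy _)) (hA.comp (hy _))).const_mul _)).add
    ((hE.comp (hy _)).const_mul _)

/-- The part of the exponent of first order in `ε`, with the drift at the initial point. -/
def leadingExponent (α αb : ℝ) (F : (Fin d → ℝ) → Fin d → ℝ)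
    (b : (Fin d → ℝ) → Fin d → Fin m → ℝ) (x : Fin d → ℝ) (ε : ℝ) (ξ : Fin d → ℝ) : ℝ :=
  ε / 2 * (totalDrift α αb F b x ⬝ᵥ ((diffusionB b (x + (α * ε) • ξ))⁻¹ *ᵥ ξ))

lemma sliceExponent_bounds (hreg : SliceRegular F b) {α : ℝ} (hα : α ∈ Icc (0 : ℝ) 1)
    (αb θ : ℝ) (x : Fin d → ℝ) :
    ∃ K, 0 < K ∧ ∀ ε ∈ Ioc (0 : ℝ) 1, ∀ ξ,
      |sliceExponent α αb θ F b x ε ξ| ≤ K * ε * (1 + ξ ⬝ᵥ ξ) ∧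
      |sliceExponent α αb θ F b x ε ξ - leadingExponent α αb F b x ε ξ|
        ≤ K * ε ^ 2 * (1 + ξ ⬝ᵥ ξ) := by
  obtain ⟨K, hK, hKb⟩ := hreg.exists_bilin_bound
  obtain ⟨L, hL, hLb⟩ := hreg.exists_lipschitz_totalDrift α αb
  obtain ⟨C, hC, hCb⟩ := (hreg.extraTerms_bddC α αb).exists_pos_bound
  set a := ‖totalDrift α αb F b x‖ with ha
  have ha0 : 0 ≤ a := norm_nonneg _
  refine ⟨K * (a + L) + K * (a + L) ^ 2 + C + K * L + K * a, by positivity, fun ε hε ξ => ?_⟩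
  have hε0 : 0 < ε := hε.1
  have hε1 : ε ≤ 1 := hε.2
  set y := x + (α * ε) • ξ with hy
  set A := totalDrift α αb F b y with hA
  set q := ξ ⬝ᵥ ξ
  have hn0 := norm_nonneg ξ
  have hq : ‖ξ‖ ^ 2 ≤ q := norm_sq_le_dotProduct ξ
  have hAd : ‖A - totalDrift α αb F b x‖ ≤ L * ε * ‖ξ‖ := by
    refine (hLb y x).trans ?_
    rw [hy, add_sub_cancel_left, norm_smul, Real.norm_eq_abs,
      abs_of_nonneg (mul_nonneg hα.1 hε0.le), mul_assoc L]
    refine mul_le_mul_of_nonneg_left ?_ hL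
    exact mul_le_mul_of_nonneg_right (by nlinarith [hα.2]) hn0
  have hAn : ‖A‖ ≤ (a + L) * (1 + ‖ξ‖) := by
    have h1 : ‖A‖ ≤ a + L * ε * ‖ξ‖ := by
      have := norm_add_le (totalDrift α αb F b x) (A - totalDrift α αb F b x)
      rw [add_sub_cancel] at this
      linarith
    have h2 : L * ε * ‖ξ‖ ≤ L * ‖ξ‖ :=
      mul_le_mul_of_nonneg_right (by nlinarith) hn0
    nlinarith [mul_nonneg ha0 hn0]
  have hAP : |A ⬝ᵥ ((diffusionB b y)⁻¹ *ᵥ A)| ≤ 2 * (K * (a + L) ^ 2 * (1 + q)) := by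
    refine (hKb y A A).trans ?_
    have h1 : ‖A‖ * ‖A‖ ≤ ((a + L) * (1 + ‖ξ‖)) * ((a + L) * (1 + ‖ξ‖)) :=
      mul_le_mul hAn hAn (norm_nonneg _) (by positivity)
    calc K * (‖A‖ * ‖A‖) ≤ K * (((a + L) * (1 + ‖ξ‖)) * ((a + L) * (1 + ‖ξ‖))) :=
          mul_le_mul_of_nonneg_left h1 hK.le
      _ = K * (a + L) ^ 2 * (1 + ‖ξ‖) ^ 2 := by ring
      _ ≤ K * (a + L) ^ 2 * (2 * (1 + q)) := by
          refine mul_le_mul_of_nonneg_left ?_ (by positivity)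
          nlinarith [sq_nonneg (‖ξ‖ - 1)]
      _ = _ := by ring
  have hE := hCb (x + (θ * ε) • ξ)
  have hq0 : 0 ≤ q := (sq_nonneg _).trans hq
  have hsecond : |(sliceExponent α αb θ F b x ε ξ
      - ε / 2 * (A ⬝ᵥ ((diffusionB b y)⁻¹ *ᵥ ξ)))| ≤ ε ^ 2 * ((K * (a + L) ^ 2 + C) * (1 + q)) := by
    have h1 : sliceExponent α αb θ F b x ε ξ - ε / 2 * (A ⬝ᵥ ((diffusionB b y)⁻¹ *ᵥ ξ))
        = ε ^ 2 * (extraTerms α αb F b (x + (θ * ε) • ξ)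
          - 1 / 4 * (A ⬝ᵥ ((diffusionB b y)⁻¹ *ᵥ A))) := by
      simp only [sliceExponent, ← hy, ← hA]; ring
    rw [h1, abs_mul, abs_of_nonneg (sq_nonneg ε)]
    refine mul_le_mul_of_nonneg_left ((abs_sub _ _).trans ?_) (sq_nonneg _)
    rw [abs_mul, abs_of_nonneg (by norm_num : (0 : ℝ) ≤ 1 / 4)]
    nlinarith [mul_nonneg hC.le hq0, mul_nonneg (mul_nonneg hK.le (sq_nonneg (a + L))) hq0]
  constructor
  · have hfirst : |ε / 2 * (A ⬝ᵥ ((diffusionB b y)⁻¹ *ᵥ ξ))| ≤ ε * (K * (a + L) * (1 + q)) := by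
      rw [abs_mul, abs_of_pos (half_pos hε0)]
      have h1 : ‖A‖ * ‖ξ‖ ≤ (a + L) * (2 * (1 + q)) := by
        calc ‖A‖ * ‖ξ‖ ≤ (a + L) * (1 + ‖ξ‖) * ‖ξ‖ := mul_le_mul_of_nonneg_right hAn hn0
          _ = (a + L) * ((1 + ‖ξ‖) * ‖ξ‖) := by ring
          _ ≤ _ := mul_le_mul_of_nonneg_left (by nlinarith [sq_nonneg (‖ξ‖ - 1)]) (by positivity)
      have h2 := (hKb y A ξ).trans (mul_le_mul_of_nonneg_left h1 hK.le)
      calc _ ≤ ε / 2 * (K * ((a + L) * (2 * (1 + q)))) :=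
            mul_le_mul_of_nonneg_left h2 (by positivity)
        _ = _ := by ring
    have h3 := abs_add_le (sliceExponent α αb θ F b x ε ξ
      - ε / 2 * (A ⬝ᵥ ((diffusionB b y)⁻¹ *ᵥ ξ))) (ε / 2 * (A ⬝ᵥ ((diffusionB b y)⁻¹ *ᵥ ξ)))
    rw [sub_add_cancel] at h3
    have h4 : ε ^ 2 * ((K * (a + L) ^ 2 + C) * (1 + q)) ≤ ε * ((K * (a + L) ^ 2 + C) * (1 + q)) :=
      mul_le_mul_of_nonneg_right (by nlinarith) (by positivity)
    have h5 : 0 ≤ (K * L + K * a) * ε * (1 + q) := by positivity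
    calc _ ≤ ε * ((K * (a + L) ^ 2 + C) * (1 + q)) + ε * (K * (a + L) * (1 + q)) := by linarith
      _ ≤ _ := by linarith
  · have hfirst : |ε / 2 * (A ⬝ᵥ ((diffusionB b y)⁻¹ *ᵥ ξ)) - leadingExponent α αb F b x ε ξ|
        ≤ ε ^ 2 * (K * L * (1 + q)) := by
      rw [leadingExponent, ← hy, ← mul_sub, ← sub_dotProduct, abs_mul, abs_of_pos (half_pos hε0)]
      have h1 : ‖A - totalDrift α αb F b x‖ * ‖ξ‖ ≤ L * ε * (1 + q) := by
        calc _ ≤ L * ε * ‖ξ‖ * ‖ξ‖ := mul_le_mul_of_nonneg_right hAd hn0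
          _ = L * ε * ‖ξ‖ ^ 2 := by ring
          _ ≤ _ := mul_le_mul_of_nonneg_left (by linarith) (by positivity)
      have h2 := (hKb y _ ξ).trans (mul_le_mul_of_nonneg_left h1 hK.le)
      calc _ ≤ ε / 2 * (K * (L * ε * (1 + q))) := mul_le_mul_of_nonneg_left h2 (by positivity)
        _ = 1 / 2 * (ε ^ 2 * (K * L * (1 + q))) := by ring
        _ ≤ _ := by
          have : 0 ≤ ε ^ 2 * (K * L * (1 + q)) := by positivity
          linarith
    have h3 := abs_add_le (sliceExponent α αb θ F b x ε ξ
      - ε / 2 * (A ⬝ᵥ ((diffusionB b y)⁻¹ *ᵥ ξ)))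
      (ε / 2 * (A ⬝ᵥ ((diffusionB b y)⁻¹ *ᵥ ξ)) - leadingExponent α αb F b x ε ξ)
    rw [sub_add_sub_cancel] at h3
    have h5 : 0 ≤ (K * (a + L) + K * a) * ε ^ 2 * (1 + q) := by positivity
    calc _ ≤ ε ^ 2 * ((K * (a + L) ^ 2 + C) * (1 + q)) + ε ^ 2 * (K * L * (1 + q)) := by linarith
      _ ≤ _ := by linarith

/-- The rescaled time slice is dominated by a Gaussian for small `ε`. -/
lemma exists_slice_domination (hreg : SliceRegular F b) {α : ℝ} (hα : α ∈ Icc (0 : ℝ) 1)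
    (αb θ : ℝ) (x : Fin d → ℝ) :
    ∃ C c ε₀ : ℝ, 0 ≤ C ∧ 0 < c ∧ 0 < ε₀ ∧ ε₀ ≤ 1 ∧ ∀ ε ∈ Ioc 0 ε₀, ∀ ξ,
      sliceGaussian b (x + (α * ε) • ξ) ξ * Real.exp |sliceExponent α αb θ F b x ε ξ|
        ≤ C * Real.exp (-c * (ξ ⬝ᵥ ξ)) := by
  obtain ⟨K, hK, hKb⟩ := hreg.sliceExponent_bounds hα αb θ x
  obtain ⟨C, c, hC, hc, hb⟩ := hreg.gaussDom_sliceGaussian.gaussBound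
  refine ⟨C * Real.exp (c / 2), c / 2, min 1 (c / (2 * K)), by positivity, by positivity,
    by positivity, min_le_left _ _, fun ε hε ξ => ?_⟩
  have hε1 : ε ≤ 1 := hε.2.trans (min_le_left _ _)
  have hε2 : K * ε ≤ c / 2 := by
    have := hε.2.trans (min_le_right _ _)
    rw [le_div_iff₀ (by positivity)] at this
    linarith
  have h0 := dotProduct_self_nonneg' ξ
  have h1 := (hKb ε ⟨hε.1, hε1⟩ ξ).1
  have h2 : |sliceExponent α αb θ F b x ε ξ| ≤ c / 2 * (1 + ξ ⬝ᵥ ξ) :=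
    h1.trans (mul_le_mul_of_nonneg_right hε2 (by positivity))
  calc _ ≤ (C * Real.exp (-c * (ξ ⬝ᵥ ξ))) * Real.exp (c / 2 * (1 + ξ ⬝ᵥ ξ)) :=
        mul_le_mul ((le_abs_self _).trans (hb _ ξ)) (Real.exp_le_exp.2 h2) (Real.exp_pos _).le
          (by positivity)
    _ = C * (Real.exp (-c * (ξ ⬝ᵥ ξ)) * Real.exp (c / 2 * (1 + ξ ⬝ᵥ ξ))) := by ring
    _ = C * (Real.exp (c / 2) * Real.exp (-(c / 2) * (ξ ⬝ᵥ ξ))) := by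
        rw [← Real.exp_add, ← Real.exp_add]; congr 2; ring
    _ = _ := by ring

/-- Dominated convergence for the rescaled time slice. -/
lemma tendsto_integral_slice (hreg : SliceRegular F b) {α : ℝ} (hα : α ∈ Icc (0 : ℝ) 1)
    (αb θ : ℝ) (x : Fin d → ℝ) {ψ : ℝ → (Fin d → ℝ) → ℝ} {ψ₀ : (Fin d → ℝ) → ℝ} {K : ℝ} (n : ℕ)
    (hψc : ∀ ε, 0 < ε → Continuous (ψ ε))
    (hψb : ∀ ε ∈ Ioc (0 : ℝ) 1, ∀ ξ, |ψ ε ξ|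
      ≤ K * (1 + ξ ⬝ᵥ ξ) ^ n * Real.exp |sliceExponent α αb θ F b x ε ξ|)
    (hψ : ∀ ξ, Tendsto (fun ε => ψ ε ξ) (𝓝[>] 0) (𝓝 (ψ₀ ξ))) :
    (∀ᶠ ε in 𝓝[>] (0 : ℝ), Integrable fun ξ => sliceGaussian b (x + (α * ε) • ξ) ξ * ψ ε ξ) ∧
    Tendsto (fun ε => ∫ ξ, sliceGaussian b (x + (α * ε) • ξ) ξ * ψ ε ξ) (𝓝[>] 0)
      (𝓝 (∫ ξ, sliceGaussian b x ξ * ψ₀ ξ)) := by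
  obtain ⟨C, c, ε₀, hC, hc, hε₀, hε₁, hb⟩ := hreg.exists_slice_domination hα αb θ x
  have hmem : ∀ᶠ ε in 𝓝[>] (0 : ℝ), ε ∈ Ioc 0 ε₀ := Ioc_mem_nhdsGT hε₀
  have hmeas : ∀ ε, 0 < ε → AEStronglyMeasurable
      (fun ξ => sliceGaussian b (x + (α * ε) • ξ) ξ * ψ ε ξ) volume := fun ε hε =>
    ((hreg.gaussDom_sliceGaussian.continuous_comp (by fun_prop)).mul (hψc ε hε)).aestronglyMeasurable
  have hbound : ∀ ε ∈ Ioc 0 ε₀, ∀ ξ, ‖sliceGaussian b (x + (α * ε) • ξ) ξ * ψ ε ξ‖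
      ≤ |K| * C * ((1 + ξ ⬝ᵥ ξ) ^ n * Real.exp (-c * (ξ ⬝ᵥ ξ))) := fun ε hε ξ => by
    have h0 := dotProduct_self_nonneg' ξ
    have hN := sliceGaussian_nonneg (b := b) (x + (α * ε) • ξ) ξ
    rw [norm_mul, Real.norm_eq_abs, Real.norm_eq_abs, abs_of_nonneg hN]
    calc _ ≤ sliceGaussian b (x + (α * ε) • ξ) ξ *
          (|K| * (1 + ξ ⬝ᵥ ξ) ^ n * Real.exp |sliceExponent α αb θ F b x ε ξ|) := by
          refine mul_le_mul_of_nonneg_left ((hψb ε ⟨hε.1, hε.2.trans hε₁⟩ ξ).trans ?_) hN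
          refine mul_le_mul_of_nonneg_right (mul_le_mul_of_nonneg_right (le_abs_self K) ?_)
            (Real.exp_pos _).le
          positivity
      _ = |K| * (1 + ξ ⬝ᵥ ξ) ^ n * (sliceGaussian b (x + (α * ε) • ξ) ξ *
          Real.exp |sliceExponent α αb θ F b x ε ξ|) := by ring
      _ ≤ |K| * (1 + ξ ⬝ᵥ ξ) ^ n * (C * Real.exp (-c * (ξ ⬝ᵥ ξ))) :=
          mul_le_mul_of_nonneg_left (hb ε hε ξ) (by positivity)
      _ = _ := by ring
  have hint := (integrable_pow_mul_exp_neg_dotProduct (d := d) n hc).const_mul (|K| * C)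
  refine ⟨?_, ?_⟩
  · filter_upwards [hmem] with ε hε
    exact hint.mono' (hmeas ε hε.1) (ae_of_all _ fun ξ => hbound ε hε ξ)
  · refine tendsto_integral_filter_of_dominated_convergence
      (fun ξ : Fin d → ℝ => |K| * C * ((1 + ξ ⬝ᵥ ξ) ^ n * Real.exp (-c * (ξ ⬝ᵥ ξ)))) ?_ ?_ hint ?_
    · filter_upwards [hmem] with ε hε using hmeas ε hε.1
    · filter_upwards [hmem] with ε hε using ae_of_all _ fun ξ => hbound ε hε ξ
    · refine ae_of_all _ fun ξ => Tendsto.mul ?_ (hψ ξ)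
      have h1 : Continuous fun ε : ℝ => sliceGaussian b (x + (α * ε) • ξ) ξ :=
        hreg.gaussDom_sliceGaussian.continuous_comp₂ (by fun_prop) continuous_const
      simpa using (h1.tendsto 0).mono_left nhdsWithin_le_nhds

end SliceRegular

end RescaledSlice

/-! ### Moments of the time slice -/

section SliceExpansion

lemma abs_exp_sub_one_le_mul (u : ℝ) : |Real.exp u - 1| ≤ |u| * Real.exp |u| := by
  have h1 := Real.add_one_le_exp u
  have h2 := Real.add_one_le_exp (-u)
  rw [Real.exp_neg] at h2
  have hpos := Real.exp_pos u
  have h3 : Real.exp u - 1 ≤ u * Real.exp u := by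
    have := mul_le_mul_of_nonneg_right h2 hpos.le
    rw [inv_mul_cancel₀ hpos.ne'] at this
    linarith
  have h4 : Real.exp u ≤ Real.exp |u| := Real.exp_le_exp.2 (le_abs_self u)
  have h5 : 1 ≤ Real.exp |u| := Real.one_le_exp (abs_nonneg u)
  rcases le_total 0 u with hu | hu
  · rw [abs_of_nonneg hu] at *
    rw [abs_of_nonneg (by linarith)]; exact h3
  · rw [abs_of_nonpos (by nlinarith), abs_of_nonpos hu] at *
    nlinarith

lemma abs_exp_sub_one_sub_le (u : ℝ) : |Real.exp u - 1 - u| ≤ u ^ 2 * Real.exp |u| := by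
  have h1 := Real.add_one_le_exp u
  have h2 := Real.add_one_le_exp (-u)
  rw [Real.exp_neg] at h2
  have hpos := Real.exp_pos u
  have h3 : Real.exp u - 1 ≤ u * Real.exp u := by
    have := mul_le_mul_of_nonneg_right h2 hpos.le
    rw [inv_mul_cancel₀ hpos.ne'] at this
    linarith
  rw [abs_of_nonneg (by linarith)]
  have h4 := abs_exp_sub_one_le_mul u
  calc Real.exp u - 1 - u ≤ u * (Real.exp u - 1) := by linarith
    _ ≤ |u| * |Real.exp u - 1| := by rw [← abs_mul]; exact le_abs_self _
    _ ≤ |u| * (|u| * Real.exp |u|) := mul_le_mul_of_nonneg_left h4 (abs_nonneg _)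
    _ = |u| ^ 2 * Real.exp |u| := by ring
    _ = _ := by rw [sq_abs]

lemma tendsto_exp_sub_one_sub_div {u : ℝ → ℝ} {c : ℝ}
    (hu : Tendsto (fun ε => u ε / ε) (𝓝[>] 0) (𝓝 c)) :
    Tendsto (fun ε => (Real.exp (u ε) - 1 - u ε) / ε ^ 2) (𝓝[>] 0) (𝓝 (c ^ 2 / 2)) := by
  have hid : Tendsto (fun ε : ℝ => ε) (𝓝[>] 0) (𝓝 0) := tendsto_id.mono_left nhdsWithin_le_nhds
  have hpos : ∀ᶠ ε in 𝓝[>] (0 : ℝ), 0 < ε := self_mem_nhdsWithin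
  have hu0 : Tendsto u (𝓝[>] 0) (𝓝 0) := by
    have := hu.mul hid
    rw [mul_zero] at this
    refine this.congr' ?_
    filter_upwards [hpos] with ε hε
    rw [div_mul_cancel₀ _ hε.ne']
  have hsmall : ∀ᶠ ε in 𝓝[>] (0 : ℝ), |u ε| ≤ 1 := by
    have := hu0.abs
    rw [abs_zero] at this
    exact this.eventually_le_const zero_lt_one
  have hmain : Tendsto (fun ε => (Real.exp (u ε) - 1 - u ε) / ε ^ 2 - (u ε / ε) ^ 2 / 2)
      (𝓝[>] 0) (𝓝 0) := by
    have hb : Tendsto (fun ε => |u ε / ε| ^ 3 * ε) (𝓝[>] 0) (𝓝 0) := by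
      simpa using (hu.abs.pow 3).mul hid
    refine squeeze_zero_norm' ?_ hb
    filter_upwards [hpos, hsmall] with ε hε hs
    have h1 := Real.exp_bound hs (n := 3) (by norm_num)
    norm_num [Finset.sum_range_succ, Nat.factorial] at h1
    have h2 : (Real.exp (u ε) - 1 - u ε) / ε ^ 2 - (u ε / ε) ^ 2 / 2
        = (Real.exp (u ε) - (1 + u ε + u ε ^ 2 / 2)) / ε ^ 2 := by
      field_simp; ring
    rw [h2, Real.norm_eq_abs, abs_div, abs_of_pos (pow_pos hε 2), div_le_iff₀ (pow_pos hε 2),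
      abs_div, abs_of_pos hε]
    refine h1.trans ?_
    have h3 : (|u ε| / ε) ^ 3 * ε * ε ^ 2 = |u ε| ^ 3 := by field_simp
    rw [h3]
    nlinarith [pow_nonneg (abs_nonneg (u ε)) 3]
  have := hmain.add ((hu.pow 2).div_const 2)
  simpa using this

lemma tendsto_exp_sub_one_div {u : ℝ → ℝ} {c : ℝ}
    (hu : Tendsto (fun ε => u ε / ε) (𝓝[>] 0) (𝓝 c)) :
    Tendsto (fun ε => (Real.exp (u ε) - 1) / ε) (𝓝[>] 0) (𝓝 c) := by
  have hid : Tendsto (fun ε : ℝ => ε) (𝓝[>] 0) (𝓝 0) := tendsto_id.mono_left nhdsWithin_le_nhds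
  have := ((tendsto_exp_sub_one_sub_div hu).mul hid).add hu
  rw [mul_zero, zero_add] at this
  refine this.congr' ?_
  filter_upwards [self_mem_nhdsWithin] with ε hε
  have hε : ε ≠ 0 := ne_of_gt hε
  field_simp
  ring

namespace SliceRegular

variable {d m : ℕ} {F : (Fin d → ℝ) → Fin d → ℝ} {b : (Fin d → ℝ) → Fin d → Fin m → ℝ}

lemma continuous_line (x ξ : Fin d → ℝ) (c : ℝ) : Continuous fun ε : ℝ => x + (c * ε) • ξ := by
  fun_prop

lemma tendsto_sliceExponent_div (hreg : SliceRegular F b) (α αb θ : ℝ) (x ξ : Fin d → ℝ) :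
    Tendsto (fun ε => sliceExponent α αb θ F b x ε ξ / ε) (𝓝[>] 0)
      (𝓝 (1 / 2 * (totalDrift α αb F b x ⬝ᵥ ((diffusionB b x)⁻¹ *ᵥ ξ)))) := by
  have hA := (hreg.continuous_totalDrift α αb).comp (continuous_line x ξ α)
  have hE := (hreg.extraTerms_bddC α αb).continuous.comp (continuous_line x ξ θ)
  have h1 := hreg.continuous_bilin (continuous_line x ξ α) hA (continuous_const (y := ξ))
  have h2 := hreg.continuous_bilin (continuous_line x ξ α) hA hA
  have h : Continuous fun ε : ℝ => 1 / 2 * (totalDrift α αb F b (x + (α * ε) • ξ) ⬝ᵥ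
        ((diffusionB b (x + (α * ε) • ξ))⁻¹ *ᵥ ξ))
      - 1 / 4 * (ε * (totalDrift α αb F b (x + (α * ε) • ξ) ⬝ᵥ
        ((diffusionB b (x + (α * ε) • ξ))⁻¹ *ᵥ totalDrift α αb F b (x + (α * ε) • ξ))))
      + ε * extraTerms α αb F b (x + (θ * ε) • ξ) :=
    ((h1.const_mul (1 / 2)).sub ((continuous_id.mul h2).const_mul (1 / 4))).add
      (continuous_id.mul hE)
  have h0 := (h.tendsto 0).mono_left (nhdsWithin_le_nhds (s := Ioi 0))
  simp only [mul_zero, zero_smul, add_zero, zero_mul, sub_zero] at h0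
  refine h0.congr' ?_
  filter_upwards [self_mem_nhdsWithin] with ε hε
  have hε : ε ≠ 0 := ne_of_gt hε
  simp only [sliceExponent]
  field_simp

/-- The second-order part of the rescaled exponent. -/
def exponentLimit (α αb : ℝ) (F : (Fin d → ℝ) → Fin d → ℝ)
    (b : (Fin d → ℝ) → Fin d → Fin m → ℝ) (x ξ : Fin d → ℝ) : ℝ :=
  α / 2 * ∑ j, (((fun k => partialD k (fun y => totalDrift α αb F b y j) x) ⬝ᵥ ξ) *
      ((diffusionB b x)⁻¹ *ᵥ ξ) j)
    - 1 / 4 * (totalDrift α αb F b x ⬝ᵥ ((diffusionB b x)⁻¹ *ᵥ totalDrift α αb F b x))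
    + extraTerms α αb F b x

lemma tendsto_sliceExponent_sub_leading (hreg : SliceRegular F b) (α αb θ : ℝ)
    (x ξ : Fin d → ℝ) :
    Tendsto (fun ε => (sliceExponent α αb θ F b x ε ξ - leadingExponent α αb F b x ε ξ) / ε ^ 2)
      (𝓝[>] 0) (𝓝 (exponentLimit α αb F b x ξ)) := by
  have hA := (hreg.continuous_totalDrift α αb).comp (continuous_line x ξ α)
  have hE := (hreg.extraTerms_bddC α αb).continuous.comp (continuous_line x ξ θ)
  have h2 := hreg.continuous_bilin (continuous_line x ξ α) hA hA
  have hc : Continuous fun ε : ℝ => -(1 / 4 * (totalDrift α αb F b (x + (α * ε) • ξ) ⬝ᵥ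
        ((diffusionB b (x + (α * ε) • ξ))⁻¹ *ᵥ totalDrift α αb F b (x + (α * ε) • ξ))))
      + extraTerms α αb F b (x + (θ * ε) • ξ) := (h2.const_mul (1 / 4)).neg.add hE
  have hc0 := (hc.tendsto 0).mono_left (nhdsWithin_le_nhds (s := Ioi 0))
  have hd : ∀ j, Tendsto (fun ε : ℝ => (totalDrift α αb F b (x + (α * ε) • ξ) j
      - totalDrift α αb F b x j) / ε) (𝓝[>] 0)
      (𝓝 (α * ((fun k => partialD k (fun y => totalDrift α αb F b y j) x) ⬝ᵥ ξ))) := fun j => by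
    have h := DifferentiableAt.hasDerivAt_line (v := α • ξ) (τ := 0)
      (hreg.differentiable_totalDrift α αb j (x + (0 : ℝ) • (α • ξ)))
    have := h.tendsto_slope_zero_right
    simp only [zero_add, zero_smul, add_zero, smul_eq_mul, Pi.smul_apply] at this
    convert! this using 2
    · rename_i ε
      rw [smul_smul, mul_comm α ε]; ring
    · rw [dotProduct, Finset.mul_sum]
      exact Finset.sum_congr rfl fun k _ => by ring
  have hP : ∀ j, Tendsto (fun ε : ℝ => ((diffusionB b (x + (α * ε) • ξ))⁻¹ *ᵥ ξ) j) (𝓝[>] 0)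
      (𝓝 (((diffusionB b x)⁻¹ *ᵥ ξ) j)) := fun j => by
    have : Continuous fun ε : ℝ => ((diffusionB b (x + (α * ε) • ξ))⁻¹ *ᵥ ξ) j := by
      simp only [Matrix.mulVec, dotProduct]
      exact continuous_finsetSum _ fun k _ =>
        ((hreg.inv_bddC j k).continuous.comp (continuous_line x ξ α)).mul continuous_const
    simpa using (this.tendsto 0).mono_left (nhdsWithin_le_nhds (s := Ioi 0))
  have hs := tendsto_finsetSum Finset.univ fun j _ => (hd j).mul (hP j)
  have := (hs.const_mul (1 / 2)).add hc0
  simp only [mul_zero, zero_smul, add_zero] at this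
  refine (this.congr' ?_).trans_eq ?_
  · filter_upwards [self_mem_nhdsWithin] with ε hε
    have hε : ε ≠ 0 := ne_of_gt hε
    have h1 : totalDrift α αb F b (x + (α * ε) • ξ) ⬝ᵥ
          ((diffusionB b (x + (α * ε) • ξ))⁻¹ *ᵥ ξ)
        - totalDrift α αb F b x ⬝ᵥ ((diffusionB b (x + (α * ε) • ξ))⁻¹ *ᵥ ξ)
        = ε * ∑ j, (totalDrift α αb F b (x + (α * ε) • ξ) j - totalDrift α αb F b x j) / ε *
          ((diffusionB b (x + (α * ε) • ξ))⁻¹ *ᵥ ξ) j := by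
      rw [← sub_dotProduct, dotProduct, Finset.mul_sum]
      refine Finset.sum_congr rfl fun j _ => ?_
      rw [Pi.sub_apply]; field_simp
    rw [eq_div_iff (pow_ne_zero 2 hε)]
    simp only [sliceExponent, leadingExponent]
    linear_combination (-ε / 2) * h1
  · rw [exponentLimit, Finset.mul_sum, Finset.mul_sum]
    congr 1
    have : ∀ a b c d : ℝ, a = b → a + (-c + d) = b - c + d := fun a b c d h => by rw [h]; ring
    exact this _ _ _ _ (Finset.sum_congr rfl fun j _ => by ring)

lemma dotProduct_inv_mulVec_eq (y v ξ : Fin d → ℝ) :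
    v ⬝ᵥ ((diffusionB b y)⁻¹ *ᵥ ξ) = ((diffusionB b y)⁻¹ *ᵥ v) ⬝ᵥ ξ := by
  rw [dotProduct_mulVec_comm (inv_isSymm y), dotProduct_comm]

lemma integrable_dotProduct_mul_sliceGaussian (hreg : SliceRegular F b) (y v w : Fin d → ℝ) :
    Integrable fun ξ => sliceGaussian b y ξ * ((v ⬝ᵥ ξ) * (w ⬝ᵥ ξ)) := by
  have h1 : ∀ ξ, sliceGaussian b y ξ * ((v ⬝ᵥ ξ) * (w ⬝ᵥ ξ))
      = ∑ i, ∑ j, v i * w j * (ξ i * (ξ j * sliceGaussian b y ξ)) := fun ξ => by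
    rw [dotProduct, dotProduct, Finset.sum_mul_sum, Finset.mul_sum]
    refine Finset.sum_congr rfl fun i _ => ?_
    rw [Finset.mul_sum]
    exact Finset.sum_congr rfl fun j _ => by ring
  simp only [h1]
  exact integrable_finsetSum _ fun i _ => integrable_finsetSum _ fun j _ =>
    ((hreg.gaussDom_sliceGaussian.coord_mul j).coord_mul i |>.integrable_comp
      (continuous_const (y := y))).const_mul _

lemma integral_sliceGaussian_mul_limit (hreg : SliceRegular F b) (α αb : ℝ) (x : Fin d → ℝ) :
    ∫ ξ, sliceGaussian b x ξ *
      ((1 / 2 * (totalDrift α αb F b x ⬝ᵥ ((diffusionB b x)⁻¹ *ᵥ ξ))) ^ 2 / 2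
        + exponentLimit α αb F b x ξ)
      = α * ∑ j, partialD j (fun y => totalDrift α αb F b y j) x + extraTerms α αb F b x := by
  set A := totalDrift α αb F b x with hA
  set P := (diffusionB b x)⁻¹ with hP
  set D : Fin d → Fin d → ℝ := fun j k => partialD k (fun y => totalDrift α αb F b y j) x with hD
  set c := - 1 / 4 * (A ⬝ᵥ (P *ᵥ A)) + extraTerms α αb F b x with hc
  have hi := hreg.integrable_dotProduct_mul_sliceGaussian (F := F) x
  have h1 : ∀ ξ, sliceGaussian b x ξ * ((1 / 2 * (A ⬝ᵥ (P *ᵥ ξ))) ^ 2 / 2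
        + exponentLimit α αb F b x ξ)
      = 1 / 8 * (sliceGaussian b x ξ * (((P *ᵥ A) ⬝ᵥ ξ) * ((P *ᵥ A) ⬝ᵥ ξ)))
        + α / 2 * ∑ j, sliceGaussian b x ξ * ((D j ⬝ᵥ ξ) * ((P *ᵥ Pi.single j 1) ⬝ᵥ ξ))
        + c * sliceGaussian b x ξ := fun ξ => by
    rw [hP]
    simp only [exponentLimit, ← dotProduct_inv_mulVec_eq, single_one_dotProduct, ← Finset.mul_sum]
    simp only [hc, hD, hA, hP]
    ring
  simp only [h1]
  have hN : Integrable fun ξ => c * sliceGaussian b x ξ :=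
    (hreg.gaussDom_sliceGaussian.integrable_comp (continuous_const (y := x))).const_mul c
  have hI2 : Integrable fun ξ => α / 2 * ∑ j, sliceGaussian b x ξ * ((D j ⬝ᵥ ξ) * ((P *ᵥ Pi.single j 1) ⬝ᵥ ξ)) :=
    (integrable_finsetSum _ fun j _ => hi (D j) (P *ᵥ Pi.single j 1)).const_mul _
  have hI1 := (hi (P *ᵥ A) (P *ᵥ A)).const_mul (1 / 8)
  rw [integral_add (f := fun ξ => 1 / 8 * (sliceGaussian b x ξ *
      (((P *ᵥ A) ⬝ᵥ ξ) * ((P *ᵥ A) ⬝ᵥ ξ))) + α / 2 * ∑ j, sliceGaussian b x ξ *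
        ((D j ⬝ᵥ ξ) * ((P *ᵥ Pi.single j 1) ⬝ᵥ ξ))) (hI1.add hI2) hN, integral_add hI1 hI2,
    integral_const_mul, integral_const_mul, integral_const_mul,
    integral_finsetSum _ fun j _ => hi (D j) (P *ᵥ Pi.single j 1), hreg.integral_sliceGaussian]
  simp only [hreg.integral_dotProduct_mul_sliceGaussian]
  rw [hP]
  simp only [hreg.mulVec_inv, dotProduct_single_one, hc, hD, ← Finset.mul_sum]
  rw [dotProduct_comm ((diffusionB b x)⁻¹ *ᵥ A) A]
  ring

lemma integral_coord_mul_limit (hreg : SliceRegular F b) (α αb : ℝ) (x : Fin d → ℝ) (i : Fin d) :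
    ∫ ξ, sliceGaussian b x ξ *
      (ξ i * (1 / 2 * (totalDrift α αb F b x ⬝ᵥ ((diffusionB b x)⁻¹ *ᵥ ξ))))
      = totalDrift α αb F b x i := by
  set A := totalDrift α αb F b x
  have h1 : ∀ ξ : Fin d → ℝ, sliceGaussian b x ξ *
      (ξ i * (1 / 2 * (A ⬝ᵥ ((diffusionB b x)⁻¹ *ᵥ ξ))))
      = 1 / 2 * (sliceGaussian b x ξ * ((Pi.single i 1 ⬝ᵥ ξ) *
        (((diffusionB b x)⁻¹ *ᵥ A) ⬝ᵥ ξ))) := fun ξ => by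
    rw [dotProduct_inv_mulVec_eq, single_one_dotProduct]; ring
  simp only [h1]
  rw [integral_const_mul, hreg.integral_dotProduct_mul_sliceGaussian, hreg.mulVec_inv,
    single_one_dotProduct]
  ring

/-- The second derivatives `∂_i ∂_j B^{ij}`. -/
def divDivB (b : (Fin d → ℝ) → Fin d → Fin m → ℝ) (x : Fin d → ℝ) : ℝ :=
  ∑ i, ∑ j, partialD i (partialD j (fun y => diffusionB b y i j)) x

lemma isLittleO_integral_sliceGaussian (hreg : SliceRegular F b) (x : Fin d → ℝ) :
    (fun s : ℝ => (∫ ξ, sliceGaussian b (x + s • ξ) ξ) - 1 - divDivB b x * s ^ 2)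
      =o[𝓝 0] fun s => s ^ 2 := by
  have hB := hreg.diffusionB_bddC
  have h := hreg.gaussDom_sliceGaussian.isLittleO_integral (J₁ := fun _ _ => 0)
    (J₂ := fun i j y => 2 * diffusionB b y i j)
    (J₂' := fun i j k y => 2 * partialD k (fun z => diffusionB b z i j) y)
    hreg.integral_coord_sliceGaussian (fun _ => differentiable_const _) x
    (by simp [partialD_const])
    hreg.integral_mul_coord_sliceGaussian (fun i j => (hB i j).1.const_mul _)
    (fun i j k y => partialD_const_mul k _ ((hB i j).1 y))
    (fun i j k => ((hB i j).2.2 k).1.const_mul _)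
  simp only [hreg.integral_sliceGaussian] at h
  refine h.congr_left fun s => ?_
  have h2 : ∀ k l, partialD k (fun y => 2 * partialD l (fun z => diffusionB b z k l) y) x
      = 2 * partialD k (partialD l (fun z => diffusionB b z k l)) x := fun k l =>
    partialD_const_mul k _ (((hB k l).2.2 l).1 x)
  simp only [h2, ← Finset.mul_sum, divDivB]
  ring

lemma isLittleO_integral_coord_sliceGaussian (hreg : SliceRegular F b) (x : Fin d → ℝ)
    (i : Fin d) :
    (fun s : ℝ => (∫ ξ, ξ i * sliceGaussian b (x + s • ξ) ξ)
      - s * (2 * ∑ k, partialD k (fun y => diffusionB b y i k) x)) =o[𝓝 0] fun s => s := by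
  have hB := hreg.diffusionB_bddC
  have h := (hreg.gaussDom_sliceGaussian.of_succ.coord_mul i).hasDerivAt_integral_zero
    (J := fun k y => 2 * diffusionB b y k i)
    (fun k y => hreg.integral_mul_coord_sliceGaussian k i y)
    (x := x) (fun k => ((hB k i).1 x).const_mul _)
  have h' := hasDerivAt_iff_isLittleO_nhds_zero.1 h
  simp only [zero_add, zero_smul, add_zero, hreg.integral_coord_sliceGaussian, sub_zero,
    smul_eq_mul] at h'
  refine h'.congr_left fun s => ?_
  simp only [partialD_const_mul _ _ ((hB _ _).1 x), ← Finset.mul_sum, diffusionB_comm _ _ i]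

lemma isLittleO_integral_leading (hreg : SliceRegular F b) (x v : Fin d → ℝ) :
    (fun s : ℝ => ∫ ξ, sliceGaussian b (x + s • ξ) ξ *
      (v ⬝ᵥ ((diffusionB b (x + s • ξ))⁻¹ *ᵥ ξ))) =o[𝓝 0] fun s => s := by
  have hw : ∀ j, GaussDom 1 fun y ξ => ∑ l, (diffusionB b y)⁻¹ j l * (ξ l * sliceGaussian b y ξ) :=
    fun j => GaussDom.sum _ fun l _ => GaussDom.bddC_mul (hreg.inv_bddC j l).of_succ
      (hreg.gaussDom_sliceGaussian.of_succ.coord_mul l)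
  have hg : GaussDom 1 fun y ξ => ∑ j, v j * ∑ l, (diffusionB b y)⁻¹ j l *
      (ξ l * sliceGaussian b y ξ) := GaussDom.sum _ fun j _ => (hw j).const_mul _
  have hint : ∀ k l y, Integrable fun ξ => ξ k * (ξ l * sliceGaussian b y ξ) := fun k l y =>
    (hreg.gaussDom_sliceGaussian.coord_mul l).coord_mul k |>.integrable_comp
      (continuous_const (y := y))
  have hJ : ∀ k y, ∫ ξ, ξ k * ∑ j, v j * ∑ l, (diffusionB b y)⁻¹ j l *
      (ξ l * sliceGaussian b y ξ) = 2 * v k := fun k y => by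
    have h1 : ∀ ξ : Fin d → ℝ, ξ k * ∑ j, v j * ∑ l, (diffusionB b y)⁻¹ j l *
        (ξ l * sliceGaussian b y ξ) = ∑ j, ∑ l, v j * (diffusionB b y)⁻¹ j l *
          (ξ k * (ξ l * sliceGaussian b y ξ)) := fun ξ => by
      simp only [Finset.mul_sum]
      exact Finset.sum_congr rfl fun j _ => Finset.sum_congr rfl fun l _ => by ring
    simp only [h1]
    rw [integral_finsetSum _ fun j _ => integrable_finsetSum _ fun l _ => (hint k l y).const_mul _]
    simp only [integral_finsetSum _ fun l _ => (hint k l y).const_mul _, integral_const_mul,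
      hreg.integral_mul_coord_sliceGaussian]
    have h2 : ∀ j, ∑ l, (diffusionB b y)⁻¹ j l * diffusionB b y l k
        = (1 : Matrix (Fin d) (Fin d) ℝ) j k := fun j => by
      rw [← Matrix.mul_apply, Matrix.nonsing_inv_mul _ (hreg.isUnit_det y)]
    have h3 : ∀ j, ∑ l, v j * (diffusionB b y)⁻¹ j l * (2 * diffusionB b y k l)
        = 2 * (v j * (1 : Matrix (Fin d) (Fin d) ℝ) j k) := fun j => by
      rw [← h2 j, Finset.mul_sum, Finset.mul_sum]
      exact Finset.sum_congr rfl fun l _ => by rw [diffusionB_comm y k l]; ring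
    simp only [h3, Matrix.one_apply, mul_ite, mul_one, mul_zero,
      Finset.sum_ite_eq', Finset.mem_univ, if_true]
  have h := hg.hasDerivAt_integral_zero (J := fun k _ => 2 * v k) hJ (x := x)
    (fun k => differentiableAt_const _)
  have h' := hasDerivAt_iff_isLittleO_nhds_zero.1 h
  have h0 : ∫ ξ, ∑ j, v j * ∑ l, (diffusionB b x)⁻¹ j l * (ξ l * sliceGaussian b x ξ) = 0 := by
    have hl : ∀ l, Integrable fun ξ => ξ l * sliceGaussian b x ξ := fun l =>
      (hreg.gaussDom_sliceGaussian.coord_mul l).integrable_comp (continuous_const (y := x))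
    rw [integral_finsetSum _ fun j _ =>
      (integrable_finsetSum _ fun l _ => (hl l).const_mul ((diffusionB b x)⁻¹ j l)).const_mul (v j)]
    simp [integral_const_mul, integral_finsetSum _ fun l _ => (hl l).const_mul _,
      hreg.integral_coord_sliceGaussian]
  simp only [zero_add, zero_smul, add_zero, h0, partialD_const, Finset.sum_const_zero, sub_zero,
    smul_zero] at h'
  refine h'.congr_left fun s => ?_
  congr 1; funext ξ
  simp only [dotProduct, Matrix.mulVec, Finset.mul_sum]
  exact Finset.sum_congr rfl fun j _ => Finset.sum_congr rfl fun l _ => by ring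

end SliceRegular

end SliceExpansion

section SliceMeasure

lemma GaussDom.integrable_mul {d n : ℕ} {g : (Fin d → ℝ) → (Fin d → ℝ) → ℝ} (hg : GaussDom n g)
    {Y : (Fin d → ℝ) → (Fin d → ℝ)} (hY : Continuous Y) {f : (Fin d → ℝ) → ℝ} (hf : Continuous f)
    {K : ℝ} (N : ℕ) (hb : ∀ ξ, |f ξ| ≤ K * (1 + ξ ⬝ᵥ ξ) ^ N) :
    Integrable fun ξ => g (Y ξ) ξ * f ξ := by
  obtain ⟨C, c, hC, hc, h⟩ := hg.gaussBound
  refine ((integrable_pow_mul_exp_neg_dotProduct N hc).const_mul (C * K)).mono'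
    ((hg.continuous_comp hY).mul hf).aestronglyMeasurable (ae_of_all _ fun ξ => ?_)
  rw [norm_mul, Real.norm_eq_abs, Real.norm_eq_abs]
  calc _ ≤ (C * Real.exp (-c * (ξ ⬝ᵥ ξ))) * (K * (1 + ξ ⬝ᵥ ξ) ^ N) :=
        mul_le_mul (h _ ξ) (hb ξ) (abs_nonneg _) (by positivity)
    _ = _ := by ring

/-- Passing from `h = ε²` to `h`. -/
lemma isLittleO_of_comp_sq {f : ℝ → ℝ}
    (hf : (fun ε => f (ε ^ 2)) =o[𝓝[>] 0] fun ε : ℝ => ε ^ 2) : f =o[𝓝[>] 0] fun h => h := by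
  have ht : Tendsto Real.sqrt (𝓝[>] 0) (𝓝[>] 0) := by
    refine tendsto_nhdsWithin_iff.2 ⟨?_, ?_⟩
    · simpa using (Real.continuous_sqrt.tendsto 0).mono_left (nhdsWithin_le_nhds (s := Ioi 0))
    · filter_upwards [self_mem_nhdsWithin] with h hh using Real.sqrt_pos.2 hh
  have he : ∀ᶠ h in 𝓝[>] (0 : ℝ), Real.sqrt h ^ 2 = h := by
    filter_upwards [self_mem_nhdsWithin] with h hh using Real.sq_sqrt (le_of_lt hh)
  refine (hf.comp_tendsto ht).congr' ?_ ?_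
  · filter_upwards [he] with h hh
    simp only [Function.comp_apply, hh]
  · filter_upwards [he] with h hh
    simp only [Function.comp_apply, hh]

namespace SliceRegular

variable {d m : ℕ} {F : (Fin d → ℝ) → Fin d → ℝ} {b : (Fin d → ℝ) → Fin d → Fin m → ℝ}

lemma sliceDensity_eq (α αb θ : ℝ) (x x₁ : Fin d → ℝ) {ε : ℝ} (hε : 0 < ε) :
    sliceDensity α αb θ F b (ε ^ 2) x x₁
      = (ε ^ d)⁻¹ * (sliceGaussian b (x + (α * ε) • (ε⁻¹ • (x₁ - x))) (ε⁻¹ • (x₁ - x)) *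
        Real.exp (sliceExponent α αb θ F b x ε (ε⁻¹ • (x₁ - x)))) := by
  rw [← rescaled_sliceDensity α αb θ x _ hε, smul_smul, mul_inv_cancel₀ hε.ne', one_smul,
    add_sub_cancel, ← mul_assoc, inv_mul_cancel₀ (pow_pos hε d).ne', one_mul]

lemma continuous_sliceDensity (hreg : SliceRegular F b) (α αb θ : ℝ) (x : Fin d → ℝ) {ε : ℝ}
    (hε : 0 < ε) : Continuous (sliceDensity α αb θ F b (ε ^ 2) x) := by
  have hξ : Continuous fun x₁ : Fin d → ℝ => ε⁻¹ • (x₁ - x) := by fun_prop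
  have h1 : Continuous fun x₁ : Fin d → ℝ =>
      sliceGaussian b (x + (α * ε) • (ε⁻¹ • (x₁ - x))) (ε⁻¹ • (x₁ - x)) :=
    hreg.gaussDom_sliceGaussian.continuous_comp₂ (by fun_prop) hξ
  have h2 := (hreg.continuous_sliceExponent α αb θ x ε).comp hξ
  rw [show sliceDensity α αb θ F b (ε ^ 2) x = _ from
    funext fun x₁ => sliceDensity_eq α αb θ x x₁ hε]
  exact continuous_const.mul (h1.mul (Real.continuous_exp.comp h2))

lemma sliceDensity_nonneg (α αb θ : ℝ) (h : ℝ) (x x₁ : Fin d → ℝ) :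
    0 ≤ sliceDensity α αb θ F b h x x₁ := by
  unfold sliceDensity slicePrefactor; positivity

lemma integral_rescale (x : Fin d → ℝ) {ε : ℝ} (hε : 0 < ε) (g : (Fin d → ℝ) → ℝ) :
    ∫ y, g y = ∫ ξ, ε ^ d * g (x + ε • ξ) := by
  rw [integral_const_mul, Measure.integral_comp_smul volume (fun z => g (x + z)) ε,
    integral_add_left_eq_self g x]
  simp only [Module.finrank_fin_fun, smul_eq_mul]
  rw [abs_of_pos (by positivity), ← mul_assoc, mul_inv_cancel₀ (by positivity), one_mul]

lemma integrable_rescale (x : Fin d → ℝ) {ε : ℝ} (hε : 0 < ε) {g : (Fin d → ℝ) → ℝ}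
    (hg : Integrable fun ξ => ε ^ d * g (x + ε • ξ)) : Integrable g := by
  have h1 : Integrable fun ξ => g (x + ε • ξ) := by
    refine (hg.const_mul (ε ^ d)⁻¹).congr (ae_of_all _ fun ξ => ?_)
    simp only [← mul_assoc]
    rw [inv_mul_cancel₀ (pow_pos hε d).ne', one_mul]
  have h2 := (integrable_comp_smul_iff volume (fun z => g (x + z)) hε.ne').1 h1
  simpa using h2.comp_add_left (-x)

lemma integral_densityMeasure (hreg : SliceRegular F b) (α αb θ : ℝ) (x : Fin d → ℝ) {ε : ℝ}
    (hε : 0 < ε) (f : (Fin d → ℝ) → ℝ) :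
    ∫ y, f y ∂(densityMeasure (sliceDensity α αb θ F b (ε ^ 2) x))
      = ∫ ξ, sliceGaussian b (x + (α * ε) • ξ) ξ *
        (f (x + ε • ξ) * Real.exp (sliceExponent α αb θ F b x ε ξ)) := by
  rw [densityMeasure, integral_withDensity_eq_integral_toReal_smul
    (hreg.continuous_sliceDensity α αb θ x hε).measurable.ennreal_ofReal
    (ae_of_all _ fun _ => ENNReal.ofReal_lt_top), integral_rescale x hε]
  congr 1; funext ξ
  rw [ENNReal.toReal_ofReal (sliceDensity_nonneg _ _ _ _ _ _), smul_eq_mul, ← mul_assoc,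
    rescaled_sliceDensity α αb θ x ξ hε]
  ring

lemma integrable_densityMeasure (hreg : SliceRegular F b) (α αb θ : ℝ) (x : Fin d → ℝ) {ε : ℝ}
    (hε : 0 < ε) {f : (Fin d → ℝ) → ℝ}
    (hf : Integrable fun ξ => sliceGaussian b (x + (α * ε) • ξ) ξ *
        (f (x + ε • ξ) * Real.exp (sliceExponent α αb θ F b x ε ξ))) :
    Integrable f (densityMeasure (sliceDensity α αb θ F b (ε ^ 2) x)) := by
  rw [densityMeasure, integrable_withDensity_iff_integrable_smul'
    (hreg.continuous_sliceDensity α αb θ x hε).measurable.ennreal_ofReal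
    (ae_of_all _ fun _ => ENNReal.ofReal_lt_top)]
  refine integrable_rescale x hε (hf.congr (ae_of_all _ fun ξ => ?_))
  simp only
  rw [ENNReal.toReal_ofReal (sliceDensity_nonneg _ _ _ _ _ _), smul_eq_mul, ← mul_assoc (ε ^ d),
    rescaled_sliceDensity α αb θ x ξ hε]
  ring

lemma incrementMonomial_add_smul {M : ℕ} (x ξ : Fin d → ℝ) (ε : ℝ) (I : Fin M → Fin d) :
    incrementMonomial x I (x + ε • ξ) = ε ^ M * ∏ k, ξ (I k) := by
  simp [incrementMonomial, Finset.prod_mul_distrib]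

lemma abs_prod_coord_le {M : ℕ} (ξ : Fin d → ℝ) (I : Fin M → Fin d) :
    |∏ k, ξ (I k)| ≤ (1 + ξ ⬝ᵥ ξ) ^ M := by
  rw [Finset.abs_prod]
  calc _ ≤ ∏ _k : Fin M, (1 + ξ ⬝ᵥ ξ) :=
        Finset.prod_le_prod (fun _ _ => abs_nonneg _) fun k _ => abs_coord_le ξ (I k)
    _ = _ := by simp

lemma exists_moment_bound_slice (hreg : SliceRegular F b) {α : ℝ} (hα : α ∈ Icc (0 : ℝ) 1)
    (αb θ : ℝ) (x : Fin d → ℝ) :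
    ∃ ε₀ > 0, ∀ (M : ℕ) (I : Fin M → Fin d), ∃ C, ∀ ε ∈ Ioc 0 ε₀,
      Integrable (fun ξ => sliceGaussian b (x + (α * ε) • ξ) ξ *
        ((∏ k, ξ (I k)) * Real.exp (sliceExponent α αb θ F b x ε ξ))) ∧
      |∫ ξ, sliceGaussian b (x + (α * ε) • ξ) ξ *
        ((∏ k, ξ (I k)) * Real.exp (sliceExponent α αb θ F b x ε ξ))| ≤ C := by
  obtain ⟨C, c, ε₀, hC, hc, hε₀, -, hb⟩ := hreg.exists_slice_domination hα αb θ x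
  refine ⟨ε₀, hε₀, fun M I => ?_⟩
  have hint := (integrable_pow_mul_exp_neg_dotProduct (d := d) M hc).const_mul C
  refine ⟨∫ ξ : Fin d → ℝ, C * ((1 + ξ ⬝ᵥ ξ) ^ M * Real.exp (-c * (ξ ⬝ᵥ ξ))), fun ε hε => ?_⟩
  have hbd : ∀ ξ, ‖sliceGaussian b (x + (α * ε) • ξ) ξ *
      ((∏ k, ξ (I k)) * Real.exp (sliceExponent α αb θ F b x ε ξ))‖
      ≤ C * ((1 + ξ ⬝ᵥ ξ) ^ M * Real.exp (-c * (ξ ⬝ᵥ ξ))) := fun ξ => by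
    have h0 := dotProduct_self_nonneg' ξ
    have hN := sliceGaussian_nonneg (b := b) (x + (α * ε) • ξ) ξ
    rw [norm_mul, norm_mul, Real.norm_eq_abs, Real.norm_eq_abs, Real.norm_eq_abs,
      abs_of_nonneg hN, Real.abs_exp]
    have he : Real.exp (sliceExponent α αb θ F b x ε ξ)
        ≤ Real.exp |sliceExponent α αb θ F b x ε ξ| := Real.exp_le_exp.2 (le_abs_self _)
    calc _ ≤ sliceGaussian b (x + (α * ε) • ξ) ξ * ((1 + ξ ⬝ᵥ ξ) ^ M *
          Real.exp |sliceExponent α αb θ F b x ε ξ|) :=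
          mul_le_mul_of_nonneg_left (mul_le_mul (abs_prod_coord_le ξ I) he (Real.exp_pos _).le
            (by positivity)) hN
      _ = (1 + ξ ⬝ᵥ ξ) ^ M * (sliceGaussian b (x + (α * ε) • ξ) ξ *
          Real.exp |sliceExponent α αb θ F b x ε ξ|) := by ring
      _ ≤ (1 + ξ ⬝ᵥ ξ) ^ M * (C * Real.exp (-c * (ξ ⬝ᵥ ξ))) :=
          mul_le_mul_of_nonneg_left (hb ε hε ξ) (by positivity)
      _ = _ := by ring
  have hmeas : Continuous fun ξ => sliceGaussian b (x + (α * ε) • ξ) ξ *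
      ((∏ k, ξ (I k)) * Real.exp (sliceExponent α αb θ F b x ε ξ)) :=
    (hreg.gaussDom_sliceGaussian.continuous_comp (by fun_prop)).mul
      ((by fun_prop : Continuous fun ξ : Fin d → ℝ => ∏ k, ξ (I k)).mul
        (Real.continuous_exp.comp (hreg.continuous_sliceExponent α αb θ x ε)))
  exact ⟨hint.mono' hmeas.aestronglyMeasurable (ae_of_all _ hbd),
    norm_integral_le_of_norm_le hint (ae_of_all _ hbd)⟩

lemma isLittleO_comp_mul {f : ℝ → ℝ} (n : ℕ) (hf : f =o[𝓝 0] fun s => s ^ n) (α : ℝ) :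
    (fun ε => f (α * ε)) =o[𝓝[>] 0] fun ε : ℝ => ε ^ n := by
  have ht : Tendsto (fun ε : ℝ => α * ε) (𝓝[>] 0) (𝓝 0) := by
    have : Continuous fun ε : ℝ => α * ε := by fun_prop
    simpa using (this.tendsto 0).mono_left (nhdsWithin_le_nhds (s := Ioi 0))
  refine (hf.comp_tendsto ht).trans_isBigO (IsBigO.of_bound (|α| ^ n) ?_)
  refine Eventually.of_forall fun ε => ?_
  simp [mul_pow]

/-- The moment of order zero: the time slice is normalized up to `o(ε²)`. -/
lemma isLittleO_integral_slice_zero (hreg : SliceRegular F b) {α : ℝ} (hα : α ∈ Icc (0 : ℝ) 1)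
    (αb θ : ℝ) (x : Fin d → ℝ) :
    (fun ε => (∫ ξ, sliceGaussian b (x + (α * ε) • ξ) ξ *
        Real.exp (sliceExponent α αb θ F b x ε ξ)) - 1) =o[𝓝[>] 0] fun ε : ℝ => ε ^ 2 := by
  obtain ⟨K, hK, hKb⟩ := hreg.sliceExponent_bounds hα αb θ x
  obtain ⟨K', hK', hKb'⟩ := hreg.exists_bilin_bound
  have hleadc : ∀ ε, Continuous (leadingExponent α αb F b x ε) := fun ε =>
    (hreg.continuous_bilin (by fun_prop) continuous_const continuous_id).const_mul _
  have hlim := hreg.tendsto_integral_slice hα αb θ x (K := K ^ 2 + K) 2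
    (ψ := fun ε ξ => (Real.exp (sliceExponent α αb θ F b x ε ξ) - 1
      - leadingExponent α αb F b x ε ξ) / ε ^ 2)
    (ψ₀ := fun ξ => (1 / 2 * (totalDrift α αb F b x ⬝ᵥ ((diffusionB b x)⁻¹ *ᵥ ξ))) ^ 2 / 2
        + exponentLimit α αb F b x ξ)
    (fun ε _ => (((Real.continuous_exp.comp (hreg.continuous_sliceExponent α αb θ x ε)).sub
      continuous_const).sub (hleadc ε)).div_const _)
    (fun ε hε ξ => by
      set X := sliceExponent α αb θ F b x ε ξ
      set Y := leadingExponent α αb F b x ε ξ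
      obtain ⟨h1, h2⟩ := hKb ε hε ξ
      have h0 := dotProduct_self_nonneg' ξ
      have hε2 : 0 < ε ^ 2 := pow_pos hε.1 2
      rw [abs_div, abs_of_pos hε2, div_le_iff₀ hε2]
      have h3 : |Real.exp X - 1 - Y| ≤ X ^ 2 * Real.exp |X| + |X - Y| := by
        have := abs_add_le (Real.exp X - 1 - X) (X - Y)
        rw [sub_add_sub_cancel] at this
        exact this.trans (add_le_add_left (abs_exp_sub_one_sub_le X) _)
      have h4 : X ^ 2 ≤ (K * ε * (1 + ξ ⬝ᵥ ξ)) ^ 2 := by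
        rw [← sq_abs]; exact pow_le_pow_left₀ (abs_nonneg _) h1 2
      have h5 := Real.one_le_exp (abs_nonneg X)
      have h6 : K * ε ^ 2 * (1 + ξ ⬝ᵥ ξ) ≤ K * ε ^ 2 * (1 + ξ ⬝ᵥ ξ) ^ 2 * Real.exp |X| := by
        calc K * ε ^ 2 * (1 + ξ ⬝ᵥ ξ) ≤ K * ε ^ 2 * (1 + ξ ⬝ᵥ ξ) ^ 2 := by
              refine mul_le_mul_of_nonneg_left (by nlinarith) (by positivity)
          _ ≤ _ := le_mul_of_one_le_right (by positivity) h5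
      calc _ ≤ (K * ε * (1 + ξ ⬝ᵥ ξ)) ^ 2 * Real.exp |X|
            + K * ε ^ 2 * (1 + ξ ⬝ᵥ ξ) ^ 2 * Real.exp |X| :=
            h3.trans (add_le_add (mul_le_mul_of_nonneg_right h4 (Real.exp_pos _).le) (h2.trans h6))
        _ = _ := by ring)
    (fun ξ => by
      have h1 := tendsto_exp_sub_one_sub_div (hreg.tendsto_sliceExponent_div α αb θ x ξ)
      have h2 := h1.add (hreg.tendsto_sliceExponent_sub_leading α αb θ x ξ)
      refine h2.congr fun ε => ?_
      rw [← add_div]; congr 1; ring)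
  rw [hreg.integral_sliceGaussian_mul_limit] at hlim
  obtain ⟨hi, hlim⟩ := hlim
  set L := α * ∑ j, partialD j (fun y => totalDrift α αb F b y j) x + extraTerms α αb F b x with hL
  have hcancel : divDivB b x * α ^ 2 + L = 0 := by
    have hdA : ∀ j, partialD j (fun y => totalDrift α αb F b y j) x
        = partialD j (fun y => F y j) x + αb * partialD j (fun y => noiseDrift b y j) x
          - 2 * α * ∑ k, partialD j (partialD k (fun y => diffusionB b y j k)) x := fun j => by
      have hB : ∀ k, DifferentiableAt ℝ (partialD k (fun y => diffusionB b y j k)) x := fun k =>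
        ((hreg.diffusionB_bddC j k).2.2 k).1 x
      have hs := DifferentiableAt.fun_sum (u := Finset.univ) fun k _ => hB k
      have hn := (hreg.noiseDrift_bddC j).1 x
      simp only [totalDrift, spuriousDrift]
      rw [partialD_add (g := fun y => αb * noiseDrift b y j
          - 2 * α * ∑ k, partialD k (fun y => diffusionB b y j k) y) j
          (hreg.drift_differentiable j x) ((hn.const_mul _).sub (hs.const_mul _)),
        partialD_sub j (hn.const_mul _) (hs.const_mul _), partialD_const_mul j _ hn,
        partialD_const_mul j _ hs, partialD_sum _ j fun k _ => hB k]
      ring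
    simp only [hL, hdA, divDivB, extraTerms, Finset.sum_add_distrib, Finset.sum_sub_distrib,
      ← Finset.mul_sum]
    ring
  have h1 : (fun ε : ℝ => (∫ ξ, sliceGaussian b (x + (α * ε) • ξ) ξ) - 1
      - divDivB b x * (α * ε) ^ 2) =o[𝓝[>] 0] fun ε => ε ^ 2 :=
    isLittleO_comp_mul 2 (hreg.isLittleO_integral_sliceGaussian x) α
  have h2 : (fun ε : ℝ => ε / 2 * ∫ ξ, sliceGaussian b (x + (α * ε) • ξ) ξ *
      (totalDrift α αb F b x ⬝ᵥ ((diffusionB b (x + (α * ε) • ξ))⁻¹ *ᵥ ξ)))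
      =o[𝓝[>] 0] fun ε => ε ^ 2 := by
    have h := isLittleO_comp_mul 1 (f := fun s => ∫ ξ, sliceGaussian b (x + s • ξ) ξ *
      (totalDrift α αb F b x ⬝ᵥ ((diffusionB b (x + s • ξ))⁻¹ *ᵥ ξ)))
      (by simpa using hreg.isLittleO_integral_leading x (totalDrift α αb F b x)) α
    have h' : (fun ε : ℝ => ε / 2) =O[𝓝[>] 0] fun ε => ε :=
      IsBigO.of_bound 1 (Eventually.of_forall fun ε => by
        rw [norm_div, one_mul]; norm_num)
    refine (h'.mul_isLittleO h).congr_right fun ε => by ring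
  have h3 : (fun ε : ℝ => ε ^ 2 * ((∫ ξ, sliceGaussian b (x + (α * ε) • ξ) ξ *
      ((Real.exp (sliceExponent α αb θ F b x ε ξ) - 1
      - leadingExponent α αb F b x ε ξ) / ε ^ 2)) - L)) =o[𝓝[>] 0] fun ε => ε ^ 2 := by
    have h : Tendsto (fun ε : ℝ => (∫ ξ, sliceGaussian b (x + (α * ε) • ξ) ξ *
      ((Real.exp (sliceExponent α αb θ F b x ε ξ) - 1
      - leadingExponent α αb F b x ε ξ) / ε ^ 2)) - L) (𝓝[>] 0) (𝓝 0) := by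
      simpa using hlim.sub_const L
    simpa using (isBigO_refl (fun ε : ℝ => ε ^ 2) (𝓝[>] 0)).mul_isLittleO
      ((isLittleO_one_iff ℝ).2 h)
  refine ((h1.add h2).add h3).congr' ?_ EventuallyEq.rfl
  filter_upwards [hi, self_mem_nhdsWithin] with ε hiε hε
  have hε : 0 < ε := hε
  have hN : Integrable fun ξ => sliceGaussian b (x + (α * ε) • ξ) ξ :=
    hreg.gaussDom_sliceGaussian.integrable_comp (by fun_prop)
  have hY : Integrable fun ξ => sliceGaussian b (x + (α * ε) • ξ) ξ *
      (totalDrift α αb F b x ⬝ᵥ ((diffusionB b (x + (α * ε) • ξ))⁻¹ *ᵥ ξ)) :=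
    hreg.gaussDom_sliceGaussian.integrable_mul (by fun_prop)
      (hreg.continuous_bilin (by fun_prop) continuous_const continuous_id)
      (K := K' * ‖totalDrift α αb F b x‖) 1 fun ξ => (hKb' _ _ ξ).trans (by
        rw [pow_one, mul_assoc]
        exact mul_le_mul_of_nonneg_left (mul_le_mul_of_nonneg_left
          (norm_le_one_add_dotProduct ξ) (norm_nonneg _)) hK'.le)
  have hsplit : ∀ ξ, sliceGaussian b (x + (α * ε) • ξ) ξ *
        Real.exp (sliceExponent α αb θ F b x ε ξ)
      = sliceGaussian b (x + (α * ε) • ξ) ξ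
        + ε / 2 * (sliceGaussian b (x + (α * ε) • ξ) ξ *
          (totalDrift α αb F b x ⬝ᵥ ((diffusionB b (x + (α * ε) • ξ))⁻¹ *ᵥ ξ)))
        + ε ^ 2 * (sliceGaussian b (x + (α * ε) • ξ) ξ *
          ((Real.exp (sliceExponent α αb θ F b x ε ξ) - 1
            - leadingExponent α αb F b x ε ξ) / ε ^ 2)) := fun ξ => by
    have : ε ^ 2 * ((Real.exp (sliceExponent α αb θ F b x ε ξ) - 1
            - leadingExponent α αb F b x ε ξ) / ε ^ 2)
        = Real.exp (sliceExponent α αb θ F b x ε ξ) - 1 - leadingExponent α αb F b x ε ξ :=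
      mul_div_cancel₀ _ (pow_pos hε 2).ne'
    rw [mul_left_comm (ε ^ 2), this, leadingExponent]
    ring
  simp only [hsplit]
  have hNY := hN.add (hY.const_mul (ε / 2))
  rw [integral_add (f := fun ξ => sliceGaussian b (x + (α * ε) • ξ) ξ
        + ε / 2 * (sliceGaussian b (x + (α * ε) • ξ) ξ *
          (totalDrift α αb F b x ⬝ᵥ ((diffusionB b (x + (α * ε) • ξ))⁻¹ *ᵥ ξ))))
      hNY (hiε.const_mul _), integral_add hN (hY.const_mul _), integral_const_mul,
    integral_const_mul]
  linear_combination (-ε ^ 2) * hcancel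

/-- The moments of first order. -/
lemma isLittleO_integral_slice_one (hreg : SliceRegular F b) {α : ℝ} (hα : α ∈ Icc (0 : ℝ) 1)
    (αb θ : ℝ) (x : Fin d → ℝ) (i : Fin d) :
    (fun ε => (∫ ξ, sliceGaussian b (x + (α * ε) • ξ) ξ *
        (ξ i * Real.exp (sliceExponent α αb θ F b x ε ξ))) - ε * itoDrift αb F b x i)
      =o[𝓝[>] 0] fun ε : ℝ => ε := by
  obtain ⟨K, hK, hKb⟩ := hreg.sliceExponent_bounds hα αb θ x
  have hlim := hreg.tendsto_integral_slice hα αb θ x (K := K) 2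
    (ψ := fun ε ξ => ξ i * ((Real.exp (sliceExponent α αb θ F b x ε ξ) - 1) / ε))
    (ψ₀ := fun ξ => ξ i *
      (1 / 2 * (totalDrift α αb F b x ⬝ᵥ ((diffusionB b x)⁻¹ *ᵥ ξ))))
    (fun ε _ => (continuous_apply i).mul
      (((Real.continuous_exp.comp (hreg.continuous_sliceExponent α αb θ x ε)).sub
      continuous_const).div_const _))
    (fun ε hε ξ => by
      have h1 := (hKb ε hε ξ).1
      have h0 := dotProduct_self_nonneg' ξ
      have hε0 : 0 < ε := hε.1
      have h2 : |(Real.exp (sliceExponent α αb θ F b x ε ξ) - 1) / ε|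
          ≤ K * (1 + ξ ⬝ᵥ ξ) * Real.exp |sliceExponent α αb θ F b x ε ξ| := by
        rw [abs_div, abs_of_pos hε0, div_le_iff₀ hε0]
        refine (abs_exp_sub_one_le_mul _).trans ((mul_le_mul_of_nonneg_right h1
          (Real.exp_pos _).le).trans (le_of_eq (by ring)))
      rw [abs_mul]
      calc _ ≤ (1 + ξ ⬝ᵥ ξ) * (K * (1 + ξ ⬝ᵥ ξ) *
            Real.exp |sliceExponent α αb θ F b x ε ξ|) :=
            mul_le_mul (abs_coord_le ξ i) h2 (abs_nonneg _) (by positivity)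
        _ = _ := by ring)
    (fun ξ => (tendsto_exp_sub_one_div (hreg.tendsto_sliceExponent_div α αb θ x ξ)).const_mul _)
  rw [hreg.integral_coord_mul_limit] at hlim
  obtain ⟨hi, hlim⟩ := hlim
  have h1 := isLittleO_comp_mul 1 (f := fun s => (∫ ξ, ξ i * sliceGaussian b (x + s • ξ) ξ)
      - s * (2 * ∑ k, partialD k (fun y => diffusionB b y i k) x))
    (by simpa using hreg.isLittleO_integral_coord_sliceGaussian x i) α
  simp only [pow_one] at h1
  have h2 : (fun ε : ℝ => ε * ((∫ ξ, sliceGaussian b (x + (α * ε) • ξ) ξ *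
      (ξ i * ((Real.exp (sliceExponent α αb θ F b x ε ξ) - 1) / ε)))
      - totalDrift α αb F b x i)) =o[𝓝[>] 0] fun ε => ε := by
    have h : Tendsto (fun ε : ℝ => (∫ ξ, sliceGaussian b (x + (α * ε) • ξ) ξ *
      (ξ i * ((Real.exp (sliceExponent α αb θ F b x ε ξ) - 1) / ε)))
      - totalDrift α αb F b x i) (𝓝[>] 0) (𝓝 0) := by
      simpa using hlim.sub_const (totalDrift α αb F b x i)
    simpa using (isBigO_refl (fun ε : ℝ => ε) (𝓝[>] 0)).mul_isLittleO
      ((isLittleO_one_iff ℝ).2 h)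
  refine (h1.add h2).congr' ?_ EventuallyEq.rfl
  filter_upwards [hi, self_mem_nhdsWithin] with ε hiε hε
  have hε : ε ≠ 0 := ne_of_gt hε
  have hN : Integrable fun ξ => ξ i * sliceGaussian b (x + (α * ε) • ξ) ξ :=
    (hreg.gaussDom_sliceGaussian.coord_mul i).integrable_comp
      (Y := fun ξ => x + (α * ε) • ξ) (by fun_prop)
  have hsplit : ∀ ξ, sliceGaussian b (x + (α * ε) • ξ) ξ *
        (ξ i * Real.exp (sliceExponent α αb θ F b x ε ξ))
      = ξ i * sliceGaussian b (x + (α * ε) • ξ) ξ + ε * (sliceGaussian b (x + (α * ε) • ξ) ξ *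
        (ξ i * ((Real.exp (sliceExponent α αb θ F b x ε ξ) - 1) / ε))) := fun ξ => by
    field_simp; ring
  simp only [hsplit]
  rw [integral_add hN (hiε.const_mul _), integral_const_mul]
  simp only [totalDrift, spuriousDrift, itoDrift]
  ring

lemma tendsto_integral_slice_two (hreg : SliceRegular F b) {α : ℝ} (hα : α ∈ Icc (0 : ℝ) 1)
    (αb θ : ℝ) (x : Fin d → ℝ) (i j : Fin d) :
    Tendsto (fun ε => ∫ ξ, sliceGaussian b (x + (α * ε) • ξ) ξ *
        (ξ i * ξ j * Real.exp (sliceExponent α αb θ F b x ε ξ))) (𝓝[>] 0)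
      (𝓝 (2 * diffusionB b x i j)) := by
  have hlim := (hreg.tendsto_integral_slice hα αb θ x (K := 1) 2
    (ψ := fun ε ξ => ξ i * ξ j * Real.exp (sliceExponent α αb θ F b x ε ξ))
    (ψ₀ := fun ξ => ξ i * ξ j)
    (fun ε _ => ((continuous_apply i).mul (continuous_apply j)).mul
      (Real.continuous_exp.comp (hreg.continuous_sliceExponent α αb θ x ε)))
    (fun ε hε ξ => by
      have h0 := dotProduct_self_nonneg' ξ
      rw [abs_mul, abs_mul, Real.abs_exp, one_mul, pow_two]
      exact mul_le_mul (mul_le_mul (abs_coord_le ξ i) (abs_coord_le ξ j) (abs_nonneg _)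
        (by positivity)) (Real.exp_le_exp.2 (le_abs_self _)) (Real.exp_pos _).le (by positivity))
    (fun ξ => by
      have h := hreg.tendsto_sliceExponent_div α αb θ x ξ
      have hid : Tendsto (fun ε : ℝ => ε) (𝓝[>] 0) (𝓝 0) :=
        tendsto_id.mono_left nhdsWithin_le_nhds
      have h1 := (Real.continuous_exp.tendsto _).comp (h.mul hid)
      rw [mul_zero, Real.exp_zero] at h1
      have h2 := h1.const_mul (ξ i * ξ j)
      rw [mul_one] at h2
      refine h2.congr' ?_
      filter_upwards [self_mem_nhdsWithin] with ε hε
      rw [Function.comp_apply, div_mul_cancel₀ _ (ne_of_gt hε)])).2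
  have h2 := hreg.integral_mul_coord_sliceGaussian i j x
  rwa [show ∫ ξ, sliceGaussian b x ξ * (ξ i * ξ j) = 2 * diffusionB b x i j by
    rw [← h2]; congr 1; funext ξ; ring] at hlim

/-- The moments of the time slice. -/
theorem hasSliceMoments_slice (hreg : SliceRegular F b) {α : ℝ} (hα : α ∈ Icc (0 : ℝ) 1)
    (αb θ : ℝ) (x : Fin d → ℝ) :
    HasSliceMoments x (itoDrift αb F b x) (diffusionB b x)
      (fun h => densityMeasure (sliceDensity α αb θ F b h x)) := by
  obtain ⟨ε₀, hε₀, hM⟩ := hreg.exists_moment_bound_slice hα αb θ x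
  have hev : ∀ᶠ h in 𝓝[>] (0 : ℝ), Real.sqrt h ∈ Ioc 0 ε₀ ∧ Real.sqrt h ^ 2 = h := by
    filter_upwards [Ioc_mem_nhdsGT (pow_pos hε₀ 2)] with h hh
    exact ⟨⟨Real.sqrt_pos.2 hh.1, (Real.sqrt_le_left hε₀.le).2 hh.2⟩, Real.sq_sqrt hh.1.le⟩
  refine HasSliceMoments.of_bounds ?_ (isLittleO_of_comp_sq ?_) (fun i => isLittleO_of_comp_sq ?_)
    (fun i j => isLittleO_of_comp_sq ?_) ?_
  · filter_upwards [hev] with h ⟨h1, h2⟩ M I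
    obtain ⟨C, hC⟩ := hM M I
    rw [← h2]
    refine hreg.integrable_densityMeasure α αb θ x h1.1 (((hC _ h1).1.const_mul
      (Real.sqrt h ^ M)).congr (ae_of_all _ fun ξ => ?_))
    simp only [incrementMonomial_add_smul]
    ring
  · refine (hreg.isLittleO_integral_slice_zero hα αb θ x).congr' ?_ EventuallyEq.rfl
    filter_upwards [self_mem_nhdsWithin] with ε hε
    simp only [hreg.integral_densityMeasure α αb θ x hε, one_mul]
  · have h := (isBigO_refl (fun ε : ℝ => ε) (𝓝[>] 0)).mul_isLittleO
      (hreg.isLittleO_integral_slice_one hα αb θ x i)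
    refine h.congr' ?_ (Eventually.of_forall fun ε => (pow_two ε).symm)
    filter_upwards [self_mem_nhdsWithin] with ε hε
    rw [hreg.integral_densityMeasure α αb θ x hε, mul_sub, ← integral_const_mul]
    refine congrArg₂ _ (integral_congr_ae (ae_of_all _ fun ξ => ?_)) (by ring)
    simp; ring
  · have h1 : Tendsto (fun ε => (∫ ξ, sliceGaussian b (x + (α * ε) • ξ) ξ *
        (ξ i * ξ j * Real.exp (sliceExponent α αb θ F b x ε ξ))) - 2 * diffusionB b x i j)
        (𝓝[>] 0) (𝓝 0) := by
      simpa using (hreg.tendsto_integral_slice_two hα αb θ x i j).sub_const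
        (2 * diffusionB b x i j)
    have h := (isBigO_refl (fun ε : ℝ => ε ^ 2) (𝓝[>] 0)).mul_isLittleO
      ((isLittleO_one_iff ℝ).2 h1)
    simp only [mul_one] at h
    refine h.congr' ?_ EventuallyEq.rfl
    filter_upwards [self_mem_nhdsWithin] with ε hε
    rw [hreg.integral_densityMeasure α αb θ x hε, mul_sub, ← integral_const_mul]
    refine congrArg₂ _ (integral_congr_ae (ae_of_all _ fun ξ => ?_)) (by ring)
    simp; ring
  · intro M I _
    obtain ⟨C, hC⟩ := hM M I
    refine ⟨C, ?_⟩
    filter_upwards [hev] with h ⟨h1, h2⟩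
    have h3 : ∫ y, incrementMonomial x I y ∂(densityMeasure (sliceDensity α αb θ F b h x))
        = Real.sqrt h ^ M * ∫ ξ, sliceGaussian b (x + (α * Real.sqrt h) • ξ) ξ *
        ((∏ k, ξ (I k)) * Real.exp (sliceExponent α αb θ F b x (Real.sqrt h) ξ)) := by
      conv_lhs => rw [← h2]
      rw [hreg.integral_densityMeasure α αb θ x h1.1, ← integral_const_mul]
      congr 1; funext ξ
      rw [incrementMonomial_add_smul]
      ring
    rw [h3, abs_mul, abs_of_nonneg (by positivity), mul_comm]
    exact mul_le_mul_of_nonneg_right (hC _ h1).2 (by positivity)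

end SliceRegular

end SliceMeasure

/-! ### Increments of the Langevin equation -/

section Langevin

lemma exists_uniform_bound {ι X : Type*} [Fintype ι] {f : ι → X → ℝ} {g : X → ℝ}
    (hg : ∀ p, 0 ≤ g p) (h : ∀ a, ∃ C, ∀ p, f a p ≤ C * g p) :
    ∃ C, 0 ≤ C ∧ ∀ a p, f a p ≤ C * g p := by
  choose C hC using h
  refine ⟨∑ a, |C a|, Finset.sum_nonneg fun a _ => abs_nonneg _, fun a p => (hC a p).trans ?_⟩
  refine mul_le_mul_of_nonneg_right ((le_abs_self _).trans ?_) (hg p)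
  exact Finset.single_le_sum (f := fun a => |C a|) (fun _ _ => abs_nonneg _) (Finset.mem_univ a)

/-- A second-order Taylor bound. -/
lemma BddC.taylor_bound {d : ℕ} {f : (Fin d → ℝ) → ℝ} (hf : BddC 2 f) :
    ∃ K, ∀ p : (Fin d → ℝ) × (Fin d → ℝ),
      |f (p.1 + p.2) - f p.1 - ∑ k, p.2 k * partialD k f p.1| ≤ K * ‖p.2‖ ^ 2 := by
  choose L hL h using fun k => lipschitz_of_bounded_partialD (hf.2.2 k).1
    fun l => ((hf.2.2 k).2.2 l).bound
  refine ⟨∑ k, L k, fun ⟨x, v⟩ => ?_⟩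
  simp only
  have hd : ∀ s : ℝ, HasDerivAt (fun s : ℝ => f (x + s • v) - s * ∑ k, v k * partialD k f x)
      (∑ k, v k * (partialD k f (x + s • v) - partialD k f x)) s := fun s => by
    refine ((hf.1 (x + s • v)).hasDerivAt_line.sub
      ((hasDerivAt_id s).mul_const (∑ k, v k * partialD k f x))).congr_deriv ?_
    simp only [one_mul, mul_sub, Finset.sum_sub_distrib]
  have := (convex_Icc (0 : ℝ) 1).norm_image_sub_le_of_norm_hasDerivWithin_le
    (C := (∑ k, L k) * ‖v‖ ^ 2) (fun s _ => (hd s).hasDerivWithinAt) (fun s hs => by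
      refine (norm_sum_le _ _).trans ?_
      rw [Finset.sum_mul]
      refine Finset.sum_le_sum fun k _ => ?_
      rw [norm_mul]
      have h1 := h k (x + s • v) x
      rw [add_sub_cancel_left, norm_smul, Real.norm_eq_abs, abs_of_nonneg hs.1] at h1
      have h2 : L k * (s * ‖v‖) ≤ L k * ‖v‖ :=
        mul_le_mul_of_nonneg_left (mul_le_of_le_one_left (norm_nonneg _) hs.2) (hL k)
      calc _ ≤ ‖v‖ * (L k * ‖v‖) := mul_le_mul (norm_le_pi_norm v k) (h1.trans h2)
            (abs_nonneg _) (norm_nonneg _)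
        _ = _ := by ring)
    (left_mem_Icc.2 zero_le_one) (right_mem_Icc.2 zero_le_one)
  simpa [sub_right_comm] using this

lemma abs_sum_mul_le {m : ℕ} {c : Fin m → ℝ} {C : ℝ} (hc : ∀ μ, |c μ| ≤ C) (w : Fin m → ℝ) :
    |∑ μ, c μ * w μ| ≤ m * (C * ‖w‖) := by
  refine (Finset.abs_sum_le_sum_abs _ _).trans ?_
  calc ∑ μ, |c μ * w μ| ≤ ∑ _μ : Fin m, C * ‖w‖ := Finset.sum_le_sum fun μ _ => by
        rw [abs_mul]
        exact mul_le_mul (hc μ) (norm_le_pi_norm w μ) (abs_nonneg _) ((abs_nonneg _).trans (hc μ))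
    _ = _ := by simp

namespace SliceRegular

variable {d m : ℕ} {F : (Fin d → ℝ) → Fin d → ℝ} {b : (Fin d → ℝ) → Fin d → Fin m → ℝ}

/-- The expansion of a solution `z` of the implicit equation, given the noise `w`. -/
lemma increment_expansion (hreg : SliceRegular F b) {αb : ℝ} (hαb : αb ∈ Icc (0 : ℝ) 1)
    (x : Fin d → ℝ) :
    ∃ C, 0 ≤ C ∧ ∀ (h : ℝ) (w : Fin m → ℝ) (z : Fin d → ℝ), h ∈ Ioc (0 : ℝ) 1 →
      (∀ i, z i = F x i * h + ∑ μ, b (x + αb • z) i μ * w μ) →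
      ‖z‖ ≤ C * (Real.sqrt h + ‖w‖) ∧
      (∀ i j, |z i * z j - (∑ μ, b x i μ * w μ) * ∑ μ, b x j μ * w μ|
        ≤ C * (Real.sqrt h + ‖w‖) ^ 3) ∧
      ∀ i, |z i - (F x i * h + ∑ μ, b x i μ * w μ + αb * ∑ k, ∑ μ, ∑ ν,
          partialD k (fun y => b y i μ) x * b x k ν * (w ν * w μ))|
        ≤ C * (Real.sqrt h + ‖w‖) ^ 3 := by
  obtain ⟨Cb, hCb, hb⟩ := exists_uniform_bound (ι := Fin d × Fin m)
    (f := fun a y => |b y a.1 a.2|) (g := fun _ => 1) (fun _ => zero_le_one)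
    fun a => by simpa using (hreg.noise a.1 a.2).bound
  obtain ⟨D, hD, hDb⟩ := exists_uniform_bound (ι := (Fin d × Fin m) × Fin d)
    (f := fun a y => |partialD a.2 (fun z => b z a.1.1 a.1.2) y|) (g := fun _ => 1)
    (fun _ => zero_le_one)
    fun a => by simpa using ((hreg.noise a.1.1 a.1.2).2.2 a.2).bound
  obtain ⟨L, hL, hLb⟩ := exists_uniform_bound (ι := Fin d × Fin m)
    (f := fun a (p : (Fin d → ℝ) × (Fin d → ℝ)) => |b p.1 a.1 a.2 - b p.2 a.1 a.2|)
    (g := fun p => ‖p.1 - p.2‖) (fun _ => norm_nonneg _) fun a => by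
      obtain ⟨L, -, h⟩ := lipschitz_of_bounded_partialD (hreg.noise a.1 a.2).1
        fun k => ((hreg.noise a.1 a.2).2.2 k).bound
      exact ⟨L, fun p => h p.1 p.2⟩
  obtain ⟨K, hK, hKb⟩ := exists_uniform_bound (ι := Fin d × Fin m)
    (f := fun a (p : (Fin d → ℝ) × (Fin d → ℝ)) => |b (p.1 + p.2) a.1 a.2 - b p.1 a.1 a.2
      - ∑ k, p.2 k * partialD k (fun y => b y a.1 a.2) p.1|)
    (g := fun p => ‖p.2‖ ^ 2) (fun _ => by positivity) fun a => (hreg.noise a.1 a.2).taylor_bound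
  simp only [mul_one] at hb hDb
  set f := ‖F x‖ with hf
  have hf0 : 0 ≤ f := norm_nonneg _
  set C₁ := f + m * Cb with hC₁
  set C₂ := f + m * (L * C₁) with hC₂
  set C₃ := m * (K * C₁ ^ 2) + d * (m * (D * C₂)) with hC₃
  set C₄ := C₂ * C₁ + m * Cb * C₂ with hC₄
  have hC₁0 : 0 ≤ C₁ := by positivity
  have hC₂0 : 0 ≤ C₂ := by positivity
  have hC₃0 : 0 ≤ C₃ := by positivity
  have hC₄0 : 0 ≤ C₄ := by positivity
  refine ⟨C₁ + C₃ + C₄, by positivity, fun h w z hh hz => ?_⟩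
  set ρ := Real.sqrt h + ‖w‖ with hρ
  have hs0 := Real.sqrt_nonneg h
  have hs1 : Real.sqrt h ≤ 1 := Real.sqrt_le_one.2 hh.2
  have hw0 := norm_nonneg w
  have hss : Real.sqrt h * Real.sqrt h = h := Real.mul_self_sqrt hh.1.le
  have hρ0 : 0 ≤ ρ := by positivity
  have hwρ : ‖w‖ ≤ ρ := by linarith
  have hhρ2 : h ≤ ρ ^ 2 := by nlinarith
  have hhρ : h ≤ ρ := by nlinarith
  have hFi : ∀ i, |F x i| ≤ f := fun i => norm_le_pi_norm (F x) i
  have hm0 : (0 : ℝ) ≤ m := Nat.cast_nonneg m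
  have h1 : ‖z‖ ≤ C₁ * ρ := by
    rw [pi_norm_le_iff_of_nonneg (by positivity)]
    intro i
    rw [hz i, Real.norm_eq_abs]
    have e1 := abs_sum_mul_le (fun μ => hb (i, μ) (x + αb • z)) w
    calc _ ≤ |F x i * h| + |∑ μ, b (x + αb • z) i μ * w μ| := abs_add_le _ _
      _ ≤ f * ρ + m * (Cb * ρ) := by
          refine add_le_add ?_ (e1.trans (by gcongr))
          rw [abs_mul, abs_of_pos hh.1]
          exact mul_le_mul (hFi i) hhρ hh.1.le hf0
      _ = C₁ * ρ := by rw [hC₁]; ring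
  have hv : ‖αb • z‖ ≤ C₁ * ρ := by
    rw [norm_smul, Real.norm_eq_abs, abs_of_nonneg hαb.1]
    exact (mul_le_of_le_one_left (norm_nonneg _) hαb.2).trans h1
  have h2 : ∀ i, |z i - ∑ μ, b x i μ * w μ| ≤ C₂ * ρ ^ 2 := fun i => by
    have e0 : z i - ∑ μ, b x i μ * w μ
        = F x i * h + ∑ μ, (b (x + αb • z) i μ - b x i μ) * w μ := by
      rw [hz i]; simp only [sub_mul, Finset.sum_sub_distrib]; ring
    have e1 := abs_sum_mul_le (C := L * (C₁ * ρ)) (fun μ => (hLb (i, μ) (x + αb • z, x)).trans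
      (by simp only [add_sub_cancel_left]; gcongr)) w
    rw [e0]
    calc _ ≤ |F x i * h| + |∑ μ, (b (x + αb • z) i μ - b x i μ) * w μ| := abs_add_le _ _
      _ ≤ f * ρ ^ 2 + m * (L * (C₁ * ρ) * ρ) := by
          refine add_le_add ?_ (e1.trans (by gcongr))
          rw [abs_mul, abs_of_pos hh.1]
          exact mul_le_mul (hFi i) hhρ2 hh.1.le hf0
      _ = C₂ * ρ ^ 2 := by rw [hC₂]; ring
  refine ⟨h1.trans (by gcongr; linarith), fun i j => ?_, fun i => ?_⟩
  · set si := ∑ μ, b x i μ * w μ with hsi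
    set sj := ∑ μ, b x j μ * w μ with hsj
    have e1 : |si| ≤ m * (Cb * ρ) := (abs_sum_mul_le (fun μ => hb (i, μ) x) w).trans (by gcongr)
    have e2 : |z j| ≤ C₁ * ρ := (norm_le_pi_norm z j).trans h1
    have e3 : z i * z j - si * sj = (z i - si) * z j + si * (z j - sj) := by ring
    rw [e3]
    calc _ ≤ |(z i - si) * z j| + |si * (z j - sj)| := abs_add_le _ _
      _ ≤ (C₂ * ρ ^ 2) * (C₁ * ρ) + (m * (Cb * ρ)) * (C₂ * ρ ^ 2) := by
          rw [abs_mul, abs_mul]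
          exact add_le_add (mul_le_mul (h2 i) e2 (abs_nonneg _) (by positivity))
            (mul_le_mul e1 (h2 j) (abs_nonneg _) (by positivity))
      _ = C₄ * ρ ^ 3 := by rw [hC₄]; ring
      _ ≤ _ := by gcongr; linarith
  · have e0 : z i - (F x i * h + ∑ μ, b x i μ * w μ + αb * ∑ k, ∑ μ, ∑ ν,
          partialD k (fun y => b y i μ) x * b x k ν * (w ν * w μ))
        = ∑ μ, (b (x + αb • z) i μ - b x i μ
            - ∑ k, (αb • z) k * partialD k (fun y => b y i μ) x) * w μ
          + αb * ∑ k, ∑ μ, (partialD k (fun y => b y i μ) x * (z k - ∑ ν, b x k ν * w ν)) * w μ := by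
      have e4 : αb * ∑ k, ∑ μ, (partialD k (fun y => b y i μ) x * (z k - ∑ ν, b x k ν * w ν)) * w μ
          = ∑ μ, (∑ k, (αb • z) k * partialD k (fun y => b y i μ) x) * w μ
            - αb * ∑ k, ∑ μ, ∑ ν, partialD k (fun y => b y i μ) x * b x k ν * (w ν * w μ) := by
        have e5 : ∑ μ, (∑ k, (αb • z) k * partialD k (fun y => b y i μ) x) * w μ
            = ∑ k, ∑ μ, αb * (partialD k (fun y => b y i μ) x * z k * w μ) := by
          simp only [Finset.sum_mul]
          rw [Finset.sum_comm]
          refine Finset.sum_congr rfl fun k _ => Finset.sum_congr rfl fun μ _ => ?_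
          simp only [Pi.smul_apply, smul_eq_mul]; ring
        rw [e5]
        simp only [Finset.mul_sum, ← Finset.sum_sub_distrib]
        refine Finset.sum_congr rfl fun k _ => Finset.sum_congr rfl fun μ _ => ?_
        simp only [mul_sub, sub_mul, Finset.mul_sum, Finset.sum_mul]
        refine congrArg₂ _ (by ring) (Finset.sum_congr rfl fun ν _ => by ring)
      rw [e4, hz i]
      simp only [sub_mul, Finset.sum_sub_distrib]
      ring
    have e1 := abs_sum_mul_le (C := K * (C₁ * ρ) ^ 2) (fun μ => (hKb (i, μ) (x, αb • z)).trans
      (by gcongr)) w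
    have e2 : ∀ k, |∑ μ, (partialD k (fun y => b y i μ) x * (z k - ∑ ν, b x k ν * w ν)) * w μ|
        ≤ m * (D * (C₂ * ρ ^ 2) * ρ) := fun k => by
      refine (abs_sum_mul_le (C := D * (C₂ * ρ ^ 2)) (fun μ => ?_) w).trans (by gcongr)
      rw [abs_mul]
      exact mul_le_mul (hDb ((i, μ), k) x) (h2 k) (abs_nonneg _) hD
    have e3 : |αb * ∑ k, ∑ μ, (partialD k (fun y => b y i μ) x *
        (z k - ∑ ν, b x k ν * w ν)) * w μ| ≤ d * (m * (D * (C₂ * ρ ^ 2) * ρ)) := by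
      rw [abs_mul, abs_of_nonneg hαb.1]
      refine (mul_le_of_le_one_left (abs_nonneg _) hαb.2).trans ?_
      refine (Finset.abs_sum_le_sum_abs _ _).trans ((Finset.sum_le_sum fun k _ => e2 k).trans ?_)
      simp
    rw [e0]
    calc _ ≤ m * (K * (C₁ * ρ) ^ 2 * ‖w‖) + d * (m * (D * (C₂ * ρ ^ 2) * ρ)) :=
          (abs_add_le _ _).trans (add_le_add e1 e3)
      _ ≤ m * (K * (C₁ * ρ) ^ 2 * ρ) + d * (m * (D * (C₂ * ρ ^ 2) * ρ)) := by gcongr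
      _ = C₃ * ρ ^ 3 := by rw [hC₃]; ring
      _ ≤ _ := by gcongr; linarith

end SliceRegular

section NoiseMoments

variable {m : ℕ}

lemma integrable_one_add_norm_pow (n : ℕ) :
    Integrable (fun w : Fin m → ℝ => (1 + ‖w‖) ^ n)
      (Measure.pi fun _ : Fin m => gaussianReal 0 1) := by
  set γ := Measure.pi fun _ : Fin m => gaussianReal 0 1 with hγ
  have h1 : ∀ i : Fin m, MemLp (fun w : Fin m → ℝ => w i) n γ := fun i =>
    MemLp.comp_measurePreserving (g := id) (memLp_id_gaussianReal' (n : ENNReal) (by simp))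
      (measurePreserving_eval (fun _ : Fin m => gaussianReal 0 1) i)
  have h2 : MemLp (fun w : Fin m → ℝ => 1 + ∑ i, ‖w i‖) n γ :=
    MemLp.add (f := fun _ => (1 : ℝ)) (g := fun w : Fin m → ℝ => ∑ i, ‖w i‖) (memLp_const 1)
      (memLp_finsetSum _ fun i _ => (h1 i).norm)
  have h3 : MemLp (fun w : Fin m → ℝ => 1 + ‖w‖) n γ := by
    refine h2.mono (by fun_prop) (ae_of_all _ fun w => ?_)
    have h3 : ‖w‖ ≤ ∑ i, ‖w i‖ := by
      rw [pi_norm_le_iff_of_nonneg (Finset.sum_nonneg fun i _ => norm_nonneg _)]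
      exact fun i => Finset.single_le_sum (f := fun i => ‖w i‖) (fun _ _ => norm_nonneg _)
        (Finset.mem_univ i)
    rw [Real.norm_eq_abs, Real.norm_eq_abs, abs_of_nonneg (by positivity)]
    exact (add_le_add_right h3 1).trans (le_abs_self _)
  refine h3.integrable_norm_pow'.congr (ae_of_all _ fun w => ?_)
  simp only
  rw [Real.norm_eq_abs, abs_of_nonneg (by positivity)]

lemma pi_gaussianReal_eq_map {h : ℝ} (hh : 0 ≤ h) :
    (Measure.pi fun _ : Fin m => gaussianReal 0 (Real.toNNReal h))
      = (Measure.pi fun _ : Fin m => gaussianReal 0 1).map (fun w => Real.sqrt h • w) := by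
  have h1 : (gaussianReal 0 1).map (Real.sqrt h * ·) = gaussianReal 0 (Real.toNNReal h) := by
    rw [gaussianReal_map_const_mul, mul_zero, mul_one]
    congr 1
    ext
    simp [Real.sq_sqrt hh, Real.coe_toNNReal _ hh]
  have : IsProbabilityMeasure ((gaussianReal 0 1).map (Real.sqrt h * ·)) := by
    rw [h1]; infer_instance
  have := Measure.pi_map_pi (μ := fun _ : Fin m => gaussianReal 0 1)
    (f := fun _ r => Real.sqrt h * r) (fun _ => by fun_prop)
  simp only [h1] at this
  rw [← this]
  rfl

lemma noise_moment (n : ℕ) {h : ℝ} (hh : 0 ≤ h) :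
    Integrable (fun w : Fin m → ℝ => (Real.sqrt h + ‖w‖) ^ n)
      (Measure.pi fun _ : Fin m => gaussianReal 0 (Real.toNNReal h)) ∧
    ∫ w : Fin m → ℝ, (Real.sqrt h + ‖w‖) ^ n
        ∂(Measure.pi fun _ : Fin m => gaussianReal 0 (Real.toNNReal h))
      = (∫ w : Fin m → ℝ, (1 + ‖w‖) ^ n ∂(Measure.pi fun _ : Fin m => gaussianReal 0 1))
        * Real.sqrt h ^ n := by
  have h1 : ∀ w : Fin m → ℝ, (Real.sqrt h + ‖Real.sqrt h • w‖) ^ n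
      = (1 + ‖w‖) ^ n * Real.sqrt h ^ n := fun w => by
    rw [norm_smul, Real.norm_eq_abs, abs_of_nonneg (Real.sqrt_nonneg h), ← mul_pow]
    congr 1; ring
  rw [pi_gaussianReal_eq_map hh, integral_map (by fun_prop) (by fun_prop),
    integrable_map_measure (by fun_prop) (by fun_prop)]
  simp only [Function.comp_def, h1]
  exact ⟨(integrable_one_add_norm_pow n).mul_const _, integral_mul_const _ _⟩

end NoiseMoments

end Langevin

section LangevinMoments

variable {d m : ℕ} {Ω : Type*} [MeasurableSpace Ω] {P : Measure Ω}
  {αb t T : ℝ} {F : ℝ → (Fin d → ℝ) → Fin d → ℝ} {b : ℝ → (Fin d → ℝ) → Fin d → Fin m → ℝ}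
  {x : Fin d → ℝ} {dW : ℝ → Ω → Fin m → ℝ} {dx : ℝ → Ω → Fin d → ℝ}

namespace IsLangevinIncrement

lemma noise_pow (hL : IsLangevinIncrement αb t T F b x P dW dx) {h : ℝ} (hh : h ∈ Ioc 0 T)
    (n : ℕ) :
    Integrable (fun ω => (Real.sqrt h + ‖dW h ω‖) ^ n) P ∧
    ∫ ω, (Real.sqrt h + ‖dW h ω‖) ^ n ∂P
      = (∫ w : Fin m → ℝ, (1 + ‖w‖) ^ n ∂(Measure.pi fun _ : Fin m => gaussianReal 0 1))
        * Real.sqrt h ^ n := by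
  obtain ⟨h1, h2⟩ := noise_moment (m := m) n hh.1.le
  rw [← hL.dW_law h hh] at h1 h2
  rw [integral_map (hL.dW_aemeasurable h hh) (by fun_prop)] at h2
  exact ⟨(integrable_map_measure (by fun_prop) (hL.dW_aemeasurable h hh)).1 h1, h2⟩

lemma integral_noise (hL : IsLangevinIncrement αb t T F b x P dW dx) {h : ℝ} (hh : h ∈ Ioc 0 T)
    (μ : Fin m) : ∫ ω, dW h ω μ ∂P = 0 := by
  rw [← integral_map (f := fun w : Fin m → ℝ => w μ) (hL.dW_aemeasurable h hh)
    (measurable_pi_apply μ).aestronglyMeasurable,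
    hL.dW_law h hh, integral_coord_pi_gaussianReal]

lemma integral_noise_mul (hL : IsLangevinIncrement αb t T F b x P dW dx) {h : ℝ}
    (hh : h ∈ Ioc 0 T) (μ ν : Fin m) :
    ∫ ω, dW h ω μ * dW h ω ν ∂P = if μ = ν then h else 0 := by
  rw [← integral_map (f := fun w : Fin m → ℝ => w μ * w ν) (hL.dW_aemeasurable h hh) (by fun_prop),
    hL.dW_law h hh, integral_mul_coord_pi_gaussianReal, Real.coe_toNNReal h hh.1.le]

lemma integrable_of_bound (hL : IsLangevinIncrement αb t T F b x P dW dx) {h : ℝ}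
    (hh : h ∈ Ioc 0 T) {f : Ω → ℝ} (hf : AEStronglyMeasurable f P) {C : ℝ} (n : ℕ)
    (hb : ∀ᵐ ω ∂P, |f ω| ≤ C * (Real.sqrt h + ‖dW h ω‖) ^ n) : Integrable f P :=
  ((hL.noise_pow hh n).1.const_mul C).mono' hf hb

lemma aemeasurable_noise (hL : IsLangevinIncrement αb t T F b x P dW dx) {h : ℝ}
    (hh : h ∈ Ioc 0 T) (μ : Fin m) : AEMeasurable (fun ω => dW h ω μ) P :=
  (measurable_pi_apply μ).comp_aemeasurable (hL.dW_aemeasurable h hh)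

lemma integrable_noise (hL : IsLangevinIncrement αb t T F b x P dW dx) {h : ℝ}
    (hh : h ∈ Ioc 0 T) (μ : Fin m) : Integrable (fun ω => dW h ω μ) P :=
  hL.integrable_of_bound hh (hL.aemeasurable_noise hh μ).aestronglyMeasurable (C := 1) 1
    (ae_of_all _ fun ω => by
      have h1 : |dW h ω μ| ≤ ‖dW h ω‖ := norm_le_pi_norm (dW h ω) μ
      have := Real.sqrt_nonneg h
      linarith)

lemma integrable_noise_mul (hL : IsLangevinIncrement αb t T F b x P dW dx) {h : ℝ}
    (hh : h ∈ Ioc 0 T) (μ ν : Fin m) : Integrable (fun ω => dW h ω μ * dW h ω ν) P :=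
  hL.integrable_of_bound hh
    ((hL.aemeasurable_noise hh μ).mul (hL.aemeasurable_noise hh ν)).aestronglyMeasurable (C := 1) 2
    (ae_of_all _ fun ω => by
      have h1 : ∀ μ, |dW h ω μ| ≤ Real.sqrt h + ‖dW h ω‖ := fun μ => by
        have h1 : |dW h ω μ| ≤ ‖dW h ω‖ := norm_le_pi_norm (dW h ω) μ
        have := Real.sqrt_nonneg h
        linarith
      rw [abs_mul, one_mul, pow_two]
      exact mul_le_mul (h1 μ) (h1 ν) (abs_nonneg _) ((abs_nonneg _).trans (h1 μ)))

lemma integral_sum_noise (hL : IsLangevinIncrement αb t T F b x P dW dx) {h : ℝ}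
    (hh : h ∈ Ioc 0 T) (c : Fin m → ℝ) :
    Integrable (fun ω => ∑ μ, c μ * dW h ω μ) P ∧ ∫ ω, ∑ μ, c μ * dW h ω μ ∂P = 0 := by
  have hi : ∀ μ, Integrable (fun ω => c μ * dW h ω μ) P := fun μ =>
    (hL.integrable_noise hh μ).const_mul _
  refine ⟨integrable_finsetSum _ fun μ _ => hi μ, ?_⟩
  rw [integral_finsetSum _ fun μ _ => hi μ]
  simp [integral_const_mul, hL.integral_noise hh]

lemma integral_sum_noise_mul (hL : IsLangevinIncrement αb t T F b x P dW dx) {h : ℝ}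
    (hh : h ∈ Ioc 0 T) (c : Fin m → Fin m → ℝ) :
    Integrable (fun ω => ∑ μ, ∑ ν, c μ ν * (dW h ω ν * dW h ω μ)) P ∧
      ∫ ω, ∑ μ, ∑ ν, c μ ν * (dW h ω ν * dW h ω μ) ∂P = h * ∑ μ, c μ μ := by
  have hi : ∀ μ ν, Integrable (fun ω => c μ ν * (dW h ω ν * dW h ω μ)) P := fun μ ν =>
    (hL.integrable_noise_mul hh ν μ).const_mul _
  have hi' := fun μ => integrable_finsetSum Finset.univ fun ν _ => hi μ ν
  refine ⟨integrable_finsetSum _ fun μ _ => hi' μ, ?_⟩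
  rw [integral_finsetSum _ fun μ _ => hi' μ]
  simp only [integral_finsetSum _ fun ν _ => hi _ ν, integral_const_mul, hL.integral_noise_mul hh,
    mul_ite, mul_zero, Finset.sum_ite_eq', Finset.mem_univ, if_true]
  rw [Finset.mul_sum]
  exact Finset.sum_congr rfl fun μ _ => mul_comm _ _

/-- The difference of two moments that agree up to `ρ ^ 3`. -/
lemma abs_integral_sub_le (hL : IsLangevinIncrement αb t T F b x P dW dx) {h : ℝ}
    (hh : h ∈ Ioc 0 T) {f g : Ω → ℝ} (hf : Integrable f P) (hg : Integrable g P) {C : ℝ} (n : ℕ)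
    (hb : ∀ᵐ ω ∂P, |f ω - g ω| ≤ C * (Real.sqrt h + ‖dW h ω‖) ^ n) :
    |∫ ω, f ω ∂P - ∫ ω, g ω ∂P| ≤ C *
      (∫ w : Fin m → ℝ, (1 + ‖w‖) ^ n ∂(Measure.pi fun _ : Fin m => gaussianReal 0 1))
        * Real.sqrt h ^ n := by
  obtain ⟨h1, h2⟩ := hL.noise_pow hh n
  rw [← integral_sub hf hg, mul_assoc, ← h2, ← integral_const_mul]
  exact norm_integral_le_of_norm_le (f := fun ω => f ω - g ω) (h1.const_mul C) hb

/-- The moments of the increment of the `ᾱ`-Langevin equation. -/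
theorem hasSliceMoments [IsProbabilityMeasure P] (hT : 0 < T)
    (hL : IsLangevinIncrement αb t T F b x P dW dx) (hreg : SliceRegular (F t) (b t))
    (hαb : αb ∈ Icc (0 : ℝ) 1) :
    HasSliceMoments x (itoDrift αb (F t) (b t) x) (diffusionB (b t) x)
      (fun h => P.map (fun ω => x + dx h ω)) := by
  obtain ⟨C, hC, hexp⟩ := hreg.increment_expansion hαb x
  have hev : ∀ᶠ h in 𝓝[>] (0 : ℝ), h ∈ Ioc 0 T ∧ h ∈ Ioc (0 : ℝ) 1 := by
    filter_upwards [Ioc_mem_nhdsGT hT, Ioc_mem_nhdsGT one_pos] with h h1 h2 using ⟨h1, h2⟩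
  have hX : ∀ h ∈ Ioc 0 T, AEMeasurable (fun ω => x + dx h ω) P := fun h hh =>
    (hL.dx_aemeasurable h hh).const_add x
  have hmap : ∀ h ∈ Ioc 0 T, ∀ f : (Fin d → ℝ) → ℝ, Continuous f →
      ∫ y, f y ∂(P.map (fun ω => x + dx h ω)) = ∫ ω, f (x + dx h ω) ∂P := fun h hh f hf =>
    integral_map (hX h hh) hf.aestronglyMeasurable
  have hmono : ∀ h ∈ Ioc 0 T, h ∈ Ioc (0 : ℝ) 1 → ∀ (M : ℕ) (I : Fin M → Fin d),
      (Integrable (fun ω => incrementMonomial x I (x + dx h ω)) P) ∧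
      ∀ᵐ ω ∂P, |incrementMonomial x I (x + dx h ω)| ≤ C ^ M * (Real.sqrt h + ‖dW h ω‖) ^ M := by
    intro h hh hh1 M I
    have hb : ∀ᵐ ω ∂P, |incrementMonomial x I (x + dx h ω)|
        ≤ C ^ M * (Real.sqrt h + ‖dW h ω‖) ^ M := by
      filter_upwards [hL.equation h hh] with ω hω
      rw [← mul_pow]
      refine (abs_incrementMonomial_le x I _).trans (pow_le_pow_left₀ (norm_nonneg _) ?_ M)
      rw [add_sub_cancel_left]
      exact (hexp h _ _ hh1 hω).1
    exact ⟨hL.integrable_of_bound hh ((continuous_incrementMonomial x I).measurable.comp_aemeasurable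
      (hX h hh)).aestronglyMeasurable M hb, hb⟩
  refine HasSliceMoments.of_bounds ?_ ?_ (fun i => ?_) (fun i j => ?_) ?_
  · filter_upwards [hev] with h ⟨hh, hh1⟩ M I
    exact (integrable_map_measure (continuous_incrementMonomial x I).aestronglyMeasurable
      (hX h hh)).2 (hmono h hh hh1 M I).1
  · refine (isLittleO_zero _ _).congr' ?_ EventuallyEq.rfl
    filter_upwards [hev] with h ⟨hh, _⟩
    rw [hmap h hh _ continuous_const]
    simp
  · refine isLittleO_of_abs_le_sqrt_pow le_rfl (C := C *
      (∫ w : Fin m → ℝ, (1 + ‖w‖) ^ 3 ∂(Measure.pi fun _ : Fin m => gaussianReal 0 1))) ?_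
    filter_upwards [hev] with h ⟨hh, hh1⟩
    have hs := hL.integral_sum_noise hh (fun μ => b t x i μ)
    have hq := fun k => hL.integral_sum_noise_mul hh
      (fun μ ν => partialD k (fun y => b t y i μ) x * b t x k ν)
    have hq1 := (integrable_finsetSum Finset.univ fun k _ => (hq k).1).const_mul αb
    have hfs : Integrable (fun ω => F t x i * h + ∑ μ, b t x i μ * dW h ω μ) P :=
      (integrable_const _).add hs.1
    have hval : ∫ ω, (F t x i * h + ∑ μ, b t x i μ * dW h ω μ + αb * ∑ k, ∑ μ, ∑ ν,
        partialD k (fun y => b t y i μ) x * b t x k ν * (dW h ω ν * dW h ω μ)) ∂P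
        = h * itoDrift αb (F t) (b t) x i := by
      rw [integral_add hfs hq1, integral_add (integrable_const _) hs.1, hs.2, integral_const_mul αb,
        integral_finsetSum _ fun k _ => (hq k).1]
      simp only [(hq _).2, itoDrift, noiseDrift, ← Finset.mul_sum, integral_const, probReal_univ,
        one_smul, mul_comm (b t x _ _)]
      ring
    rw [hmap h hh (fun y => y i - x i) (by fun_prop), ← hval]
    have hm := (hmono h hh hh1 1 (fun _ => i)).1
    refine hL.abs_integral_sub_le hh (by simpa [incrementMonomial] using hm) (hfs.add hq1) 3 ?_
    filter_upwards [hL.equation h hh] with ω hω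
    simpa using (hexp h _ _ hh1 hω).2.2 i
  · refine isLittleO_of_abs_le_sqrt_pow le_rfl (C := C *
      (∫ w : Fin m → ℝ, (1 + ‖w‖) ^ 3 ∂(Measure.pi fun _ : Fin m => gaussianReal 0 1))) ?_
    filter_upwards [hev] with h ⟨hh, hh1⟩
    have hq := hL.integral_sum_noise_mul hh (fun μ ν => b t x j μ * b t x i ν)
    have heq : ∀ ω, (∑ μ, b t x i μ * dW h ω μ) * ∑ μ, b t x j μ * dW h ω μ
        = ∑ μ, ∑ ν, b t x j μ * b t x i ν * (dW h ω ν * dW h ω μ) := fun ω => by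
      rw [mul_comm, Finset.sum_mul_sum]
      exact Finset.sum_congr rfl fun μ _ => Finset.sum_congr rfl fun ν _ => by ring
    have hval : ∫ ω, (∑ μ, b t x i μ * dW h ω μ) * ∑ μ, b t x j μ * dW h ω μ ∂P
        = h * (2 * diffusionB (b t) x i j) := by
      rw [integral_congr_ae (ae_of_all _ heq), hq.2]
      simp only [diffusionB, Matrix.of_apply, mul_comm (b t x j _)]
      ring
    rw [hmap h hh (fun y => (y i - x i) * (y j - x j)) (by fun_prop), ← hval]
    have hm := (hmono h hh hh1 2 ![i, j]).1
    refine hL.abs_integral_sub_le hh (by simpa [incrementMonomial] using hm)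
      (by simpa only [heq] using hq.1) 3 ?_
    filter_upwards [hL.equation h hh] with ω hω
    simpa using (hexp h _ _ hh1 hω).2.1 i j
  · intro M I _
    refine ⟨C ^ M *
      ∫ w : Fin m → ℝ, (1 + ‖w‖) ^ M ∂(Measure.pi fun _ : Fin m => gaussianReal 0 1), ?_⟩
    filter_upwards [hev] with h ⟨hh, hh1⟩
    rw [hmap h hh _ (continuous_incrementMonomial x I)]
    have := hL.abs_integral_sub_le hh (hmono h hh hh1 M I).1 (integrable_zero Ω ℝ P) (C := C ^ M) M
      (by simpa using (hmono h hh hh1 M I).2)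
    simpa using this

end IsLangevinIncrement

end LangevinMoments

/-! ### A smooth saturating function and an integral inequality -/

section Saturation

/-- A smooth function that is `v` for `v ≤ 1` and `1` for `2 ≤ v`. -/
def saturation (v : ℝ) : ℝ := v + Real.smoothTransition (v - 1) * (1 - v)

lemma contDiff_saturation : ContDiff ℝ ((⊤ : ℕ∞) : WithTop ℕ∞) saturation := by
  have h : ContDiff ℝ ((⊤ : ℕ∞) : WithTop ℕ∞) fun v : ℝ => Real.smoothTransition (v - 1) :=
    Real.smoothTransition.contDiff.comp (contDiff_id.sub contDiff_const)
  exact contDiff_id.add (h.mul (contDiff_const.sub contDiff_id))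

lemma saturation_of_le {v : ℝ} (hv : v ≤ 1) : saturation v = v := by
  simp [saturation, Real.smoothTransition.zero_of_nonpos (sub_nonpos.2 hv)]

lemma saturation_of_ge {v : ℝ} (hv : 2 ≤ v) : saturation v = 1 := by
  simp [saturation, Real.smoothTransition.one_of_one_le (show 1 ≤ v - 1 by linarith)]

lemma min_le_saturation (v : ℝ) : min v 1 ≤ saturation v := by
  rcases le_total v 1 with hv | hv
  · rw [saturation_of_le hv, min_eq_left hv]
  · rw [min_eq_right hv, saturation]
    nlinarith [mul_le_of_le_one_left (sub_nonneg.2 hv) (Real.smoothTransition.le_one (v - 1))]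

lemma saturation_le_two (v : ℝ) : saturation v ≤ 2 := by
  rcases le_total v 1 with hv | hv
  · rw [saturation_of_le hv]; linarith
  rcases le_total 2 v with hv2 | hv2
  · rw [saturation_of_ge hv2]; norm_num
  · rw [saturation]
    nlinarith [mul_nonneg (Real.smoothTransition.nonneg (v - 1)) (sub_nonneg.2 hv)]

lemma saturation_nonneg {v : ℝ} (hv : 0 ≤ v) : 0 ≤ saturation v :=
  (le_min hv zero_le_one).trans (min_le_saturation v)

lemma deriv_saturation_of_lt {v : ℝ} (hv : v < 1) : deriv saturation v = 1 := by
  have : saturation =ᶠ[𝓝 v] id := by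
    filter_upwards [Iio_mem_nhds hv] with w hw using saturation_of_le (le_of_lt hw)
  rw [this.deriv_eq, deriv_id]

lemma deriv_saturation_of_gt {v : ℝ} (hv : 2 < v) : deriv saturation v = 0 := by
  have : saturation =ᶠ[𝓝 v] fun _ => 1 := by
    filter_upwards [Ioi_mem_nhds hv] with w hw using saturation_of_ge (le_of_lt hw)
  rw [this.deriv_eq, deriv_const]

lemma deriv_deriv_saturation_of_lt {v : ℝ} (hv : v < 1) : deriv (deriv saturation) v = 0 := by
  have : deriv saturation =ᶠ[𝓝 v] fun _ => 1 := by
    filter_upwards [Iio_mem_nhds hv] with w hw using deriv_saturation_of_lt hw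
  rw [this.deriv_eq, deriv_const]

lemma deriv_deriv_saturation_of_gt {v : ℝ} (hv : 2 < v) : deriv (deriv saturation) v = 0 := by
  have : deriv saturation =ᶠ[𝓝 v] fun _ => 0 := by
    filter_upwards [Ioi_mem_nhds hv] with w hw using deriv_saturation_of_gt hw
  rw [this.deriv_eq, deriv_const]

lemma contDiff_deriv_saturation : ContDiff ℝ ((⊤ : ℕ∞) : WithTop ℕ∞) (deriv saturation) := by
  simpa using contDiff_saturation.iterate_deriv 1

lemma hasDerivAt_saturation (v : ℝ) : HasDerivAt saturation (deriv saturation v) v :=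
  (contDiff_saturation.differentiable (by simp) v).hasDerivAt

lemma hasDerivAt_deriv_saturation (v : ℝ) :
    HasDerivAt (deriv saturation) (deriv (deriv saturation) v) v :=
  (contDiff_deriv_saturation.differentiable (by simp) v).hasDerivAt

lemma exists_saturation_bound : ∃ C : ℝ, 0 ≤ C ∧ ∀ v : ℝ, 0 ≤ v →
    |deriv saturation v| ≤ C ∧ v * |deriv saturation v| ≤ C * saturation v ∧
      v ^ 2 * |deriv (deriv saturation) v| ≤ C * saturation v := by
  obtain ⟨C₁, h₁⟩ := (isCompact_Icc (a := (1 : ℝ)) (b := 2)).exists_bound_of_continuousOn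
    (contDiff_deriv_saturation.continuous.continuousOn)
  obtain ⟨C₂, h₂⟩ := (isCompact_Icc (a := (1 : ℝ)) (b := 2)).exists_bound_of_continuousOn
    ((contDiff_deriv_saturation.continuous_deriv (by simp)).continuousOn)
  have hC₁ : 0 ≤ C₁ := (norm_nonneg _).trans (h₁ 1 (by norm_num))
  have hC₂ : 0 ≤ C₂ := (norm_nonneg _).trans (h₂ 1 (by norm_num))
  refine ⟨1 + 2 * C₁ + 4 * C₂, by positivity, fun v hv => ?_⟩
  have hφ := saturation_nonneg hv
  rcases lt_or_ge v 1 with hv1 | hv1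
  · rw [deriv_saturation_of_lt hv1, deriv_deriv_saturation_of_lt hv1, saturation_of_le hv1.le]
    simp only [abs_one, abs_zero, mul_zero, mul_one]
    refine ⟨by linarith, by nlinarith, by positivity⟩
  rcases lt_or_ge 2 v with hv2 | hv2
  · rw [deriv_saturation_of_gt hv2, deriv_deriv_saturation_of_gt hv2]
    simp only [abs_zero, mul_zero]
    exact ⟨by positivity, by positivity, by positivity⟩
  have h1 : |deriv saturation v| ≤ C₁ := h₁ v ⟨hv1, hv2⟩
  have h2 : |deriv (deriv saturation) v| ≤ C₂ := h₂ v ⟨hv1, hv2⟩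
  have hs : 1 ≤ saturation v := by simpa [hv1] using min_le_saturation v
  have hC : 0 ≤ 1 + 2 * C₁ + 4 * C₂ := by positivity
  refine ⟨by linarith, ?_, ?_⟩
  · calc v * |deriv saturation v| ≤ 2 * C₁ := mul_le_mul hv2 h1 (abs_nonneg _) (by norm_num)
      _ ≤ (1 + 2 * C₁ + 4 * C₂) * 1 := by linarith
      _ ≤ _ := mul_le_mul_of_nonneg_left hs hC
  · calc v ^ 2 * |deriv (deriv saturation) v| ≤ 2 ^ 2 * C₂ :=
          mul_le_mul (pow_le_pow_left₀ hv hv2 2) h2 (abs_nonneg _) (by norm_num)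
      _ ≤ (1 + 2 * C₁ + 4 * C₂) * 1 := by linarith
      _ ≤ _ := mul_le_mul_of_nonneg_left hs hC

/-- The test function `φ(u ^ (n + 1) / R) - 1` of the squared distance `u`. -/
def saturatedPow (n : ℕ) (R u : ℝ) : ℝ := saturation (u ^ (n + 1) / R) - 1

/-- The derivative of `saturatedPow`. -/
def saturatedPow' (n : ℕ) (R u : ℝ) : ℝ :=
  deriv saturation (u ^ (n + 1) / R) * ((n + 1) * u ^ n / R)

/-- The second derivative of `saturatedPow`. -/
def saturatedPow'' (n : ℕ) (R u : ℝ) : ℝ :=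
  deriv (deriv saturation) (u ^ (n + 1) / R) * ((n + 1) * u ^ n / R) ^ 2
    + deriv saturation (u ^ (n + 1) / R) * ((n + 1) * (n * u ^ (n - 1)) / R)

lemma contDiff_saturatedPow (n : ℕ) (R : ℝ) :
    ContDiff ℝ ((⊤ : ℕ∞) : WithTop ℕ∞) (saturatedPow n R) :=
  (contDiff_saturation.comp ((contDiff_id.pow (n + 1)).div_const R)).sub contDiff_const

lemma hasDerivAt_saturatedPow (n : ℕ) (R u : ℝ) :
    HasDerivAt (saturatedPow n R) (saturatedPow' n R u) u := by
  have h : HasDerivAt (fun u : ℝ => u ^ (n + 1) / R) ((n + 1) * u ^ n / R) u := by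
    simpa using (hasDerivAt_pow (n + 1) u).div_const R
  exact ((hasDerivAt_saturation _).comp u h).sub_const 1

lemma hasDerivAt_saturatedPow' (n : ℕ) (R u : ℝ) :
    HasDerivAt (saturatedPow' n R) (saturatedPow'' n R u) u := by
  have h : HasDerivAt (fun u : ℝ => u ^ (n + 1) / R) ((n + 1) * u ^ n / R) u := by
    simpa using (hasDerivAt_pow (n + 1) u).div_const R
  have h2 : HasDerivAt (fun u : ℝ => (n + 1) * u ^ n / R) ((n + 1) * (n * u ^ (n - 1)) / R) u :=
    ((hasDerivAt_pow n u).const_mul _).div_const R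
  refine (((hasDerivAt_deriv_saturation _).comp u h).mul h2).congr_deriv ?_
  simp only [saturatedPow'', Function.comp]
  ring

lemma exists_saturatedPow_bound (n : ℕ) : ∃ C : ℝ, 0 ≤ C ∧ ∀ R u : ℝ, 1 ≤ R → 0 ≤ u →
    (1 + u) * |saturatedPow' n R u| + u * |saturatedPow'' n R u|
      ≤ C * (saturation (u ^ (n + 1) / R) + u ^ n / R) := by
  obtain ⟨C, hC, h⟩ := exists_saturation_bound
  refine ⟨(n + 1) ^ 2 * C + (n + 1) * C + (n + 1) * n * C, by positivity, fun R u hR hu => ?_⟩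
  have hR0 : 0 < R := by linarith
  set v := u ^ (n + 1) / R with hv
  have hv0 : 0 ≤ v := by positivity
  obtain ⟨h1, h2, h3⟩ := h v hv0
  set D := deriv saturation v
  set D₂ := deriv (deriv saturation) v
  have hw : 0 ≤ u ^ n / R := by positivity
  have huv : u * (u ^ n / R) = v := by rw [hv]; ring
  have hφ := saturation_nonneg hv0
  have e1 : |saturatedPow' n R u| = (n + 1) * (|D| * (u ^ n / R)) := by
    rw [saturatedPow', ← hv, abs_mul, abs_of_nonneg (a := (n + 1) * u ^ n / R) (by positivity)]
    ring
  have b1 : |D| * (u ^ n / R) ≤ C * (u ^ n / R) := mul_le_mul_of_nonneg_right h1 hw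
  have b2 : u * (|D| * (u ^ n / R)) ≤ C * saturation v := by
    calc u * (|D| * (u ^ n / R)) = v * |D| := by rw [← huv]; ring
      _ ≤ _ := h2
  have b3 : u * (|D₂| * (u ^ n / R) ^ 2) ≤ C * saturation v := by
    rcases lt_or_ge v 1 with hv1 | hv1
    · rw [show D₂ = 0 from deriv_deriv_saturation_of_lt hv1]
      simpa using mul_nonneg hC hφ
    · have hu1 : 1 ≤ u := by
        by_contra hu1
        have : u ^ (n + 1) < 1 := pow_lt_one₀ hu (not_le.1 hu1) (by omega)
        have := (one_le_div hR0).1 hv1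
        linarith
      calc u * (|D₂| * (u ^ n / R) ^ 2) ≤ u * (u * (|D₂| * (u ^ n / R) ^ 2)) :=
            le_mul_of_one_le_left (by positivity) hu1
        _ = v ^ 2 * |D₂| := by rw [← huv]; ring
        _ ≤ _ := h3
  have hpow : u * (n * u ^ (n - 1)) = n * u ^ n := by
    rcases n with _ | n
    · simp
    · simp only [Nat.add_sub_cancel]; ring
  have b4 : u * |saturatedPow'' n R u|
      ≤ (n + 1) ^ 2 * (C * saturation v) + (n + 1) * n * (C * (u ^ n / R)) := by
    calc u * |saturatedPow'' n R u|
        ≤ u * (|D₂| * ((n + 1) * u ^ n / R) ^ 2 + |D| * ((n + 1) * (n * u ^ (n - 1)) / R)) := by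
          refine mul_le_mul_of_nonneg_left ((abs_add_le _ _).trans (le_of_eq ?_)) hu
          rw [abs_mul, abs_mul, abs_of_nonneg (a := ((n + 1) * u ^ n / R) ^ 2) (by positivity),
            abs_of_nonneg (a := (n + 1) * (n * u ^ (n - 1)) / R) (by positivity)]
      _ = (n + 1) ^ 2 * (u * (|D₂| * (u ^ n / R) ^ 2))
          + (n + 1) * |D| * (u * (n * u ^ (n - 1))) / R := by ring
      _ = (n + 1) ^ 2 * (u * (|D₂| * (u ^ n / R) ^ 2)) + (n + 1) * n * (|D| * (u ^ n / R)) := by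
          rw [hpow]; ring
      _ ≤ _ := add_le_add (mul_le_mul_of_nonneg_left b3 (by positivity))
          (mul_le_mul_of_nonneg_left b1 (by positivity))
  have b5 : (1 + u) * |saturatedPow' n R u|
      ≤ (n + 1) * (C * (u ^ n / R)) + (n + 1) * (C * saturation v) := by
    rw [e1]
    calc (1 + u) * ((n + 1) * (|D| * (u ^ n / R)))
        = (n + 1) * (|D| * (u ^ n / R)) + (n + 1) * (u * (|D| * (u ^ n / R))) := by ring
      _ ≤ _ := add_le_add (mul_le_mul_of_nonneg_left b1 (by positivity))
          (mul_le_mul_of_nonneg_left b2 (by positivity))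
  have p1 : 0 ≤ C * saturation v := mul_nonneg hC hφ
  have p2 : 0 ≤ C * (u ^ n / R) := mul_nonneg hC hw
  have hn : (0 : ℝ) ≤ n := n.cast_nonneg
  nlinarith [mul_nonneg (mul_nonneg (by positivity : (0 : ℝ) ≤ (n + 1) * n) hC) hφ,
    mul_nonneg (by positivity : (0 : ℝ) ≤ (n + 1) ^ 2) p2]

/-- Gronwall's inequality in integral form. -/
lemma le_mul_exp_of_le_integral {g : ℝ → ℝ} {K ε h : ℝ} (hK : 0 < K) (hh : 0 ≤ h)
    (hg : ContinuousOn g (Icc 0 h)) (hle : ∀ s ∈ Icc 0 h, g s ≤ K * (∫ r in (0 : ℝ)..s, g r) + ε) :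
    g h ≤ ε * Real.exp (K * h) := by
  have hint : ∀ s ∈ Icc 0 h, IntervalIntegrable g volume 0 s := fun s hs =>
    (hg.mono (by rw [uIcc_of_le hs.1]; exact Icc_subset_Icc_right hs.2)).intervalIntegrable
  have hU : ContinuousOn (fun s => ∫ r in (0 : ℝ)..s, g r) (Icc 0 h) := by
    have := intervalIntegral.continuousOn_primitive_interval (f := g) (μ := volume) (a := 0) (b := h)
      (by rw [uIcc_of_le hh]; exact hg.integrableOn_Icc)
    rwa [uIcc_of_le hh] at this
  have hd : ∀ s ∈ Ico 0 h, HasDerivWithinAt (fun s => ∫ r in (0 : ℝ)..s, g r) (g s) (Ici s) s := by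
    intro s hs
    have hmem : Icc 0 h ∈ 𝓝[>] s := mem_of_superset (Ioc_mem_nhdsGT hs.2)
      fun r hr => ⟨hs.1.trans hr.1.le, hr.2⟩
    have hmeas : StronglyMeasurableAtFilter g (𝓝[>] s) volume :=
      ⟨Icc 0 h, hmem, hg.aestronglyMeasurable measurableSet_Icc⟩
    have hc : ContinuousWithinAt g (Ioi s) s :=
      (hg s ⟨hs.1, hs.2.le⟩).mono_of_mem_nhdsWithin hmem
    exact intervalIntegral.integral_hasDerivWithinAt_right (hint s ⟨hs.1, hs.2.le⟩) hmeas hc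
  have hG := le_gronwallBound_of_liminf_deriv_right_le (δ := 0) (K := K) (ε := ε) hU
    (fun s hs r hr => (hd s hs).liminf_right_slope_le hr) (by simp)
    (fun s hs => hle s ⟨hs.1, hs.2.le⟩) h ⟨hh, le_rfl⟩
  rw [gronwallBound_of_K_ne_0 hK.ne'] at hG
  have := hle h ⟨hh, le_rfl⟩
  simp only [zero_mul, zero_add, sub_zero] at hG
  calc g h ≤ K * (∫ r in (0 : ℝ)..h, g r) + ε := this
    _ ≤ K * (ε / K * (Real.exp (K * h) - 1)) + ε := by gcongr
    _ = _ := by field_simp; ring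

end Saturation

/-! ### The Fokker-Planck equation -/

section FokkerPlanckCoefficients

variable {d m : ℕ}

/-- The squared Euclidean distance. -/
def sqDist (x y : Fin d → ℝ) : ℝ := ∑ i, (y i - x i) ^ 2

lemma sqDist_nonneg (x y : Fin d → ℝ) : 0 ≤ sqDist x y :=
  Finset.sum_nonneg fun _ _ => sq_nonneg _

lemma sq_norm_sub_le_sqDist (x y : Fin d → ℝ) : ‖y - x‖ ^ 2 ≤ sqDist x y := by
  have := norm_sq_le_dotProduct (y - x)
  simpa [dotProduct, sqDist, pow_two] using this

lemma contDiff_sqDist (x : Fin d → ℝ) :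
    ContDiff ℝ ((⊤ : ℕ∞) : WithTop ℕ∞) (sqDist x) :=
  ContDiff.sum fun i _ => ((contDiff_apply ℝ ℝ i).sub contDiff_const).pow 2

lemma continuous_sqDist (x : Fin d → ℝ) : Continuous (sqDist x) := (contDiff_sqDist x).continuous

lemma partialD_coord_sub (x : Fin d → ℝ) (k i : Fin d) (y : Fin d → ℝ) :
    partialD k (fun z => z i - x i) y = if i = k then 1 else 0 := by
  have h : HasFDerivAt (fun z : Fin d → ℝ => z i - x i)
      (ContinuousLinearMap.proj (R := ℝ) (φ := fun _ : Fin d => ℝ) i) y :=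
    (ContinuousLinearMap.proj (R := ℝ) (φ := fun _ : Fin d => ℝ) i).hasFDerivAt.sub_const _
  rw [partialD, h.fderiv]
  simp [Pi.single_apply]

lemma differentiable_coord_sub (x : Fin d → ℝ) (i : Fin d) :
    Differentiable ℝ fun z : Fin d → ℝ => z i - x i := by fun_prop

lemma partialD_sqDist (x : Fin d → ℝ) (k : Fin d) (y : Fin d → ℝ) :
    partialD k (sqDist x) y = 2 * (y k - x k) := by
  have h : sqDist x = fun z => ∑ i, (z i - x i) * (z i - x i) := by
    funext z
    simp only [sqDist, pow_two]
  rw [h, partialD_sum Finset.univ k (f := fun i z => (z i - x i) * (z i - x i))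
    fun i _ => by fun_prop]
  simp only [partialD_mul k (differentiable_coord_sub x _ y) (differentiable_coord_sub x _ y),
    partialD_coord_sub, ite_mul, mul_ite, one_mul, zero_mul, mul_one, mul_zero,
    Finset.sum_add_distrib, Finset.sum_ite_eq', Finset.mem_univ, if_true]
  ring

/-- The generator applied to a function of the squared distance. -/
lemma fokkerPlanckAdjoint_radial (A : (Fin d → ℝ) → Fin d → ℝ)
    (b : (Fin d → ℝ) → Fin d → Fin m → ℝ) (x : Fin d → ℝ) {Φ Φ' Φ'' : ℝ → ℝ}
    (h₁ : ∀ u, HasDerivAt Φ (Φ' u) u) (h₂ : ∀ u, HasDerivAt Φ' (Φ'' u) u) (y : Fin d → ℝ) :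
    fokkerPlanckAdjoint A b (fun z => Φ (sqDist x z)) y
      = Φ' (sqDist x y) * (2 * ∑ i, A y i * (y i - x i) + 2 * ∑ i, diffusionB b y i i)
        + Φ'' (sqDist x y)
          * (4 * ∑ i, ∑ j, diffusionB b y i j * ((y i - x i) * (y j - x j))) := by
  have hr : Differentiable ℝ (sqDist x) := (contDiff_sqDist x).differentiable (by simp)
  have e1 : ∀ j, partialD j (fun z => Φ (sqDist x z))
      = fun z => Φ' (sqDist x z) * (2 * (z j - x j)) := fun j => by
    funext z
    rw [(h₁ (sqDist x z)).partialD_comp j (hr z), partialD_sqDist]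
  have e2 : ∀ i j, partialD i (fun z => Φ' (sqDist x z) * (2 * (z j - x j))) y
      = Φ'' (sqDist x y) * (4 * ((y i - x i) * (y j - x j)))
        + Φ' (sqDist x y) * (2 * if j = i then 1 else 0) := fun i j => by
    rw [partialD_mul (f := fun z => Φ' (sqDist x z)) (g := fun z => 2 * (z j - x j)) i
      ((h₂ _).differentiableAt.comp y (hr y)) (by fun_prop),
      (h₂ (sqDist x y)).partialD_comp i (hr y), partialD_sqDist,
      partialD_const_mul i 2 (differentiable_coord_sub x j y), partialD_coord_sub]
    ring
  simp only [fokkerPlanckAdjoint, e1, e2, mul_add, Finset.sum_add_distrib, mul_ite, mul_one,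
    mul_zero, Finset.sum_ite_eq', Finset.mem_univ, if_true]
  simp only [Finset.mul_sum]
  have c1 : ∀ i, A y i * (Φ' (sqDist x y) * (2 * (y i - x i)))
      = Φ' (sqDist x y) * (2 * (A y i * (y i - x i))) := fun i => by ring
  have c2 : ∀ i j, diffusionB b y i j * (Φ'' (sqDist x y) * (4 * ((y i - x i) * (y j - x j))))
      = Φ'' (sqDist x y) * (4 * (diffusionB b y i j * ((y i - x i) * (y j - x j)))) :=
    fun i j => by ring
  have c3 : ∀ i, diffusionB b y i i * (Φ' (sqDist x y) * 2)
      = Φ' (sqDist x y) * (2 * diffusionB b y i i) := fun i => by ring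
  simp only [c1, c2, c3]
  ring

/-- What the moment estimates for the Fokker-Planck equation need: continuous coefficients, a
drift of linear growth and a bounded diffusion matrix. -/
structure DynamicsRegular (t T : ℝ) (A : ℝ → (Fin d → ℝ) → Fin d → ℝ)
    (b : ℝ → (Fin d → ℝ) → Fin d → Fin m → ℝ) (x : Fin d → ℝ) : Prop where
  drift_continuousOn : ∀ i, ContinuousOn (fun p : ℝ × (Fin d → ℝ) => A p.1 p.2 i)
    (Icc t (t + T) ×ˢ univ)
  diffusion_continuousOn : ∀ i j, ContinuousOn
    (fun p : ℝ × (Fin d → ℝ) => diffusionB (b p.1) p.2 i j) (Icc t (t + T) ×ˢ univ)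
  bound : ∃ K : ℝ, 0 < K ∧ ∀ s ∈ Icc t (t + T), ∀ y,
    |2 * ∑ i, A s y i * (y i - x i) + 2 * ∑ i, diffusionB (b s) y i i| ≤ K * (1 + sqDist x y) ∧
    |4 * ∑ i, ∑ j, diffusionB (b s) y i j * ((y i - x i) * (y j - x j))| ≤ K * sqDist x y

lemma DynamicsRegular.of_bounds {t T : ℝ} {A : ℝ → (Fin d → ℝ) → Fin d → ℝ}
    {b : ℝ → (Fin d → ℝ) → Fin d → Fin m → ℝ} {x : Fin d → ℝ}
    (hA : ∀ i, ContinuousOn (fun p : ℝ × (Fin d → ℝ) => A p.1 p.2 i) (Icc t (t + T) ×ˢ univ))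
    (hB : ∀ i j, ContinuousOn
      (fun p : ℝ × (Fin d → ℝ) => diffusionB (b p.1) p.2 i j) (Icc t (t + T) ×ˢ univ))
    {K : ℝ} (hAK : ∀ s ∈ Icc t (t + T), ∀ y i, |A s y i| ≤ K * (1 + ‖y - x‖))
    (hBK : ∀ s ∈ Icc t (t + T), ∀ y i j, |diffusionB (b s) y i j| ≤ K) :
    DynamicsRegular t T A b x := by
  refine ⟨hA, hB, 1 + (∑ _i : Fin d, 6 * |K|) + (∑ _i : Fin d, ∑ _j : Fin d, 4 * |K|),
    by positivity, fun s hs y => ⟨?_, ?_⟩⟩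
  · set r := sqDist x y
    have hr : 0 ≤ r := sqDist_nonneg x y
    have hn := sq_norm_sub_le_sqDist x y
    have hterm : ∀ i, |2 * (A s y i * (y i - x i)) + 2 * diffusionB (b s) y i i|
        ≤ 6 * |K| * (1 + r) := fun i => by
      have h1 : |A s y i| ≤ |K| * (1 + ‖y - x‖) :=
        (hAK s hs y i).trans (mul_le_mul_of_nonneg_right (le_abs_self K) (by positivity))
      have h2 : |y i - x i| ≤ ‖y - x‖ := norm_le_pi_norm (y - x) i
      have h3 := (hBK s hs y i i).trans (le_abs_self K)
      have h4 : |A s y i * (y i - x i)| ≤ |K| * (1 + ‖y - x‖) * ‖y - x‖ := by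
        rw [abs_mul]
        exact mul_le_mul h1 h2 (abs_nonneg _) (by positivity)
      have h5 : (1 + ‖y - x‖) * ‖y - x‖ ≤ 1 + 2 * r := by nlinarith [sq_nonneg (‖y - x‖ - 1)]
      have h6 : |K| * ((1 + ‖y - x‖) * ‖y - x‖) ≤ |K| * (1 + 2 * r) :=
        mul_le_mul_of_nonneg_left h5 (abs_nonneg K)
      refine (abs_add_le _ _).trans ?_
      rw [abs_mul, abs_mul 2, abs_two]
      nlinarith [abs_nonneg K, mul_nonneg (abs_nonneg K) hr]
    calc |2 * ∑ i, A s y i * (y i - x i) + 2 * ∑ i, diffusionB (b s) y i i|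
        = |∑ i, (2 * (A s y i * (y i - x i)) + 2 * diffusionB (b s) y i i)| := by
          rw [Finset.sum_add_distrib, Finset.mul_sum, Finset.mul_sum]
      _ ≤ ∑ _i : Fin d, 6 * |K| * (1 + r) :=
          (Finset.abs_sum_le_sum_abs _ _).trans (Finset.sum_le_sum fun i _ => hterm i)
      _ = (∑ _i : Fin d, 6 * |K|) * (1 + r) := by rw [Finset.sum_mul]
      _ ≤ _ := mul_le_mul_of_nonneg_right (by
          have : 0 ≤ ∑ _i : Fin d, ∑ _j : Fin d, 4 * |K| := by positivity
          linarith) (by linarith)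
  · set r := sqDist x y
    have hr : 0 ≤ r := sqDist_nonneg x y
    have hn := sq_norm_sub_le_sqDist x y
    have hterm : ∀ i j, |4 * (diffusionB (b s) y i j * ((y i - x i) * (y j - x j)))|
        ≤ 4 * |K| * r := fun i j => by
      have h2 : |y i - x i| ≤ ‖y - x‖ := norm_le_pi_norm (y - x) i
      have h2' : |y j - x j| ≤ ‖y - x‖ := norm_le_pi_norm (y - x) j
      have h3 := (hBK s hs y i j).trans (le_abs_self K)
      have h4 : |y i - x i| * |y j - x j| ≤ r :=
        (mul_le_mul h2 h2' (abs_nonneg _) (norm_nonneg _)).trans (by rwa [← pow_two])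
      rw [abs_mul, abs_mul, abs_mul, mul_assoc, abs_of_pos (show (0 : ℝ) < 4 by norm_num)]
      exact mul_le_mul_of_nonneg_left (mul_le_mul h3 h4 (by positivity) (abs_nonneg K))
        (by norm_num)
    calc |4 * ∑ i, ∑ j, diffusionB (b s) y i j * ((y i - x i) * (y j - x j))|
        = |∑ i, ∑ j, 4 * (diffusionB (b s) y i j * ((y i - x i) * (y j - x j)))| := by
          simp only [Finset.mul_sum]
      _ ≤ ∑ _i : Fin d, ∑ _j : Fin d, 4 * |K| * r :=
          (Finset.abs_sum_le_sum_abs _ _).trans (Finset.sum_le_sum fun i _ =>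
            (Finset.abs_sum_le_sum_abs _ _).trans (Finset.sum_le_sum fun j _ => hterm i j))
      _ = (∑ _i : Fin d, ∑ _j : Fin d, 4 * |K|) * r := by simp only [Finset.sum_mul]
      _ ≤ _ := mul_le_mul_of_nonneg_right (by
          have : 0 ≤ ∑ _i : Fin d, 6 * |K| := by positivity
          linarith) hr

lemma RegularCoefficients.dynamicsRegular {t T : ℝ} (hT : 0 ≤ T)
    {F : ℝ → (Fin d → ℝ) → Fin d → ℝ} {b : ℝ → (Fin d → ℝ) → Fin d → Fin m → ℝ}
    (hreg : RegularCoefficients t T F b) {αb : ℝ} (hαb : αb ∈ Icc (0 : ℝ) 1) (x : Fin d → ℝ) :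
    DynamicsRegular t T (fun s => itoDrift αb (F s) (b s)) b x := by
  obtain ⟨C, hC⟩ := hreg.bounded
  have hC0 : 0 ≤ C := (norm_nonneg _).trans (hC t ⟨le_rfl, by linarith⟩ x).1
  have hbd : ∀ s ∈ Icc t (t + T), Differentiable ℝ (b s) := fun s hs =>
    (hreg.b_contDiff s hs).differentiable (by norm_num)
  have hbc : ∀ i μ, ContinuousOn (fun p : ℝ × (Fin d → ℝ) => b p.1 p.2 i μ)
      (Icc t (t + T) ×ˢ univ) := fun i μ =>
    continuousOn_pi.1 (continuousOn_pi.1 hreg.b_continuousOn i) μ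
  have hpc : ∀ k i μ, ContinuousOn
      (fun p : ℝ × (Fin d → ℝ) => partialD k (fun y => b p.1 y i μ) p.2)
      (Icc t (t + T) ×ˢ univ) := fun k i μ => by
    have h := hreg.fderiv_b_continuousOn.clm_apply
      (continuousOn_const (c := (Pi.single k 1 : Fin d → ℝ)))
    refine (continuousOn_pi.1 (continuousOn_pi.1 h i) μ).congr fun p hp => ?_
    exact partialD_coord₂ (hbd p.1 hp.1 p.2) k i μ
  have hbb : ∀ s ∈ Icc t (t + T), ∀ y i μ, |b s y i μ| ≤ C := fun s hs y i μ =>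
    ((norm_le_pi_norm (b s y i) μ).trans (norm_le_pi_norm (b s y) i)).trans (hC s hs y).2.1
  have hpb : ∀ s ∈ Icc t (t + T), ∀ y k i μ, |partialD k (fun y => b s y i μ) y| ≤ C := by
    intro s hs y k i μ
    rw [partialD_coord₂ (hbd s hs y)]
    refine ((norm_le_pi_norm _ μ).trans
      (norm_le_pi_norm (fderiv ℝ (b s) y (Pi.single k 1)) i)).trans ?_
    refine (ContinuousLinearMap.le_opNorm _ _).trans ?_
    rw [norm_single_one, mul_one]
    exact (hC s hs y).2.2.1
  obtain ⟨C', hC'⟩ := (isCompact_Icc (a := t) (b := t + T)).exists_bound_of_continuousOn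
    (f := fun s => F s x) (hreg.F_continuousOn.comp (f := fun s => (s, x))
      (by fun_prop) fun s hs => ⟨hs, mem_univ _⟩)
  have hC'0 : 0 ≤ C' := (norm_nonneg _).trans (hC' t ⟨le_rfl, by linarith⟩)
  have hFb : ∀ s ∈ Icc t (t + T), ∀ y i, |F s y i| ≤ C' + C * ‖y - x‖ := by
    intro s hs y i
    have h1 := convex_univ.norm_image_sub_le_of_norm_fderiv_le (𝕜 := ℝ) (f := F s)
      (fun w _ => (hreg.F_contDiff s hs).differentiable (by norm_num) w)
      (fun w _ => (hC s hs w).1) (mem_univ x) (mem_univ y)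
    calc |F s y i| ≤ ‖F s y‖ := norm_le_pi_norm (F s y) i
      _ = ‖F s x + (F s y - F s x)‖ := by rw [add_sub_cancel]
      _ ≤ _ := (norm_add_le _ _).trans (add_le_add (hC' s hs) h1)
  have hnb : ∀ s ∈ Icc t (t + T), ∀ y i,
      |noiseDrift (b s) y i| ≤ ∑ _k : Fin d, ∑ _μ : Fin m, C * C := fun s hs y i =>
    (Finset.abs_sum_le_sum_abs _ _).trans (Finset.sum_le_sum fun k _ =>
      (Finset.abs_sum_le_sum_abs _ _).trans (Finset.sum_le_sum fun μ _ => by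
        rw [abs_mul]
        exact mul_le_mul (hbb s hs y k μ) (hpb s hs y k i μ) (abs_nonneg _) hC0))
  have hN : 0 ≤ ∑ _k : Fin d, ∑ _μ : Fin m, C * C := by positivity
  have hM : 0 ≤ (1 / 2) * ∑ _μ : Fin m, C * C := by positivity
  refine DynamicsRegular.of_bounds (K := C' + C + (∑ _k : Fin d, ∑ _μ : Fin m, C * C)
    + (1 / 2) * ∑ _μ : Fin m, C * C) (fun i => ?_) (fun i j => ?_) (fun s hs y i => ?_)
    (fun s hs y i j => ?_)
  · simp only [itoDrift, noiseDrift]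
    refine (continuousOn_pi.1 hreg.F_continuousOn i).add (continuousOn_const.mul ?_)
    exact continuousOn_finsetSum _ fun k _ => continuousOn_finsetSum _ fun μ _ =>
      (hbc k μ).mul (hpc k i μ)
  · simp only [diffusionB, Matrix.of_apply]
    exact continuousOn_const.mul (continuousOn_finsetSum _ fun μ _ => (hbc i μ).mul (hbc j μ))
  · have h1 : |αb * noiseDrift (b s) y i| ≤ ∑ _k : Fin d, ∑ _μ : Fin m, C * C := by
      rw [abs_mul, abs_of_nonneg hαb.1]
      exact (mul_le_of_le_one_left (abs_nonneg _) hαb.2).trans (hnb s hs y i)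
    have h2 := (abs_add_le (F s y i) (αb * noiseDrift (b s) y i)).trans
      (add_le_add (hFb s hs y i) h1)
    have hn : 0 ≤ ‖y - x‖ := norm_nonneg _
    change |F s y i + αb * noiseDrift (b s) y i| ≤ _
    nlinarith [mul_nonneg hC'0 hn, mul_nonneg hN hn, mul_nonneg hM hn]
  · have h1 : |diffusionB (b s) y i j| ≤ (1 / 2) * ∑ _μ : Fin m, C * C := by
      simp only [diffusionB, Matrix.of_apply]
      rw [abs_mul, abs_of_pos (show (0 : ℝ) < 1 / 2 by norm_num)]
      refine mul_le_mul_of_nonneg_left ?_ (by norm_num)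
      refine (Finset.abs_sum_le_sum_abs _ _).trans (Finset.sum_le_sum fun μ _ => ?_)
      rw [abs_mul]
      exact mul_le_mul (hbb s hs y i μ) (hbb s hs y j μ) (abs_nonneg _) hC0
    linarith

end FokkerPlanckCoefficients

section FokkerPlanckMoments

lemma integrable_of_integral_min_le {Ω : Type*} [MeasurableSpace Ω] {μ : Measure Ω}
    [IsProbabilityMeasure μ] {g : Ω → ℝ} (hg : Measurable g) (h0 : ∀ ω, 0 ≤ g ω) {D : ℝ}
    (hD : ∀ N : ℕ, ∫ ω, min (g ω) (N + 1) ∂μ ≤ D) : Integrable g μ ∧ ∫ ω, g ω ∂μ ≤ D := by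
  have hmin : ∀ N : ℕ, Measurable fun ω => min (g ω) ((N : ℝ) + 1) := fun N =>
    hg.min measurable_const
  have hmin0 : ∀ (N : ℕ) ω, 0 ≤ min (g ω) ((N : ℝ) + 1) := fun N ω =>
    le_min (h0 ω) (by positivity)
  have hle : ∀ N : ℕ, ∫⁻ ω, ENNReal.ofReal (min (g ω) (N + 1)) ∂μ ≤ ENNReal.ofReal D := fun N => by
    rw [← ofReal_integral_eq_lintegral_ofReal _ (ae_of_all _ (hmin0 N))]
    · exact ENNReal.ofReal_le_ofReal (hD N)
    · refine Integrable.of_bound (hmin N).aestronglyMeasurable ((N : ℝ) + 1) (ae_of_all _ fun ω => ?_)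
      rw [Real.norm_eq_abs, abs_of_nonneg (hmin0 N ω)]
      exact min_le_right _ _
  have hlim : ∫⁻ ω, ENNReal.ofReal (g ω) ∂μ ≤ ENNReal.ofReal D := by
    refine le_of_tendsto' (lintegral_tendsto_of_tendsto_of_monotone
      (f := fun (N : ℕ) ω => ENNReal.ofReal (min (g ω) (N + 1)))
      (fun N => (hmin N).ennreal_ofReal.aemeasurable) (ae_of_all _ fun ω => ?_)
      (ae_of_all _ fun ω => ?_)) hle
    · intro N N' hN
      have : (N : ℝ) ≤ N' := by exact_mod_cast hN
      exact ENNReal.ofReal_le_ofReal (min_le_min le_rfl (by linarith))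
    · refine tendsto_const_nhds.congr' ?_
      obtain ⟨N₀, hN₀⟩ := exists_nat_ge (g ω)
      filter_upwards [eventually_ge_atTop N₀] with N hN
      have : (N₀ : ℝ) ≤ N := by exact_mod_cast hN
      rw [min_eq_left (by linarith)]
  have hint : Integrable g μ := ⟨hg.aestronglyMeasurable,
    (hasFiniteIntegral_iff_ofReal (ae_of_all _ h0)).2 (hlim.trans_lt ENNReal.ofReal_lt_top)⟩
  refine ⟨hint, ?_⟩
  have hD0 : 0 ≤ D := (integral_nonneg (hmin0 0)).trans (hD 0)
  rw [integral_eq_lintegral_of_nonneg_ae (ae_of_all _ h0) hg.aestronglyMeasurable]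
  exact ENNReal.toReal_le_of_le_ofReal hD0 hlim

namespace IsFokkerPlanckGreen

variable {d m : ℕ} {t T : ℝ} {A : ℝ → (Fin d → ℝ) → Fin d → ℝ}
  {b : ℝ → (Fin d → ℝ) → Fin d → Fin m → ℝ} {x : Fin d → ℝ} {G : ℝ → Measure (Fin d → ℝ)}

/-- The truncated moments are bounded uniformly in the truncation. -/
lemma saturated_moment_le (hT : 0 ≤ T) (hG : IsFokkerPlanckGreen t T A b x G)
    (hreg : DynamicsRegular t T A b x) (n : ℕ) {C : ℝ}
    (hC : ∀ h ∈ Icc 0 T, Integrable (fun y => sqDist x y ^ n) (G h) ∧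
      ∫ y, sqDist x y ^ n ∂(G h) ≤ C * h ^ n) :
    ∃ D : ℝ, ∀ R : ℝ, 1 ≤ R → ∀ h ∈ Icc 0 T,
      ∫ y, saturation (sqDist x y ^ (n + 1) / R) ∂(G h) ≤ D * h ^ (n + 1) / R := by
  obtain ⟨K, hK, hKb⟩ := hreg.bound
  obtain ⟨C₀, hC₀, hC₀b⟩ := exists_saturatedPow_bound n
  set K' := K * (C₀ + 1) with hK'def
  have hK' : 0 < K' := by positivity
  have hC0 : 0 ≤ C * T ^ n := (integral_nonneg fun y => pow_nonneg (sqDist_nonneg x y) n).trans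
    (hC T ⟨hT, le_rfl⟩).2
  refine ⟨K' * C * Real.exp (K' * T), fun R hR h hh => ?_⟩
  have hR0 : 0 < R := by linarith
  set φ : (Fin d → ℝ) → ℝ := fun y => saturation (sqDist x y ^ (n + 1) / R) with hφdef
  set f : (Fin d → ℝ) → ℝ := fun y => saturatedPow n R (sqDist x y) with hfdef
  have hφ0 : ∀ y, 0 ≤ φ y := fun y =>
    saturation_nonneg (by have := sqDist_nonneg x y; positivity)
  have hfc : ContDiff ℝ ((⊤ : ℕ∞) : WithTop ℕ∞) f :=
    (contDiff_saturatedPow n R).comp (contDiff_sqDist x)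
  have hφf : ∀ y, φ y = f y + 1 := fun y => by simp [hφdef, hfdef, saturatedPow]
  have hφc : Continuous φ := by
    rw [show φ = fun y => f y + 1 from funext hφf]
    exact hfc.continuous.add continuous_const
  have hfs : HasCompactSupport f := by
    refine HasCompactSupport.intro (isCompact_closedBall x (2 * R)) fun y hy => ?_
    rw [Metric.mem_closedBall, dist_eq_norm, not_le] at hy
    have h1 := sq_norm_sub_le_sqDist x y
    have h2 : 2 * R ≤ sqDist x y := by nlinarith
    have h3 : sqDist x y ≤ sqDist x y ^ (n + 1) := le_self_pow₀ (by linarith) (by omega)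
    have : saturation (sqDist x y ^ (n + 1) / R) = 1 :=
      saturation_of_ge ((le_div_iff₀ hR0).2 (h2.trans h3))
    simp [hfdef, saturatedPow, this]
  have hfx : f x = -1 := by
    simp [hfdef, saturatedPow, sqDist, saturation_of_le zero_le_one]
  have hφi : ∀ s ∈ Icc 0 T, Integrable φ (G s) := fun s hs => by
    have := hG.isProbabilityMeasure s hs
    refine Integrable.of_bound hφc.aestronglyMeasurable 2 (ae_of_all _ fun y => ?_)
    rw [Real.norm_eq_abs, abs_of_nonneg (hφ0 y)]
    exact saturation_le_two _
  set ℓ : ℝ → ℝ := fun s => ∫ y, fokkerPlanckAdjoint (A (t + s)) (b (t + s)) f y ∂(G s)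
  have hℓ : IntervalIntegrable ℓ volume 0 T := hG.intervalIntegrable f hfc hfs
  have hg : ∀ s ∈ Icc 0 T, ∫ y, φ y ∂(G s) = ∫ r in (0 : ℝ)..s, ℓ r := fun s hs => by
    have := hG.isProbabilityMeasure s hs
    have h1 := hG.weak_solution f hfc hfs s hs
    have h2 : ∫ y, φ y ∂(G s) = (∫ y, f y ∂(G s)) + 1 := by
      have hfi : Integrable f (G s) := hfc.continuous.integrable_of_hasCompactSupport hfs
      simp only [hφf]
      rw [integral_add hfi (integrable_const _)]
      simp
    rw [h2, h1, hfx]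
    ring
  have hbound : ∀ s ∈ Icc 0 T, ℓ s ≤ K' * (∫ y, φ y ∂(G s)) + K' * (C * s ^ n / R) := by
    intro s hs
    have hts : t + s ∈ Icc t (t + T) := ⟨by linarith [hs.1], by linarith [hs.2]⟩
    have hri := (hC s hs).1.div_const R
    have hb : ∀ y, ‖fokkerPlanckAdjoint (A (t + s)) (b (t + s)) f y‖
        ≤ K' * (φ y + sqDist x y ^ n / R) := fun y => by
      have hr := sqDist_nonneg x y
      obtain ⟨k1, k2⟩ := hKb (t + s) hts y
      have hc := hC₀b R (sqDist x y) hR hr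
      have hp : 0 ≤ φ y + sqDist x y ^ n / R := add_nonneg (hφ0 y) (by positivity)
      rw [hfdef, fokkerPlanckAdjoint_radial _ _ x (hasDerivAt_saturatedPow n R)
        (hasDerivAt_saturatedPow' n R), Real.norm_eq_abs]
      refine (abs_add_le _ _).trans ?_
      rw [abs_mul, abs_mul]
      calc _ ≤ |saturatedPow' n R (sqDist x y)| * (K * (1 + sqDist x y))
            + |saturatedPow'' n R (sqDist x y)| * (K * sqDist x y) :=
            add_le_add (mul_le_mul_of_nonneg_left k1 (abs_nonneg _))
              (mul_le_mul_of_nonneg_left k2 (abs_nonneg _))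
        _ = K * ((1 + sqDist x y) * |saturatedPow' n R (sqDist x y)|
            + sqDist x y * |saturatedPow'' n R (sqDist x y)|) := by ring
        _ ≤ K * (C₀ * (φ y + sqDist x y ^ n / R)) := mul_le_mul_of_nonneg_left hc hK.le
        _ ≤ K' * (φ y + sqDist x y ^ n / R) := by rw [hK'def]; nlinarith
    have h1 := norm_integral_le_of_norm_le (((hφi s hs).add hri).const_mul K') (ae_of_all _ hb)
    refine (le_abs_self _).trans (h1.trans ?_)
    rw [integral_const_mul, integral_add' (hφi s hs) hri, integral_div, mul_add]
    have := div_le_div_of_nonneg_right (hC s hs).2 hR0.le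
    gcongr
  have hgc : ContinuousOn (fun s => ∫ y, φ y ∂(G s)) (Icc 0 T) := by
    have := intervalIntegral.continuousOn_primitive_interval (f := ℓ) (μ := volume) (a := 0)
      (b := T) (by
        rw [uIcc_of_le hT, integrableOn_Icc_iff_integrableOn_Ioc]
        exact (intervalIntegrable_iff_integrableOn_Ioc_of_le hT).1 hℓ)
    rw [uIcc_of_le hT] at this
    exact this.congr hg
  have hsub : ∀ {s}, s ∈ Icc 0 h → s ∈ Icc 0 T := fun hs => ⟨hs.1, hs.2.trans hh.2⟩
  have hCh : ∀ s ∈ Icc 0 h, C * s ^ n ≤ C * h ^ n := fun s hs => by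
    rcases le_or_gt 0 C with hC1 | hC1
    · exact mul_le_mul_of_nonneg_left (pow_le_pow_left₀ hs.1 hs.2 n) hC1
    · have h0 : 0 ≤ C * h ^ n := (integral_nonneg fun y => pow_nonneg (sqDist_nonneg x y) n).trans
        (hC h hh).2
      exact (mul_nonpos_of_nonpos_of_nonneg hC1.le (pow_nonneg hs.1 n)).trans h0
  have hgron := le_mul_exp_of_le_integral (g := fun s => ∫ y, φ y ∂(G s)) (K := K')
    (ε := K' * (C * h ^ (n + 1) / R)) hK' hh.1 (hgc.mono (Icc_subset_Icc_right hh.2)) (by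
      intro s hs
      have hsI : IntervalIntegrable (fun s => ∫ y, φ y ∂(G s)) volume 0 s := by
        refine ContinuousOn.intervalIntegrable ?_
        rw [uIcc_of_le hs.1]
        exact hgc.mono (Icc_subset_Icc_right (hs.2.trans hh.2))
      have hmono : ∫ r in (0 : ℝ)..s, ℓ r
          ≤ ∫ r in (0 : ℝ)..s, (K' * (∫ y, φ y ∂(G r)) + K' * (C * h ^ n / R)) := by
        refine intervalIntegral.integral_mono_on hs.1 (hℓ.mono_set ?_)
          ((hsI.const_mul K').add intervalIntegrable_const) fun r hr => ?_
        · rw [uIcc_of_le hs.1, uIcc_of_le hT]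
          exact Icc_subset_Icc_right (hs.2.trans hh.2)
        · have hrh : r ∈ Icc 0 h := ⟨hr.1, hr.2.trans hs.2⟩
          refine (hbound r (hsub hrh)).trans ?_
          have := div_le_div_of_nonneg_right (hCh r hrh) hR0.le
          gcongr
      rw [hg s (hsub hs)]
      refine hmono.trans ?_
      rw [intervalIntegral.integral_add (hsI.const_mul K') intervalIntegrable_const,
        intervalIntegral.integral_const_mul, intervalIntegral.integral_const, sub_zero,
        smul_eq_mul]
      have h0 : 0 ≤ C * h ^ n := (integral_nonneg fun y => pow_nonneg (sqDist_nonneg x y) n).trans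
        (hC h hh).2
      have h1 : s * (K' * (C * h ^ n / R)) ≤ h * (K' * (C * h ^ n / R)) :=
        mul_le_mul_of_nonneg_right hs.2 (mul_nonneg hK'.le (div_nonneg h0 hR0.le))
      have h2 : h * (K' * (C * h ^ n / R)) = K' * (C * h ^ (n + 1) / R) := by ring
      linarith)
  refine hgron.trans ?_
  have h0 : 0 ≤ C * h ^ n := (integral_nonneg fun y => pow_nonneg (sqDist_nonneg x y) n).trans
    (hC h hh).2
  have hexp : Real.exp (K' * h) ≤ Real.exp (K' * T) :=
    Real.exp_le_exp.2 (mul_le_mul_of_nonneg_left hh.2 hK'.le)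
  have h3 : 0 ≤ K' * (C * h ^ (n + 1) / R) := by
    rw [pow_succ, ← mul_assoc]
    exact mul_nonneg hK'.le (div_nonneg (mul_nonneg h0 hh.1) hR0.le)
  refine (mul_le_mul_of_nonneg_left hexp h3).trans (le_of_eq ?_)
  ring

/-- All moments of the transition probability exist, with the scaling of diffusion. -/
lemma moment_le (hT : 0 ≤ T) (hG : IsFokkerPlanckGreen t T A b x G)
    (hreg : DynamicsRegular t T A b x) (n : ℕ) :
    ∃ C : ℝ, ∀ h ∈ Icc 0 T, Integrable (fun y => sqDist x y ^ n) (G h) ∧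
      ∫ y, sqDist x y ^ n ∂(G h) ≤ C * h ^ n := by
  induction n with
  | zero =>
    refine ⟨1, fun h hh => ?_⟩
    have := hG.isProbabilityMeasure h hh
    simp
  | succ n ih =>
    obtain ⟨C, hC⟩ := ih
    obtain ⟨D, hD⟩ := hG.saturated_moment_le hT hreg n hC
    refine ⟨D, fun h hh => ?_⟩
    have := hG.isProbabilityMeasure h hh
    refine integrable_of_integral_min_le ((continuous_sqDist x).pow (n + 1)).measurable
      (fun y => pow_nonneg (sqDist_nonneg x y) _) fun N => ?_
    have hR : (1 : ℝ) ≤ N + 1 := by linarith [(N.cast_nonneg : (0 : ℝ) ≤ N)]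
    have hR0 : (0 : ℝ) < N + 1 := by positivity
    have hφc : Continuous fun y => saturation (sqDist x y ^ (n + 1) / ((N : ℝ) + 1)) :=
      contDiff_saturation.continuous.comp (((continuous_sqDist x).pow (n + 1)).div_const _)
    have hφi : Integrable (fun y => saturation (sqDist x y ^ (n + 1) / ((N : ℝ) + 1))) (G h) := by
      refine Integrable.of_bound hφc.aestronglyMeasurable 2 (ae_of_all _ fun y => ?_)
      have := sqDist_nonneg x y
      rw [Real.norm_eq_abs, abs_of_nonneg (saturation_nonneg (by positivity))]
      exact saturation_le_two _
    calc ∫ y, min (sqDist x y ^ (n + 1)) ((N : ℝ) + 1) ∂(G h)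
        ≤ ∫ y, ((N : ℝ) + 1) * saturation (sqDist x y ^ (n + 1) / ((N : ℝ) + 1)) ∂(G h) := by
          refine integral_mono_of_nonneg (ae_of_all _ fun y => ?_) (hφi.const_mul _)
            (ae_of_all _ fun y => ?_)
          · exact le_min (pow_nonneg (sqDist_nonneg x y) _) hR0.le
          · have h1 := mul_le_mul_of_nonneg_left
              (min_le_saturation (sqDist x y ^ (n + 1) / ((N : ℝ) + 1))) hR0.le
            rwa [mul_min_of_nonneg _ _ hR0.le, mul_div_cancel₀ _ hR0.ne', mul_one] at h1
      _ = ((N : ℝ) + 1) * ∫ y, saturation (sqDist x y ^ (n + 1) / ((N : ℝ) + 1)) ∂(G h) :=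
          integral_const_mul _ _
      _ ≤ ((N : ℝ) + 1) * (D * h ^ (n + 1) / ((N : ℝ) + 1)) :=
          mul_le_mul_of_nonneg_left (hD _ hR h hh) hR0.le
      _ = D * h ^ (n + 1) := by field_simp

end IsFokkerPlanckGreen

end FokkerPlanckMoments

section FokkerPlanckGenerator

variable {d m : ℕ}

lemma ContDiff.continuous_partialD {f : (Fin d → ℝ) → ℝ} (hf : ContDiff ℝ 2 f) (i : Fin d) :
    Continuous (partialD i f) :=
  (ContDiff.partialD_comp (n := 1) (by simpa [one_add_one_eq_two] using hf) i).continuous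

lemma ContDiff.continuous_partialD_partialD {f : (Fin d → ℝ) → ℝ} (hf : ContDiff ℝ 2 f)
    (i j : Fin d) : Continuous (partialD i (partialD j f)) :=
  (ContDiff.partialD_comp (n := 0) (by
    simpa using ContDiff.partialD_comp (n := 1) (by simpa [one_add_one_eq_two] using hf) j)
    i).continuous

lemma Filter.EventuallyEq.partialD {f g : (Fin d → ℝ) → ℝ} {x : Fin d → ℝ} (h : f =ᶠ[𝓝 x] g)
    (i : Fin d) : partialD i f =ᶠ[𝓝 x] partialD i g := by
  filter_upwards [h.fderiv (𝕜 := ℝ)] with y hy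
  rw [_root_.partialD, hy, _root_.partialD]

lemma Filter.EventuallyEq.fokkerPlanckAdjoint_eq {f g : (Fin d → ℝ) → ℝ} {x : Fin d → ℝ}
    (h : f =ᶠ[𝓝 x] g) (A : (Fin d → ℝ) → Fin d → ℝ) (b : (Fin d → ℝ) → Fin d → Fin m → ℝ) :
    fokkerPlanckAdjoint A b f x = fokkerPlanckAdjoint A b g x := by
  simp only [fokkerPlanckAdjoint, (h.partialD _).eq_of_nhds, ((h.partialD _).partialD _).eq_of_nhds]

lemma fokkerPlanckAdjoint_eq_zero {f : (Fin d → ℝ) → ℝ} {y : Fin d → ℝ} (hy : y ∉ tsupport f)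
    (A : (Fin d → ℝ) → Fin d → ℝ) (b : (Fin d → ℝ) → Fin d → Fin m → ℝ) :
    fokkerPlanckAdjoint A b f y = 0 := by
  rw [(notMem_tsupport_iff_eventuallyEq.1 hy).fokkerPlanckAdjoint_eq]
  have h : ∀ i : Fin d, _root_.partialD i (0 : (Fin d → ℝ) → ℝ) = fun _ => 0 := fun i =>
    partialD_const i 0
  simp [fokkerPlanckAdjoint, h, partialD_const]

namespace IsFokkerPlanckGreen

variable {t T : ℝ} {A : ℝ → (Fin d → ℝ) → Fin d → ℝ}
  {b : ℝ → (Fin d → ℝ) → Fin d → Fin m → ℝ} {x : Fin d → ℝ} {G : ℝ → Measure (Fin d → ℝ)}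

/-- The generator at the initial time and the initial point. -/
lemma integral_sub_isLittleO (hT : 0 < T) (hG : IsFokkerPlanckGreen t T A b x G)
    (hreg : DynamicsRegular t T A b x) {f : (Fin d → ℝ) → ℝ}
    (hf : ContDiff ℝ ((⊤ : ℕ∞) : WithTop ℕ∞) f) (hfs : HasCompactSupport f) :
    (fun h => (∫ y, f y ∂(G h)) - f x - h * fokkerPlanckAdjoint (A t) (b t) f x)
      =o[𝓝[>] 0] fun h => h := by
  have hf2 : ContDiff ℝ 2 f := by
    exact_mod_cast contDiff_infty.1 hf 2
  set Λ : ℝ × (Fin d → ℝ) → ℝ := fun p => fokkerPlanckAdjoint (A p.1) (b p.1) f p.2 with hΛ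
  have hΛc : ContinuousOn Λ (Icc t (t + T) ×ˢ univ) := by
    refine ContinuousOn.add (continuousOn_finsetSum _ fun i _ => ?_)
      (continuousOn_finsetSum _ fun i _ => continuousOn_finsetSum _ fun j _ => ?_)
    · exact (hreg.drift_continuousOn i).mul
        ((hf2.continuous_partialD i).comp continuous_snd).continuousOn
    · exact (hreg.diffusion_continuousOn i j).mul
        ((hf2.continuous_partialD_partialD i j).comp continuous_snd).continuousOn
  obtain ⟨C, hC⟩ : ∃ C : ℝ, ∀ s ∈ Icc t (t + T), ∀ y, |Λ (s, y)| ≤ C := by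
    obtain ⟨C, hC⟩ := (isCompact_Icc (a := t) (b := t + T)).prod hfs
      |>.exists_bound_of_continuousOn (hΛc.mono (prod_mono le_rfl (subset_univ _)))
    refine ⟨max C 0, fun s hs y => ?_⟩
    by_cases hy : y ∈ tsupport f
    · exact (hC (s, y) ⟨hs, hy⟩).trans (le_max_left _ _)
    · rw [show Λ (s, y) = 0 from fokkerPlanckAdjoint_eq_zero hy _ _, abs_zero]
      exact le_max_right _ _
  have ht : t ∈ Icc t (t + T) := ⟨le_rfl, by linarith⟩
  have hC0 : 0 ≤ C := (abs_nonneg _).trans (hC t ht x)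
  obtain ⟨C₁, hC₁⟩ := hG.moment_le hT.le hreg 1
  have hC₁0 : 0 ≤ C₁ := by
    have h := (integral_nonneg fun y => pow_nonneg (sqDist_nonneg x y) 1).trans
      (hC₁ T ⟨hT.le, le_rfl⟩).2
    rw [pow_one] at h
    exact nonneg_of_mul_nonneg_left h hT
  set ℓ : ℝ → ℝ := fun s => ∫ y, fokkerPlanckAdjoint (A (t + s)) (b (t + s)) f y ∂(G s)
  have hlim : ∀ ε > 0, ∃ δ > 0, ∀ s ∈ Icc 0 T, s ≤ δ → |ℓ s - Λ (t, x)| ≤ ε := by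
    intro ε hε
    obtain ⟨δ, hδ, hδc⟩ := Metric.continuousWithinAt_iff.1 (hΛc (t, x) ⟨ht, mem_univ _⟩) (ε / 2)
      (half_pos hε)
    refine ⟨min (δ / 2) (ε / 2 / (2 * C / δ ^ 2 * C₁ + 1)), by positivity, fun s hs hsδ => ?_⟩
    have hts : t + s ∈ Icc t (t + T) := ⟨by linarith [hs.1], by linarith [hs.2]⟩
    have hsδ1 : s < δ := by linarith [hsδ.trans (min_le_left _ _)]
    have hsδ2 := hsδ.trans (min_le_right _ _)
    have := hG.isProbabilityMeasure s hs
    have hΛs : Continuous fun y => Λ (t + s, y) :=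
      continuousOn_univ.1 (hΛc.comp (f := fun y => (t + s, y)) (by fun_prop)
        fun y _ => ⟨hts, mem_univ _⟩)
    have hΛi : Integrable (fun y => Λ (t + s, y)) (G s) :=
      Integrable.of_bound hΛs.aestronglyMeasurable C (ae_of_all _ fun y => hC _ hts y)
    obtain ⟨hri, hrb⟩ := hC₁ s hs
    simp only [pow_one] at hri hrb
    have hpt : ∀ y, ‖Λ (t + s, y) - Λ (t, x)‖ ≤ ε / 2 + 2 * C / δ ^ 2 * sqDist x y := by
      intro y
      have hr := sqDist_nonneg x y
      have hq : 0 ≤ 2 * C / δ ^ 2 * sqDist x y := by positivity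
      by_cases hy : dist y x < δ
      · have hd : dist (t + s, y) (t, x) < δ := by
          rw [Prod.dist_eq, max_lt_iff]
          refine ⟨?_, hy⟩
          rw [Real.dist_eq, add_sub_cancel_left, abs_of_nonneg hs.1]
          exact hsδ1
        have := hδc (x := (t + s, y)) ⟨hts, mem_univ _⟩ hd
        rw [Real.dist_eq] at this
        rw [Real.norm_eq_abs]
        linarith
      · rw [not_lt, dist_eq_norm] at hy
        have h1 : δ ^ 2 ≤ sqDist x y :=
          (pow_le_pow_left₀ hδ.le hy 2).trans (sq_norm_sub_le_sqDist x y)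
        have h2 : 2 * C ≤ 2 * C / δ ^ 2 * sqDist x y := by
          rw [div_mul_eq_mul_div, le_div_iff₀ (by positivity)]
          exact mul_le_mul_of_nonneg_left h1 (by positivity)
        have h3 := abs_sub (Λ (t + s, y)) (Λ (t, x))
        have h4 := hC _ hts y
        have h5 := hC t ht x
        rw [Real.norm_eq_abs]
        linarith
    have h1 := norm_integral_le_of_norm_le
      ((integrable_const (ε / 2)).add (hri.const_mul (2 * C / δ ^ 2))) (ae_of_all _ hpt)
    rw [integral_sub hΛi (integrable_const _), integral_add' (integrable_const _)
      (hri.const_mul _), integral_const_mul, integral_const, integral_const, probReal_univ,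
      one_smul, one_smul] at h1
    refine h1.trans ?_
    have hc : 0 ≤ 2 * C / δ ^ 2 := by positivity
    have h2 : 2 * C / δ ^ 2 * ∫ y, sqDist x y ∂(G s) ≤ 2 * C / δ ^ 2 * (C₁ * s) :=
      mul_le_mul_of_nonneg_left hrb hc
    have h3 : (2 * C / δ ^ 2 * C₁ + 1) * s ≤ ε / 2 := by
      rwa [le_div_iff₀ (by positivity), mul_comm] at hsδ2
    nlinarith [hs.1]
  refine isLittleO_iff.2 fun ε hε => ?_
  obtain ⟨δ, hδ, hδb⟩ := hlim ε hε
  filter_upwards [Ioc_mem_nhdsGT hT, Ioc_mem_nhdsGT hδ] with h hh hhδ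
  have hℓ : IntervalIntegrable ℓ volume 0 h := (hG.intervalIntegrable f hf hfs).mono_set (by
    rw [uIcc_of_le hh.1.le, uIcc_of_le hT.le]
    exact Icc_subset_Icc_right hh.2)
  have hw := hG.weak_solution f hf hfs h ⟨hh.1.le, hh.2⟩
  have h1 : (∫ y, f y ∂(G h)) - f x - h * fokkerPlanckAdjoint (A t) (b t) f x
      = ∫ s in (0 : ℝ)..h, (ℓ s - Λ (t, x)) := by
    rw [intervalIntegral.integral_sub hℓ intervalIntegrable_const, hw,
      intervalIntegral.integral_const, sub_zero, smul_eq_mul]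
    ring
  rw [h1]
  refine (intervalIntegral.norm_integral_le_of_norm_le_const (C := ε) fun s hs => ?_).trans ?_
  · rw [uIoc_of_le hh.1.le] at hs
    exact hδb s ⟨hs.1.le, hs.2.trans hh.2⟩ (hs.2.trans hhδ.2)
  · rw [sub_zero, Real.norm_eq_abs]

/-- Smooth functions of at most quadratic growth. -/
lemma integral_isLittleO (hT : 0 < T) (hG : IsFokkerPlanckGreen t T A b x G)
    (hreg : DynamicsRegular t T A b x) {g : (Fin d → ℝ) → ℝ}
    (hg : ContDiff ℝ ((⊤ : ℕ∞) : WithTop ℕ∞) g) (hgx : g x = 0)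
    (hgb : ∀ y, 1 ≤ sqDist x y → |g y| ≤ sqDist x y)
    (hgi : ∀ h ∈ Ioc 0 T, Integrable g (G h)) :
    (fun h => (∫ y, g y ∂(G h)) - h * fokkerPlanckAdjoint (A t) (b t) g x)
      =o[𝓝[>] 0] fun h => h := by
  set χ : (Fin d → ℝ) → ℝ := fun y => Real.smoothTransition (sqDist x y - 1)
  have hχ : ContDiff ℝ ((⊤ : ℕ∞) : WithTop ℕ∞) χ :=
    Real.smoothTransition.contDiff.comp ((contDiff_sqDist x).sub contDiff_const)
  set f : (Fin d → ℝ) → ℝ := fun y => g y * (1 - χ y)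
  have hf : ContDiff ℝ ((⊤ : ℕ∞) : WithTop ℕ∞) f := hg.mul (contDiff_const.sub hχ)
  have hfs : HasCompactSupport f := by
    refine HasCompactSupport.intro (isCompact_closedBall x 2) fun y hy => ?_
    rw [Metric.mem_closedBall, dist_eq_norm, not_le] at hy
    have h1 := sq_norm_sub_le_sqDist x y
    have : χ y = 1 := Real.smoothTransition.one_of_one_le (by nlinarith)
    simp [f, this]
  have hχ0 : ∀ y, sqDist x y ≤ 1 → χ y = 0 := fun y hy =>
    Real.smoothTransition.zero_of_nonpos (by linarith)
  have hfg : f =ᶠ[𝓝 x] g := by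
    have hx : sqDist x x < 1 := by simp [sqDist]
    filter_upwards [(continuous_sqDist x).continuousAt.eventually (Iio_mem_nhds hx)] with y hy
    simp [f, hχ0 y (le_of_lt hy)]
  have hlim := hG.integral_sub_isLittleO hT hreg hf hfs
  rw [hfg.fokkerPlanckAdjoint_eq, hfg.eq_of_nhds, hgx] at hlim
  obtain ⟨C, hC⟩ := hG.moment_le hT.le hreg 2
  have htail : (fun h => (∫ y, g y ∂(G h)) - ∫ y, f y ∂(G h)) =o[𝓝[>] 0] fun h => h := by
    refine isLittleO_of_abs_le_sqrt_pow (M := 4) (C := C) (by norm_num) ?_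
    filter_upwards [Ioc_mem_nhdsGT hT] with h hh
    have hh' : h ∈ Icc 0 T := ⟨hh.1.le, hh.2⟩
    have := hG.isProbabilityMeasure h hh'
    rw [← integral_sub (hgi h hh) (hf.continuous.integrable_of_hasCompactSupport hfs),
      show Real.sqrt h ^ 4 = (Real.sqrt h ^ 2) ^ 2 by ring, Real.sq_sqrt hh.1.le]
    refine (norm_integral_le_of_norm_le (f := fun y => g y - f y) (hC h hh').1 (ae_of_all _ fun y => ?_)).trans (hC h hh').2
    have hr := sqDist_nonneg x y
    rcases le_total (sqDist x y) 1 with hy | hy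
    · simp [f, hχ0 y hy, hr]
    · have h1 : g y - f y = g y * χ y := by simp only [f]; ring
      have hχ1 : |χ y| ≤ 1 := by
        rw [abs_of_nonneg (Real.smoothTransition.nonneg _)]
        exact Real.smoothTransition.le_one _
      rw [h1, Real.norm_eq_abs, abs_mul, pow_two]
      exact mul_le_mul (hgb y hy) (hχ1.trans hy) (abs_nonneg _) hr
  refine (htail.add hlim).congr (fun h => ?_) fun _ => rfl
  ring

end IsFokkerPlanckGreen

end FokkerPlanckGenerator

section FokkerPlanckSlice

variable {d m : ℕ}

lemma fokkerPlanckAdjoint_coord (A : (Fin d → ℝ) → Fin d → ℝ)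
    (b : (Fin d → ℝ) → Fin d → Fin m → ℝ) (x : Fin d → ℝ) (i : Fin d) :
    fokkerPlanckAdjoint A b (fun z => z i - x i) x = A x i := by
  have h : ∀ k, partialD k (fun z : Fin d → ℝ => z i - x i) = fun _ => if i = k then 1 else 0 :=
    fun k => funext fun y => partialD_coord_sub x k i y
  simp [fokkerPlanckAdjoint, h, partialD_const]

lemma fokkerPlanckAdjoint_coord_mul (A : (Fin d → ℝ) → Fin d → ℝ)
    (b : (Fin d → ℝ) → Fin d → Fin m → ℝ) (x : Fin d → ℝ) (i j : Fin d) :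
    fokkerPlanckAdjoint A b (fun z => (z i - x i) * (z j - x j)) x = 2 * diffusionB b x i j := by
  have h : ∀ k, partialD k (fun z : Fin d → ℝ => (z i - x i) * (z j - x j))
      = fun z => (if i = k then 1 else 0) * (z j - x j) + (if j = k then 1 else 0) * (z i - x i) :=
    fun k => funext fun y => by
      rw [partialD_mul k (differentiable_coord_sub x i y) (differentiable_coord_sub x j y),
        partialD_coord_sub, partialD_coord_sub]
      ring
  have h2 : ∀ l k, partialD l (fun z : Fin d → ℝ => (if i = k then 1 else 0) * (z j - x j)
      + (if j = k then 1 else 0) * (z i - x i)) x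
      = (if i = k then 1 else 0) * (if j = l then 1 else 0)
        + (if j = k then 1 else 0) * (if i = l then 1 else 0) := fun l k => by
    rw [partialD_add (f := fun z : Fin d → ℝ => (if i = k then 1 else 0) * (z j - x j))
      (g := fun z : Fin d → ℝ => (if j = k then 1 else 0) * (z i - x i)) l (by fun_prop)
      (by fun_prop), partialD_const_mul l _ (differentiable_coord_sub x j x),
      partialD_const_mul l _ (differentiable_coord_sub x i x), partialD_coord_sub,
      partialD_coord_sub]
  simp only [fokkerPlanckAdjoint, h]
  simp only [h2]
  simp only [sub_self, mul_zero, add_zero, Finset.sum_const_zero, zero_add, mul_add,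
    Finset.sum_add_distrib, mul_ite, mul_one]
  simp [SliceRegular.diffusionB_comm x j i, two_mul]

theorem IsFokkerPlanckGreen.hasSliceMoments {t T : ℝ} {A : ℝ → (Fin d → ℝ) → Fin d → ℝ}
    {b : ℝ → (Fin d → ℝ) → Fin d → Fin m → ℝ} {x : Fin d → ℝ} {G : ℝ → Measure (Fin d → ℝ)}
    (hT : 0 < T) (hG : IsFokkerPlanckGreen t T A b x G) (hreg : DynamicsRegular t T A b x) :
    HasSliceMoments x (A t x) (diffusionB (b t) x) G := by
  have hsub : ∀ {h}, h ∈ Ioc 0 T → h ∈ Icc 0 T := fun hh => ⟨hh.1.le, hh.2⟩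
  have hev : ∀ᶠ h in 𝓝[>] (0 : ℝ), h ∈ Ioc 0 T := Ioc_mem_nhdsGT hT
  have hint : ∀ h ∈ Ioc 0 T, ∀ (M : ℕ) (I : Fin M → Fin d),
      Integrable (incrementMonomial x I) (G h) := by
    intro h hh M I
    have := hG.isProbabilityMeasure h (hsub hh)
    obtain ⟨C, hC⟩ := hG.moment_le hT.le hreg M
    refine ((integrable_const (1 : ℝ)).add (hC h (hsub hh)).1).mono'
      (continuous_incrementMonomial x I).aestronglyMeasurable (ae_of_all _ fun y => ?_)
    have h1 : ‖y - x‖ ^ M * ‖y - x‖ ^ M ≤ sqDist x y ^ M := by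
      rw [← mul_pow, ← pow_two]
      exact pow_le_pow_left₀ (by positivity) (sq_norm_sub_le_sqDist x y) M
    have h2 := abs_incrementMonomial_le x I y
    change |incrementMonomial x I y| ≤ 1 + sqDist x y ^ M
    nlinarith [sq_nonneg (‖y - x‖ ^ M - 1)]
  have hcoord : ∀ i y, |y i - x i| ≤ ‖y - x‖ := fun i y => norm_le_pi_norm (y - x) i
  refine HasSliceMoments.of_bounds ?_ ?_ (fun i => ?_) (fun i j => ?_) ?_
  · filter_upwards [hev] with h hh using hint h hh
  · refine (isLittleO_zero _ _).congr' ?_ EventuallyEq.rfl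
    filter_upwards [hev] with h hh
    have := hG.isProbabilityMeasure h (hsub hh)
    simp
  · rw [← fokkerPlanckAdjoint_coord (A t) (b t) x i]
    refine hG.integral_isLittleO hT hreg (g := fun z => z i - x i)
      ((contDiff_apply ℝ ℝ i).sub contDiff_const) (sub_self _) (fun y hy => ?_) fun h hh => ?_
    · nlinarith [hcoord i y, sq_norm_sub_le_sqDist x y, norm_nonneg (y - x)]
    · exact (hint h hh 1 fun _ => i).congr (ae_of_all _ fun y => by simp [incrementMonomial])
  · rw [← fokkerPlanckAdjoint_coord_mul (A t) (b t) x i j]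
    refine hG.integral_isLittleO hT hreg (g := fun z => (z i - x i) * (z j - x j))
      (((contDiff_apply ℝ ℝ i).sub contDiff_const).mul
        ((contDiff_apply ℝ ℝ j).sub contDiff_const)) (by simp) (fun y hy => ?_) fun h hh => ?_
    · rw [abs_mul]
      refine (mul_le_mul (hcoord i y) (hcoord j y) (abs_nonneg _) (norm_nonneg _)).trans ?_
      rw [← pow_two]
      exact sq_norm_sub_le_sqDist x y
    · exact (hint h hh 2 ![i, j]).congr (ae_of_all _ fun y => by simp [incrementMonomial])
  · intro M I _
    obtain ⟨k, rfl | rfl⟩ : ∃ k, M = 2 * k ∨ M = 2 * k + 1 := by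
      obtain ⟨k, hk⟩ := Nat.even_or_odd' M
      exact ⟨k, hk⟩
    · obtain ⟨C, hC⟩ := hG.moment_le hT.le hreg k
      refine ⟨C, ?_⟩
      filter_upwards [hev] with h hh
      rw [pow_mul, Real.sq_sqrt hh.1.le]
      refine (norm_integral_le_of_norm_le (f := incrementMonomial x I) (hC h (hsub hh)).1
        (ae_of_all _ fun y => ?_)).trans (hC h (hsub hh)).2
      refine (abs_incrementMonomial_le x I y).trans ?_
      rw [pow_mul]
      exact pow_le_pow_left₀ (by positivity) (sq_norm_sub_le_sqDist x y) k
    · obtain ⟨C, hC⟩ := hG.moment_le hT.le hreg k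
      obtain ⟨C', hC'⟩ := hG.moment_le hT.le hreg (k + 1)
      refine ⟨C + C', ?_⟩
      filter_upwards [hev] with h hh
      obtain ⟨hi, hb⟩ := hC h (hsub hh)
      obtain ⟨hi', hb'⟩ := hC' h (hsub hh)
      have hs : 0 < Real.sqrt h := Real.sqrt_pos.2 hh.1
      have hsq : Real.sqrt h ^ 2 = h := Real.sq_sqrt hh.1.le
      have hbd : ∀ y, ‖incrementMonomial x I y‖
          ≤ Real.sqrt h * sqDist x y ^ k + (Real.sqrt h)⁻¹ * sqDist x y ^ (k + 1) := fun y => by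
        have hr := sqDist_nonneg x y
        have hn := norm_nonneg (y - x)
        have h1 : ‖y - x‖ ^ (2 * k) ≤ sqDist x y ^ k := by
          rw [pow_mul]
          exact pow_le_pow_left₀ (by positivity) (sq_norm_sub_le_sqDist x y) k
        have h2 : ‖y - x‖ ≤ Real.sqrt h + (Real.sqrt h)⁻¹ * sqDist x y := by
          have h3 : Real.sqrt h * ‖y - x‖ ≤ Real.sqrt h ^ 2 + sqDist x y := by
            nlinarith [sq_norm_sub_le_sqDist x y, sq_nonneg (Real.sqrt h - ‖y - x‖)]
          calc ‖y - x‖ = (Real.sqrt h)⁻¹ * (Real.sqrt h * ‖y - x‖) := by field_simp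
            _ ≤ (Real.sqrt h)⁻¹ * (Real.sqrt h ^ 2 + sqDist x y) :=
              mul_le_mul_of_nonneg_left h3 (inv_nonneg.2 hs.le)
            _ = _ := by field_simp
        calc ‖incrementMonomial x I y‖ ≤ ‖y - x‖ ^ (2 * k + 1) := abs_incrementMonomial_le x I y
          _ = ‖y - x‖ ^ (2 * k) * ‖y - x‖ := pow_succ _ _
          _ ≤ sqDist x y ^ k * (Real.sqrt h + (Real.sqrt h)⁻¹ * sqDist x y) :=
            mul_le_mul h1 h2 hn (by positivity)
          _ = _ := by ring
      refine (norm_integral_le_of_norm_le ((hi.const_mul _).add (hi'.const_mul _))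
        (ae_of_all _ hbd)).trans ?_
      rw [integral_add' (hi.const_mul _) (hi'.const_mul _), integral_const_mul, integral_const_mul]
      calc _ ≤ Real.sqrt h * (C * h ^ k) + (Real.sqrt h)⁻¹ * (C' * h ^ (k + 1)) :=
            add_le_add (mul_le_mul_of_nonneg_left hb hs.le)
              (mul_le_mul_of_nonneg_left hb' (inv_nonneg.2 hs.le))
        _ = Real.sqrt h * (C * (Real.sqrt h ^ 2) ^ k)
            + (Real.sqrt h)⁻¹ * (C' * (Real.sqrt h ^ 2) ^ (k + 1)) := by rw [hsq]
        _ = (C + C') * Real.sqrt h ^ (2 * k + 1) := by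
            field_simp
            ring

end FokkerPlanckSlice

/-! ### The Stratonovich form -/

section Stratonovich

variable {d m : ℕ} {F : (Fin d → ℝ) → Fin d → ℝ} {b : (Fin d → ℝ) → Fin d → Fin m → ℝ}

lemma ContDiff.partialD_partialD_comm (hb : ContDiff ℝ 2 b) (i j k : Fin d) (μ : Fin m)
    (y : Fin d → ℝ) :
    partialD i (partialD j (fun z => b z k μ)) y = partialD j (partialD i (fun z => b z k μ)) y := by
  rw [partialD_partialD_coord₂ hb, partialD_partialD_coord₂ hb,
    (hb.contDiffAt.isSymmSndFDerivAt (by simp)).eq]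

namespace SliceRegular

lemma sum_partialD_diffusionB (hreg : SliceRegular F b) (y : Fin d → ℝ) (i : Fin d) :
    ∑ j, partialD j (fun z => diffusionB b z i j) y
      = (1 / 2) * noiseDrift b y i
        + (1 / 2) * ∑ k, ∑ μ, b y i μ * partialD k (fun z => b z k μ) y := by
  have hd : ∀ i μ, DifferentiableAt ℝ (fun z => b z i μ) y := fun i μ => (hreg.noise i μ).1 y
  have h : ∀ j, partialD j (fun z => diffusionB b z i j) y
      = (1 / 2) * (∑ μ, b y j μ * partialD j (fun z => b z i μ) y)
        + (1 / 2) * ∑ μ, b y i μ * partialD j (fun z => b z j μ) y := fun j => by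
    simp only [diffusionB, Matrix.of_apply]
    rw [partialD_const_mul (f := fun z => ∑ μ, b z i μ * b z j μ) j _
        (DifferentiableAt.fun_sum fun μ _ => (hd i μ).mul (hd j μ)),
      partialD_sum _ (f := fun μ z => b z i μ * b z j μ) j fun μ _ => (hd i μ).mul (hd j μ)]
    simp only [partialD_mul j (hd i _) (hd j _), Finset.sum_add_distrib, mul_add,
      mul_comm (partialD j (fun z => b z i _) y)]
  simp only [h, Finset.sum_add_distrib, ← Finset.mul_sum, noiseDrift]

lemma spuriousDrift_half (hreg : SliceRegular F b) (y : Fin d → ℝ) (i : Fin d) :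
    spuriousDrift (1 / 2) (1 / 2) b y i
      = - ((1 / 2) * ∑ k, ∑ μ, b y i μ * partialD k (fun z => b z k μ) y) := by
  rw [spuriousDrift, hreg.sum_partialD_diffusionB]
  ring

lemma extraTerms_half (hreg : SliceRegular F b) (hb : ContDiff ℝ 2 b) (z : Fin d → ℝ) :
    extraTerms (1 / 2) (1 / 2) F b z
      = - (1 / 2) * ∑ i, partialD i (fun w => F w i) z
        + (1 / 8) * ∑ i, ∑ j, ∑ μ,
          (partialD i (fun w => b w i μ) z * partialD j (fun w => b w j μ) z
            - partialD i (fun w => b w j μ) z * partialD j (fun w => b w i μ) z) := by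
  have hd : ∀ i μ, DifferentiableAt ℝ (fun w => b w i μ) z := fun i μ => (hreg.noise i μ).1 z
  have hd2 : ∀ k i μ, DifferentiableAt ℝ (partialD k (fun w => b w i μ)) z := fun k i μ =>
    ((hreg.noise i μ).2.2 k).1 z
  have hN : ∀ i, partialD i (fun w => noiseDrift b w i) z
      = ∑ k, ∑ μ, (partialD i (fun w => b w k μ) z * partialD k (fun w => b w i μ) z
        + b z k μ * partialD i (partialD k (fun w => b w i μ)) z) := fun i => by
    simp only [noiseDrift]
    rw [partialD_sum _ (f := fun k w => ∑ μ, b w k μ * partialD k (fun y => b y i μ) w) i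
      fun k _ => DifferentiableAt.fun_sum fun μ _ => (hd k μ).mul (hd2 k i μ)]
    refine Finset.sum_congr rfl fun k _ => ?_
    rw [partialD_sum _ (f := fun μ w => b w k μ * partialD k (fun y => b y i μ) w) i
      fun μ _ => (hd k μ).mul (hd2 k i μ)]
    exact Finset.sum_congr rfl fun μ _ => partialD_mul i (hd k μ) (hd2 k i μ)
  have hM : ∀ i, partialD i (fun w => ∑ k, ∑ μ, b w i μ * partialD k (fun y => b y k μ) w) z
      = ∑ k, ∑ μ, (partialD i (fun w => b w i μ) z * partialD k (fun w => b w k μ) z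
        + b z i μ * partialD i (partialD k (fun w => b w k μ)) z) := fun i => by
    rw [partialD_sum _ (f := fun k w => ∑ μ, b w i μ * partialD k (fun y => b y k μ) w) i
      fun k _ => DifferentiableAt.fun_sum fun μ _ => (hd i μ).mul (hd2 k k μ)]
    refine Finset.sum_congr rfl fun k _ => ?_
    rw [partialD_sum _ (f := fun μ w => b w i μ * partialD k (fun y => b y k μ) w) i
      fun μ _ => (hd i μ).mul (hd2 k k μ)]
    exact Finset.sum_congr rfl fun μ _ => partialD_mul i (hd i μ) (hd2 k k μ)
  have hBB : ∀ i, ∑ j, partialD i (partialD j (fun w => diffusionB b w i j)) z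
      = (1 / 2) * partialD i (fun w => noiseDrift b w i) z
        + (1 / 2) * partialD i (fun w => ∑ k, ∑ μ, b w i μ * partialD k (fun y => b y k μ) w) z := by
    intro i
    have h1 : DifferentiableAt ℝ (fun w => noiseDrift b w i) z := (hreg.noiseDrift_bddC i).1 z
    have h2 : DifferentiableAt ℝ
        (fun w => ∑ k, ∑ μ, b w i μ * partialD k (fun y => b y k μ) w) z :=
      DifferentiableAt.fun_sum fun k _ => DifferentiableAt.fun_sum fun μ _ =>
        (hd i μ).mul (hd2 k k μ)
    rw [← partialD_sum _ i fun j _ => ((hreg.diffusionB_bddC i j).2.2 j).1 z,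
      funext fun w => hreg.sum_partialD_diffusionB w i,
      partialD_add (f := fun w => (1 / 2) * noiseDrift b w i)
        (g := fun w => (1 / 2) * ∑ k, ∑ μ, b w i μ * partialD k (fun y => b y k μ) w) i
        (h1.const_mul _) (h2.const_mul _),
      partialD_const_mul i _ h1, partialD_const_mul i _ h2]
  have hsymm : ∑ i, ∑ k, ∑ μ, b z k μ * partialD i (partialD k (fun w => b w i μ)) z
      = ∑ i, ∑ k, ∑ μ, b z i μ * partialD i (partialD k (fun w => b w k μ)) z := by
    rw [Finset.sum_comm]
    simp only [hb.partialD_partialD_comm]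
  simp only [extraTerms, hBB, hN, hM, Finset.sum_add_distrib, ← Finset.mul_sum,
    Finset.sum_sub_distrib, hsymm]
  ring

end SliceRegular

end Stratonovich

end

theorem mainTheorem8 {d m : ℕ} (t T : ℝ) (hT : 0 < T)
    (F : ℝ → (Fin d → ℝ) → Fin d → ℝ) (b : ℝ → (Fin d → ℝ) → Fin d → Fin m → ℝ)
    (hreg : RegularCoefficients t T F b)
    (α αb θ : ℝ) (hα : α ∈ Icc (0 : ℝ) 1) (hαb : αb ∈ Icc (0 : ℝ) 1) (hθ : θ ∈ Icc (0 : ℝ) 1)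
    (x : Fin d → ℝ) :
    -- the law of `x₁ = x + dx`, with `dx` from the `ᾱ`-Langevin equation
    (∀ (Ω : Type*) [MeasurableSpace Ω] (P : Measure Ω) [IsProbabilityMeasure P]
      (dW : ℝ → Ω → Fin m → ℝ) (dx : ℝ → Ω → Fin d → ℝ),
      IsLangevinIncrement αb t T F b x P dW dx →
      MomentEquivalent x (fun h => P.map (fun ω => x + dx h ω))
        (fun h => densityMeasure (sliceDensity α αb θ (F t) (b t) h x))) ∧
    -- the exact Green's function of the Fokker-Planck equation of that dynamics
    (∀ G : ℝ → Measure (Fin d → ℝ),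
      IsFokkerPlanckGreen t T (fun s => itoDrift αb (F s) (b s)) b x G →
      MomentEquivalent x G
        (fun h => densityMeasure (sliceDensity α αb θ (F t) (b t) h x))) ∧
    -- the Gaussian representation of the equivalent Ito equation
    MomentEquivalent x
      (fun h => densityMeasure (itoDensity (itoDrift αb (F t) (b t)) (b t) h x))
      (fun h => densityMeasure (sliceDensity α αb θ (F t) (b t) h x)) ∧
    -- the case `α = ᾱ = 1/2` is the Stratonovich form
    (∀ h : ℝ, 0 < h → ∀ x₁ : Fin d → ℝ,
      sliceDensity (1 / 2) (1 / 2) θ (F t) (b t) h x x₁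
        = stratonovichDensity θ (F t) (b t) h x x₁) := by
  have ht : t ∈ Icc t (t + T) := ⟨le_rfl, by linarith⟩
  have hs := hreg.sliceRegular ht
  have hS := hs.hasSliceMoments_slice hα αb θ x
  refine ⟨fun Ω _ P _ dW dx hL => (hL.hasSliceMoments hT hs hαb).momentEquivalent hS,
    fun G hG => (hG.hasSliceMoments hT
      (hreg.dynamicsRegular hT.le hαb x)).momentEquivalent hS, ?_, fun h _ x₁ => ?_⟩
  · have h0 := hs.hasSliceMoments_slice (α := 0) ⟨le_rfl, zero_le_one⟩ αb θ x
    have heq : ∀ h, itoDensity (itoDrift αb (F t) (b t)) (b t) h x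
        = sliceDensity 0 αb θ (F t) (b t) h x := fun h => by
      funext x₁
      have he : ∀ z, extraTerms 0 αb (F t) (b t) z = 0 := fun z => by simp [extraTerms]
      have hu : ∀ i, (x₁ - x) i - itoDrift αb (F t) (b t) x i * h
          = (x₁ - x) i - F t x i * h - spuriousDrift 0 αb (b t) x i * h := fun i => by
        simp only [itoDrift, spuriousDrift]
        ring
      simp only [itoDensity, sliceDensity, zero_smul, add_zero, he, zero_mul, hu]
    simp only [heq]
    exact h0.momentEquivalent hS
  · simp only [sliceDensity, stratonovichDensity, hs.spuriousDrift_half,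
      hs.extraTerms_half (hreg.b_contDiff t ht), neg_mul, sub_neg_eq_add]
    congr 2
    ring
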